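/- **Notation.** Let $M$ be the space of smooth real $2\pi$-periodic functions $u(x)$ with $\int_0^{2\pi}u\,dx=0$, let $(f,g)=\int_0^{2\pi}fg\,dx$, $\partial=D_x=\partial/\partial x$, let $D_x^{-1}u\in M$ be the periodic primitive of zero mean of $u\in M$, and let $\bar u=u_{xx}+1/3$. Tangent vectors are elements of $M$; covectors are represented by elements of $M$ through $(\cdot,\cdot)$. A map on $M$ is smooth if it sends smooth finite-parameter families to smooth families. The Ostrovsky–Vakhnenko system is $du/dt=K[u]:=-uu_x-D_x^{-1}u$ on $M$. Let $\vartheta=D_x$, and let $\eta$ be $$\eta=\partial^{-1}\bar u\partial^{-3}\bar u\partial^{-1}+4\partial^{-2}\bar u\partial^{-1}\bar u\partial^{-2}+2(\partial^{-2}\bar u\partial^{-2}\bar u\partial^{-1}+\partial^{-1}\bar u\partial^{-2}\bar u\partial^{-2}),$$ where $\partial^{-1}$ denotes taking a primitive. That is, $v\in M$ is a value of $\eta$ at $\varphi\in M$ if there are a smooth periodic $\psi$ ("$\partial^{-2}\varphi$") with $\psi_{xx}=\varphi$ and smooth functions $a,b,w_1,\dots,w_4$ on $\mathbb R$ with $a_{xxx}=\bar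 u\psi_x$, $b_{xx}=\bar u\psi$, $(w_1)_x=\bar ua$, $(w_2)_{xx}=\bar ub_x$, $(w_3)_{xx}=\bar ua_x$, $(w_4)_x=\bar ub$, such that $\chi=a+2b$ is periodic and $v=w_1+4w_2+2(w_3+w_4)$. So at each $u$, $\eta$ is a linear relation: covectors for which the required periodic primitives do not exist are outside its domain, and different choices of primitives may give different values. A *Poisson structure* on $M$ is a family of linear relations $R_u$ from covectors to vectors such that (i) $R_u$ is skew-adjoint for every $u$: $v\in R_u\varphi$ if and only if $(\varphi,v')+(\varphi',v)=0$ for all $\varphi'$ and all $v'\in R_u\varphi'$; and (ii) the Jacobi identity holds: for all smooth sections $v_i\in R\varphi_i$ ($i=1,2,3$), the cyclic sum of $(L_{v_1}\varphi_2,v_3)$ vanishes, where $L$ is the Lie derivative of one-forms. **Proposition 3.2.** 1. (Lax representation.) Let $J\subseteq\mathbb R$ be an open interval, $u(t)\in M$, $t\in J$, a smooth curve, $D_t=\partial/\partial t+u\,\partial/\partial x$, and $\mu\in\mathbb C\setminus\{0\}$. The following are equivalent: (a) $u$ solves $du/dt=K[u]$; (b) the linear system $$D_x^3f=-\mu\bar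 uf,\qquad D_tf=\mu^{-1}D_x^2f+u_xf\qquad(*)$$ is compatible, i.e. it has a smooth complex solution on $J\times\mathbb R$ with arbitrarily prescribed $(f,D_xf,D_x^2f)$ at an arbitrary point; (c) the adjoint system $D_x^3\bar f=\mu\bar u\bar f$, $D_t\bar f=-\mu^{-1}D_x^2\bar f+u_x\bar f$ is compatible in the same sense; (d) $D_t\hat l=[\hat q,\hat l]+D_x\hat q-u_x\hat l$ on $J\times\mathbb R$, where $$\hat q=\begin{pmatrix}u_x&0&1/\mu\\-1/3&0&0\\0&-1/3&-u_x\end{pmatrix},\qquad \hat l=\begin{pmatrix}0&1&0\\0&0&1\\-\mu\bar u&0&0\end{pmatrix}.$$ Moreover, for every smooth curve $u$ in $M$, a smooth $f$ satisfies $(*)$ if and only if $h=(f,D_xf,D_x^2f)^{\intercal}$ satisfies $D_th=\hat qh$, $D_xh=\hat lh$, and every smooth solution $h$ of the latter system has this form. 2. (Compatible Poisson structures.) $\vartheta$, $\eta$ and every $\eta+\kappa\vartheta$, $\kappa\in\mathbb R$, are Poisson structures on $M$. 3. (Bi-Hamiltonian flow.) $K$ is a smooth vector field on $M$, and it is Hamiltonian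 for both structures: $K=-\vartheta\,\mathrm{grad}\,H$ with $H=\frac12\int_0^{2\pi}[u^3/3-(D_x^{-1}u)^2]\,dx$, and $-K$ is a value of $\eta$ at $\mathrm{grad}\,\bar H$ with $\bar H=\frac12\int_0^{2\pi}\bar u\,dx$, namely one obtained with $\psi=1/2$ (here $\mathrm{grad}\,\bar H=D_x^2(1/2)=0$, so this is a value of $\eta$ at the zero covector). 4. (Conservation laws.) With the recursion operator $\Lambda=\vartheta^{-1}\eta$ there are smooth maps $\varphi_j:M\to M$, $j\ge0$, such that $\vartheta\varphi_0=0$, $\varphi_{j+1}$ is a value of $\Lambda$ at $\varphi_j$ for every $j\ge 0$ (for $j=0$, one obtained with $\psi=1$), and such that the functionals $$\tilde\gamma_j[u]=\int_0^1(\varphi_j[us],u)\,ds$$ are smooth, satisfy $\mathrm{grad}\,\tilde\gamma_j=\varphi_j$, and are constant along every smooth solution of $du/dt=K[u]$ on an open interval. They are in involution with respect to both structures: $(\varphi_i,\vartheta\varphi_j)=0$, and $(\varphi_i,v)=0$ for every value $v$ of $\eta$ at $\varphi_j$, for all $i,j\ge 0$. The functionals $\tilde\gamma_j$, $j\ge1$,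 are linearly independent over $\mathbb R$. -/

import Mathlib

open scoped ContDiff

noncomputable section

namespace OV

/-! ### Smooth `2π`-periodic functions and the phase space -/

/-- Smooth real `2π`-periodic functions. -/
def Per : Submodule ℝ (ℝ → ℝ) where
  carrier := {w | ContDiff ℝ ∞ w ∧ Function.Periodic w (2 * Real.pi)}
  add_mem' := fun ha hb => ⟨ha.1.add hb.1, ha.2.add hb.2⟩
  zero_mem' := ⟨contDiff_const, fun _ => rfl⟩
  smul_mem' := fun c _ ha => ⟨contDiff_const.smul ha.1, fun x => by simp [ha.2 x]⟩

/-- The `L²` pairing over one period. -/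
def pair (f g : ℝ → ℝ) : ℝ := ∫ x in (0 : ℝ)..(2 * Real.pi), f x * g x

/-- The phase space: smooth real `2π`-periodic functions of zero mean. It is a linear space, so
tangent vectors are again elements of `M`; covectors (smooth periodic functions modulo constants)
are represented, through `pair`, by their unique representatives of zero mean, again in `M`. -/
def M : Submodule ℝ (ℝ → ℝ) where
  carrier := {w | w ∈ Per ∧ ∫ x in (0 : ℝ)..(2 * Real.pi), w x = 0}
  add_mem' := by
    intro a b ha hb
    refine ⟨Per.add_mem ha.1 hb.1, ?_⟩
    have h := intervalIntegral.integral_add (μ := MeasureTheory.volume)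
      (ha.1.1.continuous.intervalIntegrable 0 (2 * Real.pi))
      (hb.1.1.continuous.intervalIntegrable 0 (2 * Real.pi))
    simp only [Pi.add_apply]
    rw [h, ha.2, hb.2, add_zero]
  zero_mem' := ⟨Per.zero_mem, by simp⟩
  smul_mem' := by
    intro c a ha
    refine ⟨Per.smul_mem c ha.1, ?_⟩
    simp [ha.2]

theorem deriv_mem_Per {w : ℝ → ℝ} (hw : w ∈ Per) : deriv w ∈ Per :=
  ⟨(contDiff_infty_iff_deriv.mp hw.1).2, fun x => by
    have h : (fun y => w (y + 2 * Real.pi)) = w := funext hw.2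
    rw [← deriv_comp_add_const, h]⟩

theorem deriv_mem_M {w : ℝ → ℝ} (hw : w ∈ Per) : deriv w ∈ M := by
  refine ⟨deriv_mem_Per hw, ?_⟩
  have hd := contDiff_infty_iff_deriv.mp hw.1
  rw [intervalIntegral.integral_deriv_eq_sub (fun x _ => hd.1 x)
    (hd.2.continuous.intervalIntegrable _ _)]
  have h := hw.2 0
  rw [zero_add] at h
  rw [h, sub_self]

theorem contDiff_primitive {w : ℝ → ℝ} (hw : ContDiff ℝ ∞ w) :
    ContDiff ℝ ∞ (fun x => ∫ y in (0 : ℝ)..x, w y) := by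
  have h : ∀ x, HasDerivAt (fun x => ∫ y in (0 : ℝ)..x, w y) (w x) x := fun x =>
    (hw.continuous.integral_hasStrictDerivAt 0 x).hasDerivAt
  refine contDiff_infty_iff_deriv.mpr ⟨fun x => (h x).differentiableAt, ?_⟩
  rwa [show deriv (fun x => ∫ y in (0 : ℝ)..x, w y) = w from funext fun x => (h x).deriv]

theorem primitive_mem_Per {w : ℝ → ℝ} (hw : w ∈ M) :
    (fun x => ∫ y in (0 : ℝ)..x, w y) ∈ Per := by
  refine ⟨contDiff_primitive hw.1.1, fun x => ?_⟩
  have hi : ∀ a b : ℝ, IntervalIntegrable w MeasureTheory.volume a b :=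
    fun a b => hw.1.1.continuous.intervalIntegrable a b
  have h := hw.1.2.intervalIntegral_add_eq x 0
  rw [zero_add, hw.2] at h
  change (∫ y in (0 : ℝ)..(x + 2 * Real.pi), w y) = ∫ y in (0 : ℝ)..x, w y
  rw [← intervalIntegral.integral_add_adjacent_intervals (hi 0 x) (hi x _), h, add_zero]

/-- The mean value over one period. -/
def mean (w : ℝ → ℝ) : ℝ := (2 * Real.pi)⁻¹ * ∫ x in (0 : ℝ)..(2 * Real.pi), w x

theorem sub_mean_mem_M {w : ℝ → ℝ} (hw : w ∈ Per) : (fun x => w x - mean w) ∈ M := by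
  refine ⟨⟨hw.1.sub contDiff_const, fun x => by simp [hw.2 x]⟩, ?_⟩
  rw [intervalIntegral.integral_sub (hw.1.continuous.intervalIntegrable _ _)
    (continuous_const.intervalIntegrable _ _), intervalIntegral.integral_const]
  have h : (2 * Real.pi) ≠ 0 := by positivity
  simp only [mean, sub_zero, smul_eq_mul]
  field_simp
  simp

theorem mul_deriv_mem_M (u : M) : (fun x => u.1 x * deriv u.1 x) ∈ M := by
  have hu := u.2.1
  have hP : (fun x => u.1 x * u.1 x / 2) ∈ Per :=
    ⟨(hu.1.mul hu.1).div_const 2, fun x => by simp [hu.2 x]⟩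
  have h : deriv (fun x => u.1 x * u.1 x / 2) = fun x => u.1 x * deriv u.1 x := by
    funext x
    have hd := ((contDiff_infty_iff_deriv.mp hu.1).1 x).hasDerivAt
    have := ((hd.mul hd).div_const 2).deriv
    refine (Eq.trans this ?_)
    ring
  exact h ▸ deriv_mem_M hP

/-- `D_x : M → M`. -/
def Dx (u : M) : M := ⟨deriv u.1, deriv_mem_M u.2.1⟩

/-- `D_x⁻¹ : M → M`, the periodic primitive of zero mean. -/
def Dinv (u : M) : M :=
  ⟨fun x => (∫ y in (0 : ℝ)..x, u.1 y) - mean (fun z => ∫ y in (0 : ℝ)..z, u.1 y),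
    sub_mean_mem_M (primitive_mem_Per u.2)⟩

/-- The Ostrovsky-Vakhnenko vector field `K[u] = -u u_x - D_x⁻¹ u` on `M`. -/
def K (u : M) : M := -⟨fun x => u.1 x * deriv u.1 x, mul_deriv_mem_M u⟩ - Dinv u

/-- `ū = u_xx + 1/3`. -/
def ubar (u : ℝ → ℝ) (x : ℝ) : ℝ := iteratedDeriv 2 u x + 1 / 3

/-! ### Smooth maps on `M`

A map on `M` is smooth when it sends smooth finite-parameter families to smooth families. -/

/-- A smooth `k`-parameter family of elements of `M`. -/
def SmoothFamily {k : ℕ} (p : (Fin k → ℝ) → M) : Prop :=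
  ContDiff ℝ ∞ (fun z : (Fin k → ℝ) × ℝ => (p z.1).1 z.2)

/-- A smooth map `M → M`. -/
def SmoothMap (Φ : M → M) : Prop :=
  ∀ (k : ℕ) (p : (Fin k → ℝ) → M), SmoothFamily p → SmoothFamily (fun s => Φ (p s))

/-- A smooth functional on `M`. -/
def SmoothFunctional (F : M → ℝ) : Prop :=
  ∀ (k : ℕ) (p : (Fin k → ℝ) → M), SmoothFamily p → ContDiff ℝ ∞ (fun s => F (p s))

/-- The directional derivative of `Φ : M → M` at `u` along `v`. -/
def dirDeriv (Φ : M → M) (u v : M) (x : ℝ) : ℝ := deriv (fun s : ℝ => (Φ (u + s • v)).1 x) 0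

/-- `g = grad F`, the gradient with respect to `pair`. -/
def HasGrad (F : M → ℝ) (g : M → M) : Prop :=
  ∀ u v : M, HasDerivAt (fun s : ℝ => F (u + s • v)) (pair (g u).1 v.1) 0

/-! ### Poisson structures

A Poisson structure is a family `R` of linear relations from covectors to vectors: `R u φ v` says
that `φ` is in the domain of the structure at `u` and that `v` is a value of it at `φ`. An operator
`T*(M) → T(M)` is the case where every `R u` is a graph. -/

/-- `⟨L_v φ, w⟩` at `u`: the Lie derivative of the one-form `φ` along the vector field `v`,
evaluated on the vector field `w`. -/
def lieTerm (v φ w : M → M) (u : M) : ℝ :=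
  pair (dirDeriv φ u (v u)) (w u).1 + pair (φ u).1 (dirDeriv v u (w u))

/-- `R` is a (possibly not everywhere defined or multivalued) Poisson structure, that is, a Dirac
structure: at each point `R u` is skew-adjoint (equal to minus its adjoint relation), and the
Jacobi identity holds in the form of Dorfman: the cyclic sum of `⟨L_{v₁} φ₂, v₃⟩` vanishes for all
smooth sections. When each `R u` is the graph of an operator `P`, this says that `P` is
skew-adjoint and that the bracket `(grad F, P grad G)` satisfies the Jacobi identity. -/
structure IsPoisson (R : M → M → M → Prop) : Prop where
  skewAdjoint : ∀ u φ v : M, R u φ v ↔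
    ∀ φ' v' : M, R u φ' v' → pair φ.1 v'.1 + pair φ'.1 v.1 = 0
  jacobi : ∀ φ₁ φ₂ φ₃ v₁ v₂ v₃ : M → M,
    SmoothMap φ₁ → SmoothMap φ₂ → SmoothMap φ₃ → SmoothMap v₁ → SmoothMap v₂ → SmoothMap v₃ →
    (∀ u, R u (φ₁ u) (v₁ u)) → (∀ u, R u (φ₂ u) (v₂ u)) → (∀ u, R u (φ₃ u) (v₃ u)) →
    ∀ u, lieTerm v₁ φ₂ v₃ u + lieTerm v₂ φ₃ v₁ u + lieTerm v₃ φ₁ v₂ u = 0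

/-- `ϑ = D_x`. -/
def theta (_u φ v : M) : Prop := v = Dx φ

/-- The operator
`η = ∂⁻¹ū∂⁻³ū∂⁻¹ + 4∂⁻²ū∂⁻¹ū∂⁻² + 2(∂⁻²ū∂⁻²ū∂⁻¹ + ∂⁻¹ū∂⁻²ū∂⁻²)`
applied to `φ = ψ_xx` (so `ψ = ∂⁻²φ`, `ψ_x = ∂⁻¹φ`), with its intermediate primitives displayed:
`a = ∂⁻³ū∂⁻¹φ`, `b = ∂⁻²ū∂⁻²φ`, `w₁ = ∂⁻¹ūa`, `w₂ = ∂⁻²ūb_x`, `w₃ = ∂⁻²ūa_x`, `w₄ = ∂⁻¹ūb`,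
`v = w₁ + 4w₂ + 2(w₃ + w₄)`. Single terms may fail to be periodic; what has to be periodic is
`ψ`, the total factor `χ = a + 2b` in front of which the last `ū` stands, and the value `v`. -/
def EtaVia (u : M) (ψ χ : Per) (v : M) : Prop :=
  ∃ a b w₁ w₂ w₃ w₄ : ℝ → ℝ,
    (ContDiff ℝ ∞ a ∧ ContDiff ℝ ∞ b ∧ ContDiff ℝ ∞ w₁ ∧ ContDiff ℝ ∞ w₂ ∧ ContDiff ℝ ∞ w₃ ∧
      ContDiff ℝ ∞ w₄) ∧
    (∀ x, iteratedDeriv 3 a x = ubar u.1 x * deriv ψ.1 x) ∧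
    (∀ x, iteratedDeriv 2 b x = ubar u.1 x * ψ.1 x) ∧
    (∀ x, χ.1 x = a x + 2 * b x) ∧
    (∀ x, deriv w₁ x = ubar u.1 x * a x) ∧
    (∀ x, iteratedDeriv 2 w₂ x = ubar u.1 x * deriv b x) ∧
    (∀ x, iteratedDeriv 2 w₃ x = ubar u.1 x * deriv a x) ∧
    (∀ x, deriv w₄ x = ubar u.1 x * b x) ∧
    (∀ x, v.1 x = w₁ x + 4 * w₂ x + 2 * (w₃ x + w₄ x))

/-- `η` as a linear relation at `u`: `v` is a value of `η` at the covector `φ`. -/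
def eta (u φ v : M) : Prop :=
  ∃ ψ χ : Per, (∀ x, iteratedDeriv 2 ψ.1 x = φ.1 x) ∧ EtaVia u ψ χ v

/-- The pencil `η + κ ϑ`. -/
def pencil (κ : ℝ) (u φ v : M) : Prop := ∃ w : M, eta u φ w ∧ v = w + κ • Dx φ

/-- The recursion operator `Λ = ϑ⁻¹ η`: `φ'` is a value of `Λ` at `φ`. -/
def Recursion (u φ φ' : M) : Prop := ∃ w : M, eta u φ w ∧ theta u φ' w

/-! ### Solutions and the Lax representation

All complex-valued functions of `(t, x)` are considered over `t ∈ J`, `x ∈ ℝ`. -/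

/-- `t ↦ u t`, `t ∈ J`, is a smooth curve in `M`. -/
def SmoothCurve (J : Set ℝ) (u : ℝ → M) : Prop :=
  ContDiffOn ℝ ∞ (fun z : ℝ × ℝ => (u z.1).1 z.2) (J ×ˢ Set.univ)

/-- `du/dt = K[u]` on `J`. -/
def IsSolution (J : Set ℝ) (u : ℝ → M) : Prop :=
  ∀ t ∈ J, ∀ x, deriv (fun s => (u s).1 x) t = (K (u t)).1 x

/-- `D_t = ∂/∂t + u ∂/∂x`. -/
def Dt (u : ℝ → M) (f : ℝ → ℝ → ℂ) (t x : ℝ) : ℂ :=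
  deriv (fun s => f s x) t + ((u t).1 x : ℂ) * deriv (f t) x

/-- `D_x³ f = -μ ū f`, `D_t f = μ⁻¹ D_x² f + u_x f`. -/
def ScalarLax (J : Set ℝ) (u : ℝ → M) (μ : ℂ) (f : ℝ → ℝ → ℂ) : Prop :=
  ∀ t ∈ J, ∀ x,
    iteratedDeriv 3 (f t) x = -μ * (ubar (u t).1 x : ℂ) * f t x ∧
    Dt u f t x = μ⁻¹ * iteratedDeriv 2 (f t) x + ((deriv (u t).1 x : ℝ) : ℂ) * f t x

/-- The adjoint pair: `D_x³ f̄ = μ ū f̄`, `D_t f̄ = -μ⁻¹ D_x² f̄ + u_x f̄`. -/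
def AdjointLax (J : Set ℝ) (u : ℝ → M) (μ : ℂ) (f : ℝ → ℝ → ℂ) : Prop :=
  ∀ t ∈ J, ∀ x,
    iteratedDeriv 3 (f t) x = μ * (ubar (u t).1 x : ℂ) * f t x ∧
    Dt u f t x = -μ⁻¹ * iteratedDeriv 2 (f t) x + ((deriv (u t).1 x : ℝ) : ℂ) * f t x

/-- `f` is smooth over `J`. -/
def SmoothOver (J : Set ℝ) (f : ℝ → ℝ → ℂ) : Prop :=
  ContDiffOn ℝ ∞ (fun z : ℝ × ℝ => f z.1 z.2) (J ×ˢ Set.univ)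

/-- The vector `(f, D_x f, D_x² f)`. -/
def jet (f : ℝ → ℝ → ℂ) (i : Fin 3) (t x : ℝ) : ℂ := iteratedDeriv (i : ℕ) (f t) x

/-- The matrix of the `t`-part. -/
def qMat (u : ℝ → ℝ) (μ : ℂ) (x : ℝ) : Matrix (Fin 3) (Fin 3) ℂ :=
  !![((deriv u x : ℝ) : ℂ), 0, 1 / μ;
     -1 / 3, 0, 0;
     0, -1 / 3, -((deriv u x : ℝ) : ℂ)]

/-- The matrix of the `x`-part. -/
def lMat (u : ℝ → ℝ) (μ : ℂ) (x : ℝ) : Matrix (Fin 3) (Fin 3) ℂ :=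
  !![0, 1, 0;
     0, 0, 1;
     -μ * (ubar u x : ℂ), 0, 0]

/-- The matrix system `D_t h = q h`, `D_x h = l h`. -/
def MatrixLax (J : Set ℝ) (u : ℝ → M) (μ : ℂ) (h : Fin 3 → ℝ → ℝ → ℂ) : Prop :=
  ∀ t ∈ J, ∀ x, ∀ i : Fin 3,
    Dt u (h i) t x = ∑ j, qMat (u t).1 μ x i j * h j t x ∧
    deriv (h i t) x = ∑ j, lMat (u t).1 μ x i j * h j t x

/-- The Zakharov-Shabat condition `D_t l = [q, l] + D_x q - u_x l`. -/
def ZeroCurvature (J : Set ℝ) (u : ℝ → M) (μ : ℂ) : Prop :=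
  ∀ t ∈ J, ∀ x, ∀ i j : Fin 3,
    Dt u (fun s y => lMat (u s).1 μ y i j) t x =
      (qMat (u t).1 μ x * lMat (u t).1 μ x - lMat (u t).1 μ x * qMat (u t).1 μ x) i j +
        deriv (fun y => qMat (u t).1 μ y i j) x - ((deriv (u t).1 x : ℝ) : ℂ) * lMat (u t).1 μ x i j

/-- Compatibility of a linear system `S` for a function `f(t, x)` that is of third order in `x`:
it has a smooth solution with arbitrary prescribed `(f, D_x f, D_x² f)` at an arbitrary point. -/
def Compatible (J : Set ℝ) (S : (ℝ → ℝ → ℂ) → Prop) : Prop :=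
  ∀ t₀ ∈ J, ∀ x₀ : ℝ, ∀ c : Fin 3 → ℂ,
    ∃ f : ℝ → ℝ → ℂ, SmoothOver J f ∧ S f ∧ ∀ i, jet f i t₀ x₀ = c i

/-! ### Functionals -/

/-- The Hamiltonian of `K` for `ϑ`: `½ ∫ (u³/3 - (D_x⁻¹u)²) dx`. -/
def H (u : M) : ℝ :=
  1 / 2 * ∫ x in (0 : ℝ)..(2 * Real.pi), (u.1 x ^ 3 / 3 - (Dinv u).1 x ^ 2)

/-- The Hamiltonian of `K` for `η`: `½ ∫ ū dx`. On `M` it is constant, with gradient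
`D_x² (1/2) = 0`; the flow sits in the value of `η` obtained with `∂⁻² 0 = 1/2`. -/
def Hbar (u : M) : ℝ := 1 / 2 * ∫ x in (0 : ℝ)..(2 * Real.pi), ubar u.1 x

/-- The functional `∫₀¹ (φ[us], u) ds`. -/
def homotopy (φ : M → M) (u : M) : ℝ := ∫ s in (0 : ℝ)..1, pair (φ (s • u)).1 u.1

/-- A constant as a smooth periodic function. -/
def constPer (c : ℝ) : Per := ⟨fun _ => c, contDiff_const, fun _ => rfl⟩

end OV

end

open scoped ContDiff

noncomputable section

namespace OV

open MeasureTheory Filter Topology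

/-! ### Parametric integrals and mixed partial derivatives -/

section Parametric

variable {E F : Type} [NormedAddCommGroup E] [NormedSpace ℝ E]
  [NormedAddCommGroup F] [NormedSpace ℝ F]

/-! Lax representation. The zero curvature equation has one entry with content, `ū_t + u ū_x + 3 u_x
ū = 0`. This is `du/dt = K[u]` differentiated twice in `x`, and nothing is lost because `D_x` is
injective on zero-mean functions (`isSolution_iff`, `zeroCurvature_iff`). Zero curvature gives
solutions with arbitrary data: transport the identity in `x` along each line `t = const` and correct
by an ODE in `t` at `x₀`; the defect in the `t`-equation solves the linear `x`-equation with zero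
data (`exists_solution_of_zero_curvature`). Conversely, a solution with data `(1,0,0)` yields the
equation by computing the time derivative of its third `x`-derivative in two ways. The adjoint
system is the same system with `-μ`.

Poisson structures. With `w = ū`, `A = 2w' + 3w∂` and `B = w' + 3w∂`, the relation `η` is
`∂⁻²B∂⁻³A∂⁻²`, that is, `χ''' = Aψ`, `v'' = Bχ` (`etaVia_iff`). As `A* = -B` and `∂³` is skew, `η`
is skew. It is maximal because the two solvability conditions (orthogonality of `ψ` to `w'` and
`Bu`) match the two free constants in `ψ` and `χ` (`eta_of_skew`).

For the Jacobi identity one differentiates `ψ` and `χ` along lines. They are determined by the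
section only up to constants, which change the value by multiples of `K u` and `u_x`. Where these
two are linearly independent (`gram u ≠ 0`) the constants are given by Cramer's rule and are
differentiable; skewness then removes all derivatives of sections from the cyclic sum, and the
remaining cubic integrand is integrated by parts to zero (`perInt_jacobi_eta`,
`perInt_jacobi_theta`). At an arbitrary point the identity follows by continuity: along `u + s cos`,
`gram` is a polynomial in `s` of degree six, nonzero for small `s ≠ 0`. The pencil is treated in one
stroke, and `η` is its member `κ = 0`.

Flow and hierarchy. Since `(K u)'' = -B u` and `A(1/2) = u'''`, taking `ψ = 1/2`, `χ = u` gives `-K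
∈ η(0)`. The recursion is solved globally, without inverting anything, by the monodromy matrix `T`
of the spectral problem as a formal power series in the spectral parameter. `T` is periodic and `T_x
= [l,T]`; eliminating its other entries gives, for the corner entry `P` and the sum `S` of the two
entries just above the diagonal, `S_{n+1}''' = -A P_n` and `P_{n+1}''''' = 3B S_n`. Hence
`P_{2j}''`, rescaled, obeys the Lenard recursion (`etaVia_flow`). The variation of the trace of the
monodromy is `-∫ δw P_n`, so these are gradients (`hasDerivAt_charge`). Conservation and involution
use only skewness.

Independence. At `u = 0` the potential is constant, and the gradients linearized on a Fourier mode
of wave number `k` are polynomials in `1/k²` of distinct degrees `3j+2` (`hasDerivAt_pair_flow`,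
`coeff_symbol_ne_zero`). A linear relation would give a nonzero polynomial with infinitely many
roots. -/

theorem hasFDerivAt_integral_param [ProperSpace E] [CompleteSpace F] {g : E × ℝ → F}
    (hg : ContDiff ℝ 1 g) (a b : ℝ) (p : E) :
    HasFDerivAt (fun q => ∫ y in a..b, g (q, y))
      (∫ y in a..b, (fderiv ℝ g (p, y)).comp (ContinuousLinearMap.inl ℝ E ℝ)) p := by
  have hcont : Continuous fun z : E × ℝ =>
      (fderiv ℝ g z).comp (ContinuousLinearMap.inl ℝ E ℝ) :=
    (hg.continuous_fderiv one_ne_zero).clm_comp continuous_const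
  obtain ⟨C, hC⟩ := ((isCompact_closedBall p 1).prod (isCompact_uIcc (a := a) (b := b))).exists_bound_of_continuousOn
    hcont.continuousOn
  refine intervalIntegral.hasFDerivAt_integral_of_dominated_of_fderiv_le
    (F := fun q y => g (q, y))
    (F' := fun q y => (fderiv ℝ g (q, y)).comp (ContinuousLinearMap.inl ℝ E ℝ))
    (bound := fun _ => C) (Metric.closedBall_mem_nhds p one_pos) ?_ ?_ ?_ ?_ ?_ ?_
  · exact Eventually.of_forall fun q =>
      (hg.continuous.comp (by fun_prop : Continuous fun y : ℝ => (q, y))).aestronglyMeasurable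
  · exact (hg.continuous.comp (by fun_prop : Continuous fun y : ℝ => (p, y))).intervalIntegrable _ _
  · exact (hcont.comp (by fun_prop : Continuous fun y : ℝ => (p, y))).aestronglyMeasurable
  · exact Eventually.of_forall fun y hy q hq => hC (q, y) ⟨hq, Set.uIoc_subset_uIcc hy⟩
  · exact continuous_const.intervalIntegrable _ _
  · refine Eventually.of_forall fun y _ q _ => ?_
    exact ((hg.differentiable one_ne_zero (q, y)).hasFDerivAt).comp q
      (hasFDerivAt_prodMk_left q y)

/-- The derivative is again a parametric integral, with values in a space of linear maps; hence the
codomain varies in the induction. -/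
theorem contDiff_integral_param_nat [ProperSpace E] [CompleteSpace F] {n : ℕ} {g : E × ℝ → F}
    (hg : ContDiff ℝ n g) (a b : ℝ) : ContDiff ℝ n (fun q => ∫ y in a..b, g (q, y)) := by
  induction n generalizing F with
  | zero =>
    simp only [Nat.cast_zero, contDiff_zero] at hg ⊢
    exact intervalIntegral.continuous_parametric_intervalIntegral_of_continuous'
      (f := fun q y => g (q, y)) hg a b
  | succ n ih =>
    have hg1 : ContDiff ℝ 1 g := hg.of_le (by exact_mod_cast Nat.le_add_left 1 n)
    have hd := hasFDerivAt_integral_param hg1 a b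
    push_cast at hg ⊢
    refine contDiff_succ_iff_fderiv.mpr ⟨fun p => (hd p).differentiableAt, by simp, ?_⟩
    rw [funext fun p => (hd p).fderiv]
    exact ih ((contDiff_succ_iff_fderiv.mp hg).2.2.clm_comp contDiff_const)

theorem contDiff_integral_param [ProperSpace E] [CompleteSpace F] {g : E × ℝ → F}
    (hg : ContDiff ℝ ∞ g) (a b : ℝ) : ContDiff ℝ ∞ (fun q => ∫ y in a..b, g (q, y)) :=
  contDiff_infty.mpr fun n => contDiff_integral_param_nat (contDiff_infty.mp hg n) a b

theorem contDiff_primitive_param_nat [ProperSpace E] [CompleteSpace F] {n : ℕ} {g : E × ℝ → F}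
    (hg : ContDiff ℝ n g) : ContDiff ℝ n (fun z : E × ℝ => ∫ y in (0 : ℝ)..z.2, g (z.1, y)) := by
  -- Rescaling to `[0,1]` turns the variable endpoint into a parameter of the integrand.
  have h : (fun z : E × ℝ => ∫ y in (0 : ℝ)..z.2, g (z.1, y)) =
      fun z : E × ℝ => ∫ r in (0 : ℝ)..1, z.2 • g (z.1, z.2 * r) := by
    funext z
    rw [intervalIntegral.integral_smul,
      intervalIntegral.smul_integral_comp_mul_left (f := fun y => g (z.1, y))]
    simp
  rw [h]
  exact contDiff_integral_param_nat (g := fun w : (E × ℝ) × ℝ => w.1.2 • g (w.1.1, w.1.2 * w.2))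
    (contDiff_fst.snd.smul (hg.comp (by fun_prop))) 0 1

theorem contDiff_primitive_param [ProperSpace E] [CompleteSpace F] {g : E × ℝ → F}
    (hg : ContDiff ℝ ∞ g) : ContDiff ℝ ∞ (fun z : E × ℝ => ∫ y in (0 : ℝ)..z.2, g (z.1, y)) :=
  contDiff_infty.mpr fun n => contDiff_primitive_param_nat (contDiff_infty.mp hg n)

theorem deriv_snd_eq {f : E × ℝ → F} {z : E × ℝ} (hf : DifferentiableAt ℝ f z) :
    deriv (fun y => f (z.1, y)) z.2 = fderiv ℝ f z (0, 1) := by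
  have h : HasDerivAt (fun y : ℝ => (z.1, y)) ((0 : E), (1 : ℝ)) z.2 :=
    (hasDerivAt_const _ _).prodMk (hasDerivAt_id _)
  exact (hf.hasFDerivAt.comp_hasDerivAt z.2 h).deriv

theorem deriv_fst_eq {f : ℝ × E → F} {z : ℝ × E} (hf : DifferentiableAt ℝ f z) :
    deriv (fun y => f (y, z.2)) z.1 = fderiv ℝ f z (1, 0) := by
  have h : HasDerivAt (fun y : ℝ => (y, z.2)) ((1 : ℝ), (0 : E)) z.1 :=
    (hasDerivAt_id _).prodMk (hasDerivAt_const _ _)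
  exact (hf.hasFDerivAt.comp_hasDerivAt z.1 h).deriv

theorem contDiff_deriv_snd {f : E × ℝ → F} (hf : ContDiff ℝ ∞ f) :
    ContDiff ℝ ∞ (fun z : E × ℝ => deriv (fun y => f (z.1, y)) z.2) := by
  rw [funext fun z => deriv_snd_eq (hf.differentiable (by simp) z)]
  exact (hf.fderiv_right (m := ∞) (by simp)).clm_apply contDiff_const

theorem contDiff_deriv_fst {f : ℝ × E → F} (hf : ContDiff ℝ ∞ f) :
    ContDiff ℝ ∞ (fun z : ℝ × E => deriv (fun y => f (y, z.2)) z.1) := by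
  rw [funext fun z => deriv_fst_eq (hf.differentiable (by simp) z)]
  exact (hf.fderiv_right (m := ∞) (by simp)).clm_apply contDiff_const

theorem contDiff_iteratedDeriv_snd (n : ℕ) {f : E × ℝ → F} (hf : ContDiff ℝ ∞ f) :
    ContDiff ℝ ∞ (fun z : E × ℝ => iteratedDeriv n (fun y => f (z.1, y)) z.2) := by
  induction n with
  | zero => simpa [iteratedDeriv_zero] using hf
  | succ n ih =>
    simp only [iteratedDeriv_succ]
    exact contDiff_deriv_snd ih

/-- Symmetry of the second derivative, in the form that also provides differentiability in the
parameter. -/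
theorem deriv_deriv_comm {f : ℝ × ℝ → F} {s x : ℝ} (hf : ContDiffAt ℝ ∞ f (s, x)) :
    HasDerivAt (fun r => deriv (fun y => f (r, y)) x)
      (deriv (fun y => deriv (fun r => f (r, y)) s) x) s := by
  have hf1 : ∀ᶠ z in 𝓝 (s, x), DifferentiableAt ℝ f z := by
    filter_upwards [(hf.of_le (m := 1) (by exact_mod_cast le_top)).eventually (by simp)] with z hz
    exact hz.differentiableAt one_ne_zero
  have hs : ∀ᶠ r in 𝓝 s, DifferentiableAt ℝ f (r, x) :=
    (by fun_prop : Continuous fun r : ℝ => (r, x)).continuousAt.eventually hf1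
  have hx : ∀ᶠ y in 𝓝 x, DifferentiableAt ℝ f (s, y) :=
    (by fun_prop : Continuous fun y : ℝ => (s, y)).continuousAt.eventually hf1
  have hd : DifferentiableAt ℝ (fderiv ℝ f) (s, x) :=
    (hf.fderiv_right (m := ∞) (by simp)).differentiableAt (by simp)
  have h1 : HasDerivAt (fun r => fderiv ℝ f (r, x) (0, 1))
      (fderiv ℝ (fderiv ℝ f) (s, x) (1, 0) (0, 1)) s := by
    have := hd.hasFDerivAt.comp_hasDerivAt s
      ((hasDerivAt_id s).prodMk (hasDerivAt_const s x))
    exact this.clm_apply (hasDerivAt_const s _) |>.congr_deriv (by simp)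
  have h2 : HasDerivAt (fun y => fderiv ℝ f (s, y) (1, 0))
      (fderiv ℝ (fderiv ℝ f) (s, x) (0, 1) (1, 0)) x := by
    have := hd.hasFDerivAt.comp_hasDerivAt x
      ((hasDerivAt_const x s).prodMk (hasDerivAt_id x))
    exact this.clm_apply (hasDerivAt_const x _) |>.congr_deriv (by simp)
  have hsymm : IsSymmSndFDerivAt ℝ f (s, x) :=
    hf.isSymmSndFDerivAt (by
      rw [minSmoothness_of_isRCLikeNormedField]
      exact WithTop.coe_le_coe.mpr le_top)
  have e1 : (fun r => deriv (fun y => f (r, y)) x) =ᶠ[𝓝 s] fun r => fderiv ℝ f (r, x) (0, 1) := by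
    filter_upwards [hs] with r hr using deriv_snd_eq hr
  have e2 : (fun y => deriv (fun r => f (r, y)) s) =ᶠ[𝓝 x] fun y => fderiv ℝ f (s, y) (1, 0) := by
    filter_upwards [hx] with r hr using deriv_fst_eq hr
  rw [e2.deriv_eq, h2.deriv, ← hsymm.eq]
  exact h1.congr_of_eventuallyEq e1

theorem hasDerivAt_iteratedDeriv_param (n : ℕ) {f : ℝ × ℝ → F} (hf : ContDiff ℝ ∞ f) (s x : ℝ) :
    HasDerivAt (fun r => iteratedDeriv n (fun y => f (r, y)) x)
      (iteratedDeriv n (fun y => deriv (fun r => f (r, y)) s) x) s := by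
  induction n generalizing f with
  | zero =>
    simp only [iteratedDeriv_zero]
    exact ((hf.differentiable (by simp)).comp
      (by fun_prop : Differentiable ℝ fun r : ℝ => (r, x)) s).hasDerivAt
  | succ n ih =>
    have h := ih (contDiff_deriv_snd hf)
    simp only [iteratedDeriv_succ']
    convert h using 3 with y
    exact (deriv_deriv_comm hf.contDiffAt).deriv.symm

theorem hasDerivAt_integral_param [CompleteSpace F] {g : ℝ × ℝ → F} (hg : ContDiff ℝ ∞ g)
    (a b s : ℝ) :
    HasDerivAt (fun r => ∫ y in a..b, g (r, y)) (∫ y in a..b, deriv (fun r => g (r, y)) s) s := by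
  have h := (hasFDerivAt_integral_param (hg.of_le (m := 1) (by exact_mod_cast le_top)) a b
    s).hasDerivAt
  refine h.congr_deriv ?_
  have hi : IntervalIntegrable
      (fun y => (fderiv ℝ g (s, y)).comp (ContinuousLinearMap.inl ℝ ℝ ℝ)) volume a b :=
    Continuous.intervalIntegrable (((hg.continuous_fderiv (by simp)).comp
      (by fun_prop : Continuous fun y : ℝ => (s, y))).clm_comp continuous_const) _ _
  rw [ContinuousLinearMap.intervalIntegral_apply hi]
  refine intervalIntegral.integral_congr fun y _ => ?_
  simp [deriv_fst_eq (z := (s, y)) (hg.differentiable (by simp) (s, y))]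

end Parametric

end OV

namespace OV

open MeasureTheory Filter Topology

/-! ### Linear ordinary differential equations with parameters -/

section LinearODE

variable {E : Type} [NormedAddCommGroup E] [NormedSpace ℝ E]

/-- The terms of the Picard series of `y' = L y`, `y(0) = e`. -/
def picardTerm (L : ℝ × ℝ → E →L[ℝ] E) (e : E) : ℕ → ℝ × ℝ → E
  | 0 => fun _ => e
  | n + 1 => fun z => ∫ r in (0 : ℝ)..z.2, L (z.1, r) (picardTerm L e n (z.1, r))

theorem continuous_picardTerm {L : ℝ × ℝ → E →L[ℝ] E} (hL : Continuous L) (e : E) (n : ℕ) :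
    Continuous (picardTerm L e n) := by
  induction n with
  | zero => exact continuous_const
  | succ n ih =>
    exact intervalIntegral.continuous_parametric_primitive_of_continuous
      (f := fun t r => L (t, r) (picardTerm L e n (t, r))) (hL.clm_apply ih)

theorem hasDerivAt_picardTerm [CompleteSpace E] {L : ℝ × ℝ → E →L[ℝ] E} (hL : Continuous L) (e : E)
    (n : ℕ) (t x : ℝ) :
    HasDerivAt (fun x => picardTerm L e (n + 1) (t, x)) (L (t, x) (picardTerm L e n (t, x))) x := by
  have hc : Continuous fun r => L (t, r) (picardTerm L e n (t, r)) :=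
    (hL.clm_apply (continuous_picardTerm hL e n)).comp (by fun_prop : Continuous fun r : ℝ => (t, r))
  exact (hc.integral_hasStrictDerivAt 0 x).hasDerivAt

theorem norm_picardTerm_le {L : ℝ × ℝ → E →L[ℝ] E} (e : E) {R C : ℝ}
    (hC : ∀ t x, |t| ≤ R → |x| ≤ R → ‖L (t, x)‖ ≤ C) (n : ℕ) {t x : ℝ} (ht : |t| ≤ R)
    (hx : |x| ≤ R) : ‖picardTerm L e n (t, x)‖ ≤ ‖e‖ * ((C * |x|) ^ n / n.factorial) := by
  have hC0 : 0 ≤ C := (norm_nonneg _).trans (hC t x ht hx)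
  induction n generalizing x with
  | zero => simp [picardTerm]
  | succ n ih =>
    -- Integration over `[0,1]` handles both signs of `x` at once.
    have h1 : picardTerm L e (n + 1) (t, x) =
        x • ∫ r in (0 : ℝ)..1, L (t, x * r) (picardTerm L e n (t, x * r)) := by
      rw [intervalIntegral.smul_integral_comp_mul_left
        (f := fun y => L (t, y) (picardTerm L e n (t, y)))]
      simp [picardTerm]
    have h2 : ‖∫ r in (0 : ℝ)..1, L (t, x * r) (picardTerm L e n (t, x * r))‖ ≤
        ∫ r in (0 : ℝ)..1, C * (‖e‖ * ((C * |x|) ^ n / n.factorial)) * r ^ n := by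
      refine intervalIntegral.norm_integral_le_of_norm_le zero_le_one ?_
        (Continuous.intervalIntegrable (by fun_prop) _ _)
      refine ae_of_all _ fun r hr => ?_
      have hxr : |x * r| = |x| * r := by rw [abs_mul, abs_of_pos hr.1]
      have hxr' : |x * r| ≤ R := by
        rw [hxr]; nlinarith [abs_nonneg x, hr.2]
      refine ((L (t, x * r)).le_opNorm _).trans ?_
      calc _ ≤ C * (‖e‖ * ((C * |x * r|) ^ n / n.factorial)) := by
            gcongr
            · exact hC _ _ ht hxr'
            · exact ih hxr'
        _ = _ := by rw [hxr]; ring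
    rw [h1, norm_smul, Real.norm_eq_abs]
    refine (mul_le_mul_of_nonneg_left h2 (abs_nonneg x)).trans (le_of_eq ?_)
    rw [intervalIntegral.integral_const_mul, integral_pow, Nat.factorial_succ]
    push_cast
    field_simp
    simp
    ring

/-- The Picard series and its termwise derivative converge locally uniformly in both variables. Only
continuity in the parameter is obtained here; smoothness comes from a bootstrap for the fundamental
solution. -/
theorem exists_continuous_linearODE [CompleteSpace E] {L : ℝ × ℝ → E →L[ℝ] E} (hL : Continuous L)
    (e : E) : ∃ y : ℝ × ℝ → E, Continuous y ∧ (∀ t, y (t, 0) = e) ∧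
      ∀ t x, HasDerivAt (fun x => y (t, x)) (L (t, x) (y (t, x))) x := by
  have hbound : ∀ R : ℝ, ∃ C, 0 ≤ C ∧ ∀ t x, |t| ≤ R → |x| ≤ R → ‖L (t, x)‖ ≤ C := by
    intro R
    obtain ⟨C, hC⟩ := ((isCompact_Icc (a := -R) (b := R)).prod
      (isCompact_Icc (a := -R) (b := R))).exists_bound_of_continuousOn hL.continuousOn
    exact ⟨max C 0, le_max_right _ _, fun t x ht hx =>
      (hC (t, x) ⟨abs_le.mp ht, abs_le.mp hx⟩).trans (le_max_left _ _)⟩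
  have hterm : ∀ R : ℝ, 0 ≤ R → ∃ u : ℕ → ℝ, Summable u ∧ ∀ n t x, |t| ≤ R → |x| ≤ R →
      ‖picardTerm L e n (t, x)‖ ≤ u n ∧ ‖L (t, x) (picardTerm L e n (t, x))‖ ≤ u n := by
    intro R hR
    obtain ⟨C, hC0, hC⟩ := hbound R
    -- The factor `1 + C` makes one majorant serve the terms and their images under `L`.
    refine ⟨fun n => (1 + C) * (‖e‖ * ((C * R) ^ n / n.factorial)),
      ((Real.summable_pow_div_factorial _).mul_left _).mul_left _, fun n t x ht hx => ?_⟩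
    have h1 : ‖picardTerm L e n (t, x)‖ ≤ ‖e‖ * ((C * R) ^ n / n.factorial) :=
      (norm_picardTerm_le e hC n ht hx).trans (by gcongr)
    have h0 : 0 ≤ ‖e‖ * ((C * R) ^ n / n.factorial) := by positivity
    refine ⟨h1.trans (by nlinarith), ((L (t, x)).le_opNorm _).trans ?_⟩
    calc _ ≤ C * (‖e‖ * ((C * R) ^ n / n.factorial)) := by gcongr; exact hC _ _ ht hx
      _ ≤ _ := by nlinarith
  have hsum : ∀ t x, Summable fun n => picardTerm L e n (t, x) := by
    intro t x
    obtain ⟨u, hu, hun⟩ := hterm (max |t| |x|) ((abs_nonneg t).trans (le_max_left _ _))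
    exact hu.of_norm_bounded fun n => (hun n t x (le_max_left _ _) (le_max_right _ _)).1
  refine ⟨fun z => ∑' n, picardTerm L e n z, ?_, ?_, ?_⟩
  · refine continuous_iff_continuousAt.mpr fun z => ?_
    obtain ⟨u, hu, hun⟩ := hterm (max |z.1| |z.2| + 1) (by positivity)
    have hmem : {w : ℝ × ℝ | |w.1| < max |z.1| |z.2| + 1 ∧ |w.2| < max |z.1| |z.2| + 1} ∈ 𝓝 z := by
      refine ((isOpen_lt continuous_fst.abs continuous_const).inter
        (isOpen_lt continuous_snd.abs continuous_const)).mem_nhds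
        ⟨(?_ : |z.1| < _), (?_ : |z.2| < _)⟩
      · exact (le_max_left _ _).trans_lt (lt_add_one _)
      · exact (le_max_right _ _).trans_lt (lt_add_one _)
    refine ContinuousOn.continuousAt (continuousOn_tsum
      (fun n => (continuous_picardTerm hL e n).continuousOn) hu fun n w hw => ?_) hmem
    exact (hun n w.1 w.2 hw.1.le hw.2.le).1
  · intro t
    change ∑' n, picardTerm L e n (t, 0) = e
    rw [tsum_eq_single 0]
    · rfl
    · intro n hn
      obtain ⟨m, rfl⟩ := Nat.exists_eq_succ_of_ne_zero hn
      simp [picardTerm]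
  · intro t x
    obtain ⟨u, hu, hun⟩ := hterm (max |t| |x| + 1) (by positivity)
    have hxm : x ∈ Set.Ioo (-(max |t| |x| + 1)) (max |t| |x| + 1) :=
      abs_lt.mp ((le_max_right _ _).trans_lt (lt_add_one _))
    have hd := hasDerivAt_tsum_of_isPreconnected hu isOpen_Ioo isPreconnected_Ioo
      (g := fun n x => picardTerm L e (n + 1) (t, x))
      (g' := fun n x => L (t, x) (picardTerm L e n (t, x)))
      (fun n y _ => hasDerivAt_picardTerm hL e n t y)
      (fun n y hy => (hun n t y ((le_max_left _ _).trans (lt_add_one _).le)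
        (abs_lt.mpr hy).le).2) hxm ((summable_nat_add_iff 1).mpr (hsum t x)) hxm
    rw [← ContinuousLinearMap.map_tsum _ (hsum t x)] at hd
    refine (hd.const_add e).congr_of_eventuallyEq (Eventually.of_forall fun y => ?_)
    exact (hsum t y).tsum_eq_zero_add

theorem linearODE_unique {L : ℝ → E →L[ℝ] E} (hL : Continuous L) {y z : ℝ → E}
    (hy : ∀ x, HasDerivAt y (L x (y x)) x) (hz : ∀ x, HasDerivAt z (L x (z x)) x) {x₀ : ℝ}
    (h0 : y x₀ = z x₀) : y = z := by
  funext x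
  obtain ⟨C, hC⟩ := (isCompact_Icc (a := min x x₀ - 1) (b := max x x₀ + 1)).exists_bound_of_continuousOn
    hL.continuousOn
  refine ODE_solution_unique_of_mem_Ioo (v := fun x w => L x w) (s := fun _ => Set.univ)
    (K := C.toNNReal) (a := min x x₀ - 1) (b := max x x₀ + 1) (t₀ := x₀) ?_ ?_
    (fun t _ => ⟨hy t, trivial⟩) (fun t _ => ⟨hz t, trivial⟩) h0 ?_
  · intro t ht
    refine ((L t).lipschitz.weaken ?_).lipschitzOnWith
    rw [← NNReal.coe_le_coe, coe_nnnorm]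
    exact (hC t ⟨ht.1.le, ht.2.le⟩).trans (Real.le_coe_toNNReal C)
  · constructor <;> grind
  · constructor <;> grind

end LinearODE

section FundamentalSolution

variable {𝔸 : Type} [NormedRing 𝔸] [NormedAlgebra ℝ 𝔸]

/-- `Φ` is the fundamental solution of `Φ_x = A Φ`, `Φ(t, 0) = 1`, and `Ψ` is its inverse. -/
structure IsFundamental (A Φ Ψ : ℝ × ℝ → 𝔸) : Prop where
  continuous_left : Continuous Φ
  continuous_right : Continuous Ψ
  left_zero : ∀ t, Φ (t, 0) = 1
  right_zero : ∀ t, Ψ (t, 0) = 1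
  hasDerivAt_left : ∀ t x, HasDerivAt (fun x => Φ (t, x)) (A (t, x) * Φ (t, x)) x
  hasDerivAt_right : ∀ t x, HasDerivAt (fun x => Ψ (t, x)) (-(Ψ (t, x) * A (t, x))) x
  right_mul_left : ∀ z, Ψ z * Φ z = 1
  left_mul_right : ∀ z, Φ z * Ψ z = 1

theorem exists_isFundamental [CompleteSpace 𝔸] {A : ℝ × ℝ → 𝔸} (hA : Continuous A) :
    ∃ Φ Ψ, IsFundamental A Φ Ψ := by
  have hl : Continuous fun z => ContinuousLinearMap.mul ℝ 𝔸 (A z) :=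
    (ContinuousLinearMap.mul ℝ 𝔸).continuous.comp hA
  have hr : Continuous fun z => (ContinuousLinearMap.mul ℝ 𝔸).flip (A z) :=
    ((ContinuousLinearMap.mul ℝ 𝔸).flip).continuous.comp hA
  obtain ⟨Φ, hΦc, hΦ0, hΦ⟩ := exists_continuous_linearODE hl 1
  obtain ⟨Ψ, hΨc, hΨ0, hΨ⟩ := exists_continuous_linearODE hr.neg 1
  replace hΦ : ∀ t x, HasDerivAt (fun x => Φ (t, x)) (A (t, x) * Φ (t, x)) x := hΦ
  replace hΨ : ∀ t x, HasDerivAt (fun x => Ψ (t, x)) (-(Ψ (t, x) * A (t, x))) x := hΨ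
  refine ⟨Φ, Ψ, hΦc, hΨc, hΦ0, hΨ0, hΦ, hΨ, fun z => ?_, fun z => ?_⟩
  · have h : ∀ x, HasDerivAt (fun x => Ψ (z.1, x) * Φ (z.1, x)) 0 x := fun x =>
      ((hΨ z.1 x).mul (hΦ z.1 x)).congr_deriv (by noncomm_ring)
    have := is_const_of_deriv_eq_zero (fun x => (h x).differentiableAt) (fun x => (h x).deriv) z.2 0
    simpa [hΨ0, hΦ0] using this
  -- A left inverse need not be a right inverse in `𝔸`. The product `ΦΨ` solves `y' = Ay - yA`, as
  -- does the constant `1`, so uniqueness applies.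
  · have hc : Continuous fun x => ContinuousLinearMap.mul ℝ 𝔸 (A (z.1, x)) -
        (ContinuousLinearMap.mul ℝ 𝔸).flip (A (z.1, x)) :=
      (hl.sub hr).comp (by fun_prop : Continuous fun x : ℝ => (z.1, x))
    have := linearODE_unique hc (y := fun x => Φ (z.1, x) * Ψ (z.1, x)) (z := fun _ => 1) (x₀ := 0)
      (fun x => ((hΦ z.1 x).mul (hΨ z.1 x)).congr_deriv (by simp; noncomm_ring))
      (fun x => (hasDerivAt_const x _).congr_deriv (by simp)) (by simp [hΨ0, hΦ0])
    exact congrFun this z.2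

theorem IsFundamental.eq_mul {A Φ Ψ : ℝ × ℝ → 𝔸} (h : IsFundamental A Φ Ψ) {t : ℝ} {y : ℝ → 𝔸}
    (hy : ∀ x, HasDerivAt y (A (t, x) * y x) x) (x : ℝ) : y x = Φ (t, x) * y 0 := by
  have hd : ∀ x, HasDerivAt (fun x => Ψ (t, x) * y x) 0 x := fun x =>
    ((h.hasDerivAt_right t x).mul (hy x)).congr_deriv (by noncomm_ring)
  have := is_const_of_deriv_eq_zero (fun x => (hd x).differentiableAt) (fun x => (hd x).deriv) x 0
  simp only [h.right_zero, one_mul] at this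
  rw [← this, ← mul_assoc, h.left_mul_right, one_mul]

/-- Duhamel's formula: integrate the derivative of `Ψ(t,·)Φ(s,·)`. -/
theorem IsFundamental.sub_eq [CompleteSpace 𝔸] {A Φ Ψ : ℝ × ℝ → 𝔸} (h : IsFundamental A Φ Ψ) (hA : Continuous A)
    (s t x : ℝ) : Φ (s, x) - Φ (t, x) =
      Φ (t, x) * ∫ y in (0 : ℝ)..x, Ψ (t, y) * (A (s, y) - A (t, y)) * Φ (s, y) := by
  have hd : ∀ y, HasDerivAt (fun y => Ψ (t, y) * Φ (s, y))
      (Ψ (t, y) * (A (s, y) - A (t, y)) * Φ (s, y)) y := fun y =>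
    ((h.hasDerivAt_right t y).mul (h.hasDerivAt_left s y)).congr_deriv (by noncomm_ring)
  have h1 := h.continuous_left
  have h2 := h.continuous_right
  have hc : Continuous fun y => Ψ (t, y) * (A (s, y) - A (t, y)) * Φ (s, y) := by fun_prop
  rw [intervalIntegral.integral_eq_sub_of_hasDerivAt (fun y _ => hd y)
    (hc.intervalIntegrable _ _), h.right_zero, h.left_zero, mul_sub, ← mul_assoc,
    h.left_mul_right]
  simp

/-- The derivative of a fundamental solution with respect to the parameter. -/
theorem IsFundamental.hasDerivAt_param [CompleteSpace 𝔸] {A Φ Ψ : ℝ × ℝ → 𝔸} (h : IsFundamental A Φ Ψ)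
    (hA : ContDiff ℝ ∞ A) (t x : ℝ) :
    HasDerivAt (fun s => Φ (s, x))
      (Φ (t, x) * ∫ y in (0 : ℝ)..x, Ψ (t, y) * deriv (fun s => A (s, y)) t * Φ (t, y)) t := by
  have hA' : Continuous fun z : ℝ × ℝ => deriv (fun s => A (s, z.2)) z.1 :=
    (contDiff_deriv_fst hA).continuous
  have hAc := hA.continuous
  have h1 := h.continuous_left
  have h2 := h.continuous_right
  -- Hadamard's lemma extracts the factor `s - t` from Duhamel's formula; what remains is continuous
  -- in `s`, so the difference quotient has a limit at `t`.
  have hadamard : ∀ s y, A (s, y) - A (t, y) =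
      (s - t) • ∫ r in (0 : ℝ)..1, deriv (fun s => A (s, y)) (t + (s - t) * r) := by
    intro s y
    rw [intervalIntegral.smul_integral_comp_add_mul (f := deriv (fun s => A (s, y)))]
    have hd : Differentiable ℝ fun s => A (s, y) :=
      (hA.comp (by fun_prop : ContDiff ℝ ∞ fun s : ℝ => (s, y))).differentiable (by simp)
    rw [intervalIntegral.integral_deriv_eq_sub (fun r _ => hd r)]
    · simp
    · exact (hA'.comp (by fun_prop : Continuous fun s : ℝ => (s, y))).intervalIntegrable _ _
  have hB : Continuous fun z : ℝ × ℝ =>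
      ∫ r in (0 : ℝ)..1, deriv (fun s => A (s, z.2)) (t + (z.1 - t) * r) := by
    refine intervalIntegral.continuous_parametric_intervalIntegral_of_continuous'
      (f := fun (z : ℝ × ℝ) r => deriv (fun s => A (s, z.2)) (t + (z.1 - t) * r)) ?_ 0 1
    exact hA'.comp (by fun_prop : Continuous fun w : (ℝ × ℝ) × ℝ => (t + (w.1.1 - t) * w.2, w.1.2))
  have hq : Continuous fun s => Φ (t, x) * ∫ y in (0 : ℝ)..x, Ψ (t, y) *
      (∫ r in (0 : ℝ)..1, deriv (fun s => A (s, y)) (t + (s - t) * r)) * Φ (s, y) := by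
    refine continuous_const.mul
      (intervalIntegral.continuous_parametric_intervalIntegral_of_continuous' (f := fun s y =>
        Ψ (t, y) * (∫ r in (0 : ℝ)..1, deriv (fun s => A (s, y)) (t + (s - t) * r)) * Φ (s, y))
        ?_ 0 x)
    exact ((h2.comp (by fun_prop : Continuous fun w : ℝ × ℝ => (t, w.2))).mul hB).mul h1
  have hs : ∀ s, Φ (s, x) = Φ (t, x) + (s - t) • (Φ (t, x) * ∫ y in (0 : ℝ)..x, Ψ (t, y) *
      (∫ r in (0 : ℝ)..1, deriv (fun s => A (s, y)) (t + (s - t) * r)) * Φ (s, y)) := by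
    intro s
    have := h.sub_eq hAc s t x
    rw [eq_add_of_sub_eq' this]
    congr 1
    rw [← mul_smul_comm, ← intervalIntegral.integral_smul]
    congr 1
    refine intervalIntegral.integral_congr fun y _ => ?_
    simp only [hadamard, mul_smul_comm, smul_mul_assoc]
  rw [funext hs]
  refine HasDerivAt.const_add _ ?_
  rw [hasDerivAt_iff_tendsto_slope]
  refine (hq.tendsto t).mono_left nhdsWithin_le_nhds |>.congr' ?_ |>.trans (le_of_eq ?_)
  · filter_upwards [self_mem_nhdsWithin] with s hst
    have : s - t ≠ 0 := sub_ne_zero.mpr hst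
    simp [slope, smul_smul, this]
  · simp

/-- Bootstrap: both partial derivatives of `Φ` are expressed through `A`, `Φ` and `Ψ = Φ⁻¹` by
products and primitives, so `Cⁿ` regularity of `Φ` gives `Cⁿ⁺¹`. -/
theorem IsFundamental.contDiff_left [CompleteSpace 𝔸] {A Φ Ψ : ℝ × ℝ → 𝔸} (h : IsFundamental A Φ Ψ)
    (hA : ContDiff ℝ ∞ A) : ContDiff ℝ ∞ Φ := by
  have hinv : ∀ z, Ψ z = Ring.inverse (Φ z) := fun z =>
    (Ring.inverse_unit ⟨Φ z, Ψ z, h.left_mul_right z, h.right_mul_left z⟩).symm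
  have key : ∀ n : ℕ, ContDiff ℝ n Φ → ContDiff ℝ n fun z : ℝ × ℝ =>
      Φ z * ∫ y in (0 : ℝ)..z.2, Ψ (z.1, y) * deriv (fun s => A (s, y)) z.1 * Φ (z.1, y) := by
    intro n hn
    have hΨ : ContDiff ℝ n Ψ := by
      rw [funext hinv]
      refine contDiff_iff_contDiffAt.mpr fun z => ?_
      exact (contDiffAt_ringInverse ℝ
        (⟨Φ z, Ψ z, h.left_mul_right z, h.right_mul_left z⟩ : 𝔸ˣ)).comp z hn.contDiffAt
    refine hn.mul (contDiff_primitive_param_nat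
      (g := fun w => Ψ w * deriv (fun s => A (s, w.2)) w.1 * Φ w) ((hΨ.mul ?_).mul hn))
    exact contDiff_infty.mp (contDiff_deriv_fst hA) n
  have hF : ∀ z, HasFDerivAt Φ
      (((ContinuousLinearMap.toSpanSingleton ℝ (Φ z * ∫ y in (0 : ℝ)..z.2,
        Ψ (z.1, y) * deriv (fun s => A (s, y)) z.1 * Φ (z.1, y)))).coprod
        (ContinuousLinearMap.toSpanSingleton ℝ (A z * Φ z))) z := by
    intro z
    have hc := (key 0 (by simpa using h.continuous_left)).continuous
    have := hasStrictFDerivAt_uncurry_coprod (𝕜 := ℝ) (u := z) (f := fun t x => Φ (t, x))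
      (f₁ := fun t x => ContinuousLinearMap.toSpanSingleton ℝ (Φ (t, x) * ∫ y in (0 : ℝ)..x,
        Ψ (t, y) * deriv (fun s => A (s, y)) t * Φ (t, y)))
      (f₂ := fun t x => ContinuousLinearMap.toSpanSingleton ℝ (A (t, x) * Φ (t, x)))
      (Eventually.of_forall fun v => (h.hasDerivAt_param hA v.1 v.2).hasFDerivAt)
      (Eventually.of_forall fun v => (h.hasDerivAt_left v.1 v.2).hasFDerivAt)
      ((ContinuousLinearMap.toSpanSingletonCLE (𝕜 := ℝ) (E := 𝔸)).continuous.comp hc).continuousAt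
      ((ContinuousLinearMap.toSpanSingletonCLE (𝕜 := ℝ) (E := 𝔸)).continuous.comp
        (hA.continuous.mul h.continuous_left)).continuousAt
    exact this.hasFDerivAt
  refine contDiff_infty.mpr fun n => ?_
  induction n with
  | zero => simpa using h.continuous_left
  | succ n ih =>
    push_cast
    refine contDiff_succ_iff_fderiv.mpr ⟨fun z => (hF z).differentiableAt, by simp, ?_⟩
    rw [funext fun z => (hF z).fderiv]
    have h1 := (ContinuousLinearMap.toSpanSingletonCLE (𝕜 := ℝ) (E := 𝔸)).contDiff.comp (key n ih)
    have h2 := (ContinuousLinearMap.toSpanSingletonCLE (𝕜 := ℝ) (E := 𝔸)).contDiff.comp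
      ((contDiff_infty.mp hA n).mul ih)
    exact (ContinuousLinearMap.coprodEquivL ℝ (E := ℝ) (F := ℝ) (G := 𝔸)).contDiff.comp (h1.prodMk h2)

end FundamentalSolution

end OV

namespace OV

open MeasureTheory Filter Topology

/-! ### The differential algebra of smooth periodic functions -/

/-- Smooth `2π`-periodic functions as a subalgebra. -/
def perSubalgebra : Subalgebra ℝ (ℝ → ℝ) where
  carrier := {w | w ∈ Per}
  add_mem' := fun ha hb => Per.add_mem ha hb
  mul_mem' := fun ha hb => ⟨ha.1.mul hb.1, fun x => by simp [ha.2 x, hb.2 x]⟩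
  algebraMap_mem' := fun _ => ⟨contDiff_const, fun _ => rfl⟩

/-- The algebra of smooth `2π`-periodic functions. -/
abbrev PerAlg : Type := perSubalgebra

namespace PerAlg

theorem contDiff (f : PerAlg) : ContDiff ℝ ∞ f.1 := f.2.1

theorem differentiable (f : PerAlg) : Differentiable ℝ f.1 := f.2.1.differentiable (by simp)

theorem continuous (f : PerAlg) : Continuous f.1 := f.2.1.continuous

theorem periodic (f : PerAlg) : Function.Periodic f.1 (2 * Real.pi) := f.2.2

theorem intervalIntegrable (f : PerAlg) (a b : ℝ) : IntervalIntegrable f.1 volume a b :=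
  f.continuous.intervalIntegrable a b

@[simp] theorem add_apply (f g : PerAlg) (x : ℝ) : (f + g).1 x = f.1 x + g.1 x := rfl

@[simp] theorem sub_apply (f g : PerAlg) (x : ℝ) : (f - g).1 x = f.1 x - g.1 x := rfl

@[simp] theorem neg_apply (f : PerAlg) (x : ℝ) : (-f).1 x = -f.1 x := rfl

@[simp] theorem mul_apply (f g : PerAlg) (x : ℝ) : (f * g).1 x = f.1 x * g.1 x := rfl

@[simp] theorem smul_apply (c : ℝ) (f : PerAlg) (x : ℝ) : (c • f).1 x = c * f.1 x := rfl

@[simp] theorem algebraMap_apply (c x : ℝ) : (algebraMap ℝ PerAlg c).1 x = c := rfl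

@[simp] theorem zero_apply (x : ℝ) : (0 : PerAlg).1 x = 0 := rfl

@[simp] theorem one_apply (x : ℝ) : (1 : PerAlg).1 x = 1 := rfl

@[simp] theorem ofNat_apply (n : ℕ) [n.AtLeastTwo] (x : ℝ) :
    (ofNat(n) : PerAlg).1 x = ofNat(n) := rfl

theorem ext {f g : PerAlg} (h : ∀ x, f.1 x = g.1 x) : f = g := Subtype.ext (funext h)

/-- Differentiation as a derivation of the algebra of smooth periodic functions. -/
def D : Derivation ℝ PerAlg PerAlg :=
  Derivation.mk'
    { toFun := fun f => ⟨deriv f.1, deriv_mem_Per f.2⟩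
      map_add' := fun f g => ext fun x => deriv_add (f.differentiable x) (g.differentiable x)
      map_smul' := fun c f => ext fun x => deriv_const_mul c (f.differentiable x) }
    fun f g => ext fun x => by
      refine (deriv_mul (f.differentiable x) (g.differentiable x)).trans ?_
      change _ = f.1 x * deriv g.1 x + g.1 x * deriv f.1 x
      ring

theorem D_apply (f : PerAlg) (x : ℝ) : (D f).1 x = deriv f.1 x := rfl

theorem D_mul (f g : PerAlg) : D (f * g) = f * D g + D f * g := by
  rw [D.leibniz, smul_eq_mul, smul_eq_mul, mul_comm g]

@[simp] theorem D_smul (c : ℝ) (f : PerAlg) : D (c • f) = c • D f := D.map_smul c f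

@[simp] theorem D_algebraMap (c : ℝ) : D (algebraMap ℝ PerAlg c) = 0 := D.map_algebraMap c

@[simp] theorem D_ofNat (n : ℕ) [n.AtLeastTwo] : D (ofNat(n) : PerAlg) = 0 :=
  D.map_natCast n

theorem D_iterate_apply (n : ℕ) (f : PerAlg) (x : ℝ) :
    (D^[n] f).1 x = iteratedDeriv n f.1 x := by
  induction n generalizing f with
  | zero => simp
  | succ n ih => rw [Function.iterate_succ_apply, ih, iteratedDeriv_succ']; rfl

theorem hasDerivAt (f : PerAlg) (x : ℝ) : HasDerivAt f.1 ((D f).1 x) x :=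
  (f.differentiable x).hasDerivAt

/-- The integral over one period. -/
def perInt : PerAlg →ₗ[ℝ] ℝ where
  toFun f := ∫ x in (0 : ℝ)..(2 * Real.pi), f.1 x
  map_add' f g := intervalIntegral.integral_add (f.intervalIntegrable _ _)
    (g.intervalIntegrable _ _)
  map_smul' c f := intervalIntegral.integral_const_mul c f.1

@[simp] theorem perInt_D (f : PerAlg) : perInt (D f) = 0 := (deriv_mem_M f.2).2

theorem perInt_mul_D (f g : PerAlg) : perInt (f * D g) = -perInt (D f * g) := by
  have h := perInt_D (f * g)
  rw [D_mul, map_add] at h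
  linarith

theorem perInt_algebraMap (c : ℝ) : perInt (algebraMap ℝ PerAlg c) = 2 * Real.pi * c := by
  change (∫ _ in (0 : ℝ)..(2 * Real.pi), c) = _
  simp

theorem eq_algebraMap_of_D_eq_zero {f : PerAlg} (h : D f = 0) :
    f = algebraMap ℝ PerAlg (f.1 0) := ext fun x =>
  is_const_of_deriv_eq_zero f.differentiable (fun y => congrFun (congrArg Subtype.val h) y) x 0

/-- Periodicity rules out polynomials: a constant that is the derivative of a periodic function has
zero mean, hence is zero. -/
theorem D_eq_zero_of_D_iterate_eq_zero {f : PerAlg} (n : ℕ) (h : D^[n + 1] f = 0) : D f = 0 := by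
  induction n generalizing f with
  | zero => simpa using h
  | succ n ih =>
    have h1 := ih (f := D f) (by rwa [← Function.iterate_succ_apply])
    have h2 := eq_algebraMap_of_D_eq_zero h1
    have h3 : perInt (D f) = 0 := perInt_D f
    rw [h2, perInt_algebraMap] at h3
    have : (D f).1 0 = 0 := by
      rcases mul_eq_zero.mp h3 with h | h
      · exact absurd h (by positivity)
      · exact h
    rw [h2, this, map_zero]

theorem eq_zero_of_perInt_mul_self {f : PerAlg} (h : perInt (f * f) = 0) : f = 0 := by
  have hpi : (0 : ℝ) < 2 * Real.pi := by positivity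
  have hz : ∀ x ∈ Set.Ioo (0 : ℝ) (2 * Real.pi), f.1 x = 0 := by
    by_contra! hne
    obtain ⟨x, hx, hfx⟩ := hne
    have : 0 < perInt (f * f) := intervalIntegral.integral_pos hpi
      (f := fun x => f.1 x * f.1 x) (f.continuous.mul f.continuous).continuousOn
      (fun x _ => mul_self_nonneg _) ⟨x, ⟨hx.1.le, hx.2.le⟩, mul_self_pos.mpr hfx⟩
    exact this.ne' h
  have hcl : Set.EqOn f.1 (fun _ => 0) (closure (Set.Ioo (0 : ℝ) (2 * Real.pi))) :=
    Set.EqOn.closure (fun x hx => hz x hx) f.continuous continuous_const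
  rw [closure_Ioo hpi.ne] at hcl
  refine ext fun x => ?_
  obtain ⟨y, hy, hxy⟩ := f.periodic.exists_mem_Ico₀ hpi x
  rw [hxy]
  exact hcl ⟨hy.1, hy.2.le⟩

end PerAlg

open PerAlg

/-- The inclusion of the phase space into the smooth periodic functions. -/
def toAlg : M →ₗ[ℝ] PerAlg where
  toFun u := ⟨u.1, u.2.1⟩
  map_add' _ _ := rfl
  map_smul' _ _ := rfl

@[simp] theorem toAlg_apply (u : M) (x : ℝ) : (toAlg u).1 x = u.1 x := rfl

theorem toAlg_injective : Function.Injective toAlg := fun _ _ h =>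
  Subtype.ext (congrArg (fun f : PerAlg => f.1) h)

@[simp] theorem perInt_toAlg (u : M) : perInt (toAlg u) = 0 := u.2.2

theorem exists_toAlg_eq {f : PerAlg} (h : perInt f = 0) : ∃ u : M, toAlg u = f :=
  ⟨⟨f.1, f.2, h⟩, rfl⟩

theorem pair_toAlg (u v : M) : pair u.1 v.1 = perInt (toAlg u * toAlg v) := rfl

@[simp] theorem toAlg_Dx (u : M) : toAlg (Dx u) = D (toAlg u) := rfl

@[simp] theorem Dx_Dinv (u : M) : Dx (Dinv u) = u := by
  refine toAlg_injective (PerAlg.ext fun x => ?_)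
  have h := (u.2.1.1.continuous.integral_hasStrictDerivAt 0 x).hasDerivAt
  exact (h.sub_const _).deriv

@[simp] theorem D_toAlg_Dinv (u : M) : D (toAlg (Dinv u)) = toAlg u := by
  rw [← toAlg_Dx, Dx_Dinv]

theorem eq_zero_of_D_toAlg {u : M} (h : D (toAlg u) = 0) : u = 0 := by
  have h1 := eq_algebraMap_of_D_eq_zero h
  have h2 := perInt_toAlg u
  rw [h1, perInt_algebraMap] at h2
  have : (toAlg u).1 0 = 0 := by
    rcases mul_eq_zero.mp h2 with h | h
    · exact absurd h (by positivity)
    · exact h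
  exact toAlg_injective (by rw [h1, this, map_zero, map_zero])

theorem D_toAlg_injective : Function.Injective fun u : M => D (toAlg u) := fun u v h =>
  sub_eq_zero.mp (eq_zero_of_D_toAlg (by
    rw [map_sub, map_sub]
    exact sub_eq_zero.mpr h))

theorem DD_toAlg_injective : Function.Injective fun u : M => D (D (toAlg u)) := fun u v h =>
  D_toAlg_injective (congrArg toAlg (D_toAlg_injective (a₁ := Dx u) (a₂ := Dx v) h))

/-- `D_x⁻²` on the functions of zero mean, as a map of periodic functions. -/
theorem exists_D_toAlg_eq {f : PerAlg} (h : perInt f = 0) : ∃ u : M, D (toAlg u) = f := by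
  obtain ⟨v, rfl⟩ := exists_toAlg_eq h
  exact ⟨Dinv v, D_toAlg_Dinv v⟩

theorem toAlg_K (u : M) : toAlg (K u) = -(toAlg u * D (toAlg u)) - toAlg (Dinv u) := rfl

/-- `ū` as a smooth periodic function. -/
def wbar (u : M) : PerAlg := D (D (toAlg u)) + algebraMap ℝ PerAlg (1 / 3)

theorem wbar_apply (u : M) (x : ℝ) : (wbar u).1 x = ubar u.1 x := by
  simp only [wbar, ubar, PerAlg.add_apply, algebraMap_apply]
  rw [show u.1 = (toAlg u).1 from rfl, ← D_iterate_apply 2]; rfl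

theorem D_wbar (u : M) : D (wbar u) = D (D (D (toAlg u))) := by simp [wbar]

/-! ### Paths of periodic functions -/

/-- A path in the algebra of smooth periodic functions that is smooth in both variables. -/
def SmoothPath (f : ℝ → PerAlg) : Prop := ContDiff ℝ ∞ fun z : ℝ × ℝ => (f z.1).1 z.2

/-- `f'` is the derivative of the path `f` at `s`, together with all `x`-derivatives. -/
def HasPathDeriv (f : ℝ → PerAlg) (f' : PerAlg) (s : ℝ) : Prop :=
  ∀ n x, HasDerivAt (fun r => (D^[n] (f r)).1 x) ((D^[n] f').1 x) s

theorem SmoothPath.periodic_deriv {f : ℝ → PerAlg} (hf : SmoothPath f) (s : ℝ) :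
    (fun x => deriv (fun r => (f r).1 x) s) ∈ Per := by
  refine ⟨(contDiff_deriv_fst hf).comp (by fun_prop : ContDiff ℝ ∞ fun x : ℝ => (s, x)), fun x => ?_⟩
  exact congrArg (fun g => deriv g s) (funext fun r => (f r).periodic x)

/-- The derivative of a smooth path. -/
def SmoothPath.pathDeriv {f : ℝ → PerAlg} (hf : SmoothPath f) (s : ℝ) : PerAlg :=
  ⟨fun x => deriv (fun r => (f r).1 x) s, hf.periodic_deriv s⟩

theorem SmoothPath.hasPathDeriv {f : ℝ → PerAlg} (hf : SmoothPath f) (s : ℝ) :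
    HasPathDeriv f (hf.pathDeriv s) s := fun n x => by
  simp only [D_iterate_apply]
  exact hasDerivAt_iteratedDeriv_param n hf s x

theorem SmoothPath.perInt_pathDeriv {f : ℝ → PerAlg} (hf : SmoothPath f) (s : ℝ) :
    HasDerivAt (fun r => perInt (f r)) (perInt (hf.pathDeriv s)) s :=
  hasDerivAt_integral_param hf _ _ s

namespace HasPathDeriv

variable {f g : ℝ → PerAlg} {f' g' : PerAlg} {s : ℝ}

theorem hasDerivAt (hf : HasPathDeriv f f' s) (x : ℝ) :
    HasDerivAt (fun r => (f r).1 x) (f'.1 x) s := hf 0 x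

theorem unique {f'' : PerAlg} (h1 : HasPathDeriv f f' s) (h2 : HasPathDeriv f f'' s) : f' = f'' :=
  PerAlg.ext fun x => (h1.hasDerivAt x).unique (h2.hasDerivAt x)

theorem congr (hf : HasPathDeriv f f' s) (h : ∀ᶠ r in 𝓝 s, g r = f r) : HasPathDeriv g f' s :=
  fun n x => (hf n x).congr_of_eventuallyEq (h.mono fun r hr => by simp only [hr])

theorem const (c : PerAlg) : HasPathDeriv (fun _ => c) 0 s := fun n x =>
  (hasDerivAt_const s _).congr_deriv (by
    rw [iterate_map_zero]; rfl)

theorem add (hf : HasPathDeriv f f' s) (hg : HasPathDeriv g g' s) :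
    HasPathDeriv (fun r => f r + g r) (f' + g') s := fun n x => by
  simp only [iterate_map_add]
  exact (hf n x).add (hg n x)

theorem D (hf : HasPathDeriv f f' s) : HasPathDeriv (fun r => PerAlg.D (f r)) (PerAlg.D f') s :=
  fun n x => by
  simp only [← Function.iterate_succ_apply]
  exact hf (n + 1) x

theorem mul (hf : HasPathDeriv f f' s) (hg : HasPathDeriv g g' s) :
    HasPathDeriv (fun r => f r * g r) (f s * g' + f' * g s) s := fun n x => by
  induction n generalizing f g f' g' with
  | zero => exact ((hf.hasDerivAt x).mul (hg.hasDerivAt x)).congr_deriv (by simp; ring)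
  | succ n ih =>
    simp only [Function.iterate_succ_apply, D_mul, iterate_map_add, map_add, PerAlg.add_apply]
    have h1 := ih hf hg.D
    have h2 := ih hf.D hg
    refine (h1.add h2).congr_deriv ?_
    simp only [iterate_map_add, PerAlg.add_apply]
    ring

theorem constMul (c : PerAlg) (hf : HasPathDeriv f f' s) :
    HasPathDeriv (fun r => c * f r) (c * f') s := by
  simpa using (const (s := s) c).mul hf

theorem const_fun {c : ℝ → ℝ} {c' : ℝ} (hc : HasDerivAt c c' s) :
    HasPathDeriv (fun r => algebraMap ℝ PerAlg (c r)) (algebraMap ℝ PerAlg c') s :=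
  fun n x => by
  cases n with
  | zero => exact hc
  | succ n =>
    simp only [Function.iterate_succ_apply, D_algebraMap]
    rw [iterate_map_zero]
    exact hasDerivAt_const s _

theorem smul {c : ℝ → ℝ} {c' : ℝ} (hc : HasDerivAt c c' s) (hf : HasPathDeriv f f' s) :
    HasPathDeriv (fun r => c r • f r) (c s • f' + c' • f s) s := by
  simpa only [Algebra.smul_def] using (const_fun hc).mul hf

end HasPathDeriv

/-- The line through `u` in the direction `h`. -/
theorem hasPathDeriv_line (u h : M) (s : ℝ) :
    HasPathDeriv (fun r : ℝ => toAlg (u + r • h)) (toAlg h) s := by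
  have := (HasPathDeriv.const (s := s) (toAlg u)).add
    (HasPathDeriv.smul (hasDerivAt_id s) (HasPathDeriv.const (s := s) (toAlg h)))
  simpa using this

end OV

namespace OV

open MeasureTheory Filter Topology PerAlg

/-! ### The relation `η` in terms of `ψ` and `χ` -/

theorem perInt_congr_D {f g : PerAlg} (h : PerAlg) (e : f = g + D h) : perInt f = perInt g := by
  rw [e, map_add, perInt_D, add_zero]

/-- The first order operator `A ψ = 2 ū' ψ + 3 ū ψ'`. -/
def opA (w ψ : PerAlg) : PerAlg := 2 * D w * ψ + 3 * w * D ψ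

/-- The first order operator `B χ = ū' χ + 3 ū χ'`, minus the adjoint of `opA`. -/
def opB (w χ : PerAlg) : PerAlg := D w * χ + 3 * w * D χ

theorem perInt_opA_mul (w ψ χ : PerAlg) : perInt (opA w ψ * χ) = -perInt (ψ * opB w χ) := by
  have h : perInt (opA w ψ * χ + ψ * opB w χ) = perInt 0 := by
    refine perInt_congr_D (3 * w * ψ * χ) ?_
    simp only [opA, opB, D_mul, D_ofNat]
    ring
  rw [map_add, map_zero] at h
  linarith

theorem perInt_D3_mul (f g : PerAlg) : perInt (D (D (D f)) * g) = -perInt (f * D (D (D g))) := by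
  have h : perInt (D (D (D f)) * g + f * D (D (D g))) = perInt 0 := by
    refine perInt_congr_D (D (D f) * g + f * D (D g) - D f * D g) ?_
    simp only [D_mul, map_add, map_sub]
    ring
  rw [map_add, map_zero] at h
  linarith

theorem perInt_D2_mul (f g : PerAlg) : perInt (D (D f) * g) = perInt (f * D (D g)) := by
  refine perInt_congr_D (D f * g - f * D g) ?_
  simp only [D_mul, map_sub]
  ring

theorem perInt_opA (w ψ : PerAlg) : perInt (opA w ψ) = -perInt (D w * ψ) := by
  have h : perInt (opA w ψ) = perInt (-(D w * ψ)) := by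
    refine perInt_congr_D (3 * w * ψ) ?_
    simp only [opA, D_mul, D_ofNat]
    ring
  rw [h, map_neg]

theorem perInt_opB (w χ : PerAlg) : perInt (opB w χ) = -2 * perInt (D w * χ) := by
  have h : perInt (opB w χ) = perInt ((-2 : ℝ) • (D w * χ)) := by
    refine perInt_congr_D (3 * w * χ) ?_
    rw [Algebra.smul_def]
    simp only [opB, D_mul, D_ofNat, map_neg, map_ofNat]
    ring
  rw [h, map_smul, smul_eq_mul]

theorem hasDerivAt_primitive {f : ℝ → ℝ} (hf : ContDiff ℝ ∞ f) (x : ℝ) :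
    HasDerivAt (fun x => ∫ y in (0 : ℝ)..x, f y) (f x) x :=
  (hf.continuous.integral_hasStrictDerivAt 0 x).hasDerivAt

theorem deriv_primitive {f : ℝ → ℝ} (hf : ContDiff ℝ ∞ f) :
    deriv (fun x => ∫ y in (0 : ℝ)..x, f y) = f :=
  funext fun x => (hasDerivAt_primitive hf x).deriv

/-- The six nested primitives collapse to two differential equations between periodic functions, `η
= ∂⁻²B∂⁻³A∂⁻²`. The non-periodic intermediate primitives disappear from the rest of the argument. -/
theorem etaVia_iff (u : M) (ψ χ : PerAlg) (v : M) :
    EtaVia u ⟨ψ.1, ψ.2⟩ ⟨χ.1, χ.2⟩ v ↔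
      D (D (D χ)) = opA (wbar u) ψ ∧ D (D (toAlg v)) = opB (wbar u) χ := by
  set w := wbar u with hw
  have hwx : ∀ x, ubar u.1 x = w.1 x := fun x => (wbar_apply u x).symm
  simp only [EtaVia, hwx]
  have h2 : ∀ f : ℝ → ℝ, iteratedDeriv 2 f = deriv (deriv f) := fun f => by
    rw [iteratedDeriv_succ, iteratedDeriv_one]
  have h3 : ∀ f : ℝ → ℝ, iteratedDeriv 3 f = deriv (deriv (deriv f)) := fun f => by
    rw [iteratedDeriv_succ, h2]
  simp only [h2, h3]
  have hd : ∀ {f : ℝ → ℝ}, ContDiff ℝ ∞ f → ContDiff ℝ ∞ (deriv f) := fun hf =>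
    (contDiff_infty_iff_deriv.mp hf).2
  have hda : ∀ {f : ℝ → ℝ}, ContDiff ℝ ∞ f → ∀ x, HasDerivAt f (deriv f x) x := fun hf x =>
    ((contDiff_infty_iff_deriv.mp hf).1 x).hasDerivAt
  constructor
  · rintro ⟨a, b, w₁, w₂, w₃, w₄, ⟨ha, hb, hw₁, hw₂, hw₃, hw₄⟩, ea, eb, ec, e1, e2, e3, e4, ev⟩
    have c1 : ∀ x, deriv χ.1 x = deriv a x + 2 * deriv b x := fun x => by
      rw [funext ec]
      exact ((hda ha x).add ((hda hb x).const_mul 2)).deriv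
    have c2 : ∀ x, deriv (deriv χ.1) x = deriv (deriv a) x + 2 * (w.1 x * ψ.1 x) := fun x => by
      rw [funext c1, ← eb]
      exact ((hda (hd ha) x).add ((hda (hd hb) x).const_mul 2)).deriv
    have c3 : ∀ x, deriv (deriv (deriv χ.1)) x =
        w.1 x * deriv ψ.1 x + 2 * (deriv w.1 x * ψ.1 x + w.1 x * deriv ψ.1 x) := fun x => by
      rw [funext c2]
      exact (((hda (hd (hd ha)) x).congr_deriv (ea x)).add
        (((hda w.contDiff x).mul (hda ψ.contDiff x)).const_mul 2)).deriv
    have v1 : ∀ x, deriv v.1 x = w.1 x * a x + 4 * deriv w₂ x +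
        2 * (deriv w₃ x + w.1 x * b x) := fun x => by
      rw [show v.1 = _ from funext ev, ← e1, ← e4]
      exact (((hda hw₁ x).add ((hda hw₂ x).const_mul 4)).add
        (((hda hw₃ x).add (hda hw₄ x)).const_mul 2)).deriv
    have v2 : ∀ x, deriv (deriv v.1) x = (deriv w.1 x * a x + w.1 x * deriv a x) +
        4 * (w.1 x * deriv b x) + 2 * (w.1 x * deriv a x +
          (deriv w.1 x * b x + w.1 x * deriv b x)) := fun x => by
      rw [funext v1]
      exact ((((hda w.contDiff x).mul (hda ha x)).add
        (((hda (hd hw₂) x).congr_deriv (e2 x)).const_mul 4)).add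
        ((((hda (hd hw₃) x).congr_deriv (e3 x)).add ((hda w.contDiff x).mul (hda hb x))).const_mul 2)).deriv
    refine ⟨PerAlg.ext fun x => ?_, PerAlg.ext fun x => ?_⟩
    · refine (c3 x).trans ?_
      simp [opA, D_apply]
      ring
    · refine (v2 x).trans ?_
      simp [opB, D_apply, c1, ec]
      ring
  · rintro ⟨eχ, ev⟩
    have hwψ : ContDiff ℝ ∞ fun x => w.1 x * ψ.1 x := w.contDiff.mul ψ.contDiff
    -- Any double primitive `b` will do. Then `a = χ - 2b` is forced, and `w₂` is solved from the
    -- formula for `v` once `w₁`, `w₃`, `w₄` are chosen.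
    obtain ⟨b, hb, eb⟩ : ∃ b : ℝ → ℝ, ContDiff ℝ ∞ b ∧
        ∀ x, deriv (deriv b) x = w.1 x * ψ.1 x :=
      ⟨_, contDiff_primitive (contDiff_primitive hwψ), fun x => by
        rw [deriv_primitive (contDiff_primitive hwψ), deriv_primitive hwψ]⟩
    have ha : ContDiff ℝ ∞ fun x => χ.1 x - 2 * b x := χ.contDiff.sub (contDiff_const.mul hb)
    have a1 : deriv (fun x => χ.1 x - 2 * b x) = fun x => deriv χ.1 x - 2 * deriv b x :=
      funext fun x => ((hda χ.contDiff x).sub ((hda hb x).const_mul 2)).deriv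
    have a2 : deriv (fun x => deriv χ.1 x - 2 * deriv b x) =
        fun x => deriv (deriv χ.1) x - 2 * (w.1 x * ψ.1 x) := funext fun x => by
      rw [← eb]
      exact ((hda (hd χ.contDiff) x).sub ((hda (hd hb) x).const_mul 2)).deriv
    have a3 : deriv (fun x => deriv (deriv χ.1) x - 2 * (w.1 x * ψ.1 x)) = fun x =>
        deriv (deriv (deriv χ.1)) x - 2 * (deriv w.1 x * ψ.1 x + w.1 x * deriv ψ.1 x) :=
      funext fun x => ((hda (hd (hd χ.contDiff)) x).sub
        (((hda w.contDiff x).mul (hda ψ.contDiff x)).const_mul 2)).deriv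
    obtain ⟨w₁, hw₁, e1⟩ : ∃ f : ℝ → ℝ, ContDiff ℝ ∞ f ∧
        ∀ x, deriv f x = w.1 x * (χ.1 x - 2 * b x) :=
      ⟨_, contDiff_primitive (w.contDiff.mul ha), fun x => by
        rw [deriv_primitive (w.contDiff.mul ha)]⟩
    obtain ⟨w₄, hw₄, e4⟩ : ∃ f : ℝ → ℝ, ContDiff ℝ ∞ f ∧ ∀ x, deriv f x = w.1 x * b x :=
      ⟨_, contDiff_primitive (w.contDiff.mul hb), fun x => by
        rw [deriv_primitive (w.contDiff.mul hb)]⟩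
    have hwa := w.contDiff.mul (hd ha)
    obtain ⟨w₃, hw₃, e3⟩ : ∃ f : ℝ → ℝ, ContDiff ℝ ∞ f ∧
        ∀ x, deriv (deriv f) x = w.1 x * deriv (fun x => χ.1 x - 2 * b x) x :=
      ⟨_, contDiff_primitive (contDiff_primitive hwa), fun x => by
        rw [deriv_primitive (contDiff_primitive hwa), deriv_primitive hwa]⟩
    have hv : ContDiff ℝ ∞ v.1 := v.2.1.1
    have hw₂ : ContDiff ℝ ∞ fun x => (v.1 x - w₁ x - 2 * (w₃ x + w₄ x)) / 4 :=
      ((hv.sub hw₁).sub (contDiff_const.mul (hw₃.add hw₄))).div_const 4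
    have d1 : deriv (fun x => (v.1 x - w₁ x - 2 * (w₃ x + w₄ x)) / 4) = fun x =>
        (deriv v.1 x - w.1 x * (χ.1 x - 2 * b x) - 2 * (deriv w₃ x + w.1 x * b x)) / 4 :=
      funext fun x => by
        rw [← e1, ← e4]
        exact ((((hda hv x).sub (hda hw₁ x)).sub
          (((hda hw₃ x).add (hda hw₄ x)).const_mul 2)).div_const 4).deriv
    have d2 : ∀ x, deriv (fun x =>
        (deriv v.1 x - w.1 x * (χ.1 x - 2 * b x) - 2 * (deriv w₃ x + w.1 x * b x)) / 4) x =
        (deriv (deriv v.1) x - (deriv w.1 x * (χ.1 x - 2 * b x) +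
          w.1 x * deriv (fun x => χ.1 x - 2 * b x) x) - 2 * (w.1 x *
          deriv (fun x => χ.1 x - 2 * b x) x + (deriv w.1 x * b x + w.1 x * deriv b x))) / 4 :=
      fun x => by
        exact ((((hda (hd hv) x).sub ((hda w.contDiff x).mul (hda ha x))).sub
          ((((hda (hd hw₃) x).congr_deriv (e3 x)).add
            ((hda w.contDiff x).mul (hda hb x))).const_mul 2)).div_const 4).deriv
    refine ⟨fun x => χ.1 x - 2 * b x, b, w₁, _, w₃, w₄, ⟨ha, hb, hw₁, hw₂, hw₃, hw₄⟩,
      fun x => ?_, eb, fun x => ?_, e1, fun x => ?_, e3, e4, fun x => ?_⟩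
    · have := congrArg (fun f : PerAlg => f.1 x) eχ
      simp only [D_apply, opA, PerAlg.add_apply, PerAlg.mul_apply, ofNat_apply] at this
      rw [a1, a2, a3]
      change deriv (deriv (deriv χ.1)) x - _ = _
      change deriv (deriv (deriv χ.1)) x = _ at this
      rw [this]
      ring
    · ring
    · have := congrArg (fun f : PerAlg => f.1 x) ev
      simp only [D_apply, opB, PerAlg.add_apply, PerAlg.mul_apply, ofNat_apply] at this
      change deriv (deriv v.1) x = _ at this
      rw [d1, d2, this, a1]
      ring
    · ring

theorem eta_iff (u φ v : M) : eta u φ v ↔ ∃ ψ χ : PerAlg, D (D ψ) = toAlg φ ∧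
    D (D (D χ)) = opA (wbar u) ψ ∧ D (D (toAlg v)) = opB (wbar u) χ := by
  have key : ∀ ψ : PerAlg, (∀ x, iteratedDeriv 2 ψ.1 x = φ.1 x) ↔ D (D ψ) = toAlg φ := fun ψ => by
    rw [Subtype.ext_iff, funext_iff]
    refine forall_congr' fun x => ?_
    rw [← D_iterate_apply 2]
    rfl
  constructor
  · rintro ⟨ψ, χ, h1, h2⟩
    exact ⟨⟨ψ.1, ψ.2⟩, ⟨χ.1, χ.2⟩, (key ⟨ψ.1, ψ.2⟩).mp h1,
      (etaVia_iff u ⟨ψ.1, ψ.2⟩ ⟨χ.1, χ.2⟩ v).mp h2⟩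
  · rintro ⟨ψ, χ, h1, h2⟩
    exact ⟨⟨ψ.1, ψ.2⟩, ⟨χ.1, χ.2⟩, (key ψ).mpr h1, (etaVia_iff u ψ χ v).mpr h2⟩

/-! ### Skew-adjointness -/

/-- Both pairings are moved onto `ψ` and `χ`; then `A* = -B` and the skewness of `∂³` cancel them.
No choice of primitives matters. -/
theorem eta_skew {u φ v φ' v' : M} (h : eta u φ v) (h' : eta u φ' v') :
    pair φ.1 v'.1 + pair φ'.1 v.1 = 0 := by
  obtain ⟨ψ, χ, h1, h2, h3⟩ := (eta_iff u φ v).mp h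
  obtain ⟨ψ', χ', h1', h2', h3'⟩ := (eta_iff u φ' v').mp h'
  rw [pair_toAlg, pair_toAlg, ← h1, ← h1', perInt_D2_mul, perInt_D2_mul, h3, h3']
  have e1 := perInt_opA_mul (wbar u) ψ χ'
  have e2 := perInt_opA_mul (wbar u) ψ' χ
  have e3 := perInt_D3_mul χ χ'
  rw [← h2] at e1
  rw [← h2', mul_comm] at e2
  linarith

/-! ### Maximality of the skew relation `η` -/

theorem exists_orthogonal (e g : PerAlg) : ∃ α : ℝ, perInt ((g - α • e) * e) = 0 := by
  by_cases h : perInt (e * e) = 0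
  · exact ⟨0, by rw [eq_zero_of_perInt_mul_self h]; simp⟩
  · refine ⟨perInt (g * e) / perInt (e * e), ?_⟩
    rw [sub_mul, map_sub, smul_mul_assoc, map_smul, smul_eq_mul, div_mul_cancel₀ _ h, sub_self]

/-- One Gram–Schmidt step; the two functions may be dependent or zero. -/
theorem exists_orthogonal₂ (e₁ e₂ g : PerAlg) : ∃ α β : ℝ,
    perInt ((g - α • e₁ - β • e₂) * e₁) = 0 ∧ perInt ((g - α • e₁ - β • e₂) * e₂) = 0 := by
  obtain ⟨α, hα⟩ := exists_orthogonal e₁ e₂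
  obtain ⟨β, hβ⟩ := exists_orthogonal e₁ g
  obtain ⟨γ, hγ⟩ := exists_orthogonal (e₂ - α • e₁) g
  refine ⟨β - γ * α, γ, ?_, ?_⟩
  all_goals
    simp only [sub_mul, mul_sub, smul_mul_assoc, mul_smul_comm, map_sub, map_smul, smul_eq_mul,
      mul_comm e₁ e₂] at *
  · linear_combination hβ - γ * hα
  · linear_combination hγ + α * hβ - (γ * α + β) * hα

theorem exists_D3_eq {f : PerAlg} (h : perInt f = 0) : ∃ χ, D (D (D χ)) = f := by
  obtain ⟨m, hm⟩ := exists_D_toAlg_eq h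
  exact ⟨toAlg (Dinv (Dinv m)), by simp [hm]⟩

theorem exists_D2_toAlg_eq {f : PerAlg} (h : perInt f = 0) : ∃ v : M, D (D (toAlg v)) = f := by
  obtain ⟨m, hm⟩ := exists_D_toAlg_eq h
  exact ⟨Dinv m, by simp [hm]⟩

/-- The hypothesis makes the residual `v'' - Bχ₀` orthogonal to every `ψ` in the domain of `η`, that
is, to every `ψ` orthogonal to `w'` and `Bu`. So the residual lies in the span of these two
functions, which is exactly what the constants of integration can absorb. -/
theorem eta_of_skew {u φ v : M}
    (h : ∀ φ' v' : M, eta u φ' v' → pair φ.1 v'.1 + pair φ'.1 v.1 = 0) : eta u φ v := by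
  set w := wbar u with hw
  set U := toAlg u with hU
  have hDw : D w = D (D (D U)) := D_wbar u
  set ψ₀ := toAlg (Dinv (Dinv φ)) with hψ₀
  have hψφ : D (D ψ₀) = toAlg φ := by simp [hψ₀]
  -- The choice `ψ = 0`, `χ = 1` shows that `u_x` is a value at the zero covector. Testing against
  -- it gives the solvability condition for `χ₀`.
  have horth : perInt (D w * ψ₀) = 0 := by
    have h1 := h 0 (Dx u) ((eta_iff _ _ _).mpr ⟨0, 1, by simp, by simp [opA], by
      simp [opB, ← hw, hDw, ← hU]⟩)
    rw [pair_toAlg, pair_toAlg, map_zero, zero_mul, map_zero, add_zero, ← hψφ, perInt_D2_mul,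
      toAlg_Dx] at h1
    rw [hDw, mul_comm]
    exact h1
  obtain ⟨χ₀, hχ₀⟩ := exists_D3_eq (f := opA w ψ₀) (by rw [perInt_opA, horth, neg_zero])
  have hmain : ∀ ψ : PerAlg, perInt (ψ * D w) = 0 → perInt (ψ * opB w U) = 0 →
      perInt (ψ * (D (D (toAlg v)) - opB w χ₀)) = 0 := by
    intro ψ h1 h2
    obtain ⟨χ, hχ⟩ := exists_D3_eq (f := opA w ψ) (by rw [perInt_opA, mul_comm, h1, neg_zero])
    -- As `w' = u'''`, the mean of `Bχ` is `-2∫u'''χ = 2∫u Aψ = -2∫ψ Bu`.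
    have h3 : perInt (opB w χ) = 0 := by
      have e1 := perInt_D3_mul U χ
      have e2 := perInt_opA_mul w ψ U
      rw [perInt_opB, hDw, e1, hχ, mul_comm U, e2, h2]
      simp
    obtain ⟨v', hv'⟩ := exists_D2_toAlg_eq h3
    obtain ⟨φ', hφ'⟩ := exists_toAlg_eq (f := D (D ψ)) (perInt_D _)
    have h4 := h φ' v' ((eta_iff _ _ _).mpr ⟨ψ, χ, hφ'.symm, hχ, hv'⟩)
    rw [pair_toAlg, pair_toAlg, hφ', ← hψφ, perInt_D2_mul, perInt_D2_mul, hv'] at h4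
    have e1 := perInt_opA_mul w ψ₀ χ
    have e2 := perInt_opA_mul w ψ χ₀
    have e3 := perInt_D3_mul χ₀ χ
    rw [hχ₀, hχ, mul_comm χ₀] at e3
    rw [mul_sub, map_sub]
    linarith
  obtain ⟨α, β, h1, h2⟩ := exists_orthogonal₂ (D w) (opB w U) (D (D (toAlg v)) - opB w χ₀)
  have hr := hmain _ h1 h2
  set r := D (D (toAlg v)) - opB w χ₀ - α • D w - β • opB w U with hrdef
  have hrr : perInt (r * r) = 0 := by
    have : perInt (r * r) = perInt (r * (D (D (toAlg v)) - opB w χ₀)) - α * perInt (r * D w) -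
        β * perInt (r * opB w U) := by
      rw [← smul_eq_mul α, ← smul_eq_mul β, ← map_smul, ← map_smul, ← map_sub, ← map_sub,
        ← mul_smul_comm, ← mul_smul_comm, ← mul_sub, ← mul_sub]
    rw [this, hr, h1, h2]
    simp
  have hr0 := eq_zero_of_perInt_mul_self hrr
  -- `A(β/2) = βw' = (βu)'''`, and `B(βu + α) = βBu + αw'` supplies the residual.
  refine (eta_iff _ _ _).mpr ⟨ψ₀ + algebraMap ℝ PerAlg (β / 2), χ₀ + β • U + algebraMap ℝ PerAlg α,
    by simp [hψφ], ?_, ?_⟩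
  · have hβ : algebraMap ℝ PerAlg β = 2 * algebraMap ℝ PerAlg (β / 2) := by
      rw [← map_ofNat (algebraMap ℝ PerAlg) 2, ← map_mul]
      congr 1
      ring
    simp only [map_add, hχ₀, ← hw, Algebra.smul_def, hβ]
    simp [opA, hDw]
    ring
  · have : D (D (toAlg v)) = opB w χ₀ + α • D w + β • opB w U := by
      rw [← sub_eq_zero, ← hr0, hrdef]
      ring
    rw [this, ← hw]
    simp only [opB, map_add, D_algebraMap, Algebra.smul_def, D_mul]
    ring

/-! ### Skew-adjointness of the pencil and of `ϑ` -/

theorem pencil_zero (u φ v : M) : pencil 0 u φ v ↔ eta u φ v := by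
  constructor
  · rintro ⟨w, hw, rfl⟩
    simpa using hw
  · exact fun h => ⟨v, h, by simp⟩

theorem pencil_iff (κ : ℝ) (u φ v : M) : pencil κ u φ v ↔ eta u φ (v - κ • Dx φ) := by
  constructor
  · rintro ⟨w, hw, rfl⟩
    simpa using hw
  · exact fun h => ⟨_, h, by simp⟩

theorem pair_Dx (φ φ' : M) : pair φ.1 (Dx φ').1 = -pair φ'.1 (Dx φ).1 := by
  rw [pair_toAlg, pair_toAlg, toAlg_Dx, toAlg_Dx, perInt_mul_D, mul_comm]

theorem pencil_skewAdjoint (κ : ℝ) (u φ v : M) : pencil κ u φ v ↔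
    ∀ φ' v' : M, pencil κ u φ' v' → pair φ.1 v'.1 + pair φ'.1 v.1 = 0 := by
  have key : ∀ φ' w : M, pair φ.1 (w + κ • Dx φ').1 + pair φ'.1 v.1 =
      pair φ.1 w.1 + pair φ'.1 (v - κ • Dx φ).1 := by
    intro φ' w
    have h := pair_Dx φ φ'
    simp only [pair_toAlg, map_add, map_sub, map_smul, mul_add, mul_sub, mul_smul_comm,
      smul_eq_mul] at h ⊢
    rw [h]
    ring
  rw [pencil_iff]
  constructor
  · rintro h φ' v' ⟨w, hw, rfl⟩
    rw [key]
    exact eta_skew h hw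
  · intro h
    refine eta_of_skew fun φ' w hw => ?_
    rw [← key]
    exact h φ' _ ⟨w, hw, rfl⟩

theorem theta_skewAdjoint (u φ v : M) : theta u φ v ↔
    ∀ φ' v' : M, theta u φ' v' → pair φ.1 v'.1 + pair φ'.1 v.1 = 0 := by
  constructor
  · rintro rfl φ' _ rfl
    rw [pair_Dx]
    ring
  · intro h
    -- Testing with the defect itself gives its squared norm.
    have h1 := h (v - Dx φ) _ rfl
    rw [pair_Dx] at h1
    have h2 : toAlg (v - Dx φ) = 0 := by
      refine eq_zero_of_perInt_mul_self ?_
      simp only [pair_toAlg] at h1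
      rw [← h1, map_sub toAlg v]
      simp only [mul_sub, sub_mul, map_sub]
      ring
    exact sub_eq_zero.mp (toAlg_injective (by rw [h2, map_zero]))

end OV

namespace OV

open MeasureTheory Filter Topology PerAlg

/-! ### The Jacobi identity: algebraic part -/

/-- The cubic expression in the primitives of three sections that the cyclic sum in the Jacobi
identity for `η` reduces to. -/
theorem perInt_jacobi_eta {w ψ₁ ψ₂ ψ₃ χ₁ χ₂ χ₃ : PerAlg} (h₁ : D (D (D χ₁)) = opA w ψ₁)
    (h₂ : D (D (D χ₂)) = opA w ψ₂) (h₃ : D (D (D χ₃)) = opA w ψ₃) :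
    perInt (opB w χ₁ * (D ψ₂ * χ₃ - D ψ₃ * χ₂ + 2 * (ψ₃ * D χ₂ - ψ₂ * D χ₃)) +
      opB w χ₂ * (D ψ₃ * χ₁ - D ψ₁ * χ₃ + 2 * (ψ₁ * D χ₃ - ψ₃ * D χ₁)) +
      opB w χ₃ * (D ψ₁ * χ₂ - D ψ₂ * χ₁ + 2 * (ψ₂ * D χ₁ - ψ₁ * D χ₂))) = 0 := by
  rw [← map_zero perInt]
  -- The primitive is the Wronskian of `χ₁`, `χ₂`, `χ₃`; its derivative contains third derivatives
  -- only, which `A` replaces.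
  refine perInt_congr_D (D (D χ₃) * (χ₁ * D χ₂ - D χ₁ * χ₂) + D (D χ₁) * (χ₂ * D χ₃ - D χ₂ * χ₃) +
    D (D χ₂) * (χ₃ * D χ₁ - D χ₃ * χ₁)) ?_
  simp only [D_mul, map_add, map_sub, h₁, h₂, h₃, opA, opB]
  ring

/-- The contribution of `ϑ` to the cyclic sum in the Jacobi identity. -/
theorem perInt_jacobi_theta {w ψ₁ ψ₂ ψ₃ χ₁ χ₂ χ₃ : PerAlg} (h₁ : D (D (D χ₁)) = opA w ψ₁)
    (h₂ : D (D (D χ₂)) = opA w ψ₂) (h₃ : D (D (D χ₃)) = opA w ψ₃) :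
    perInt (D (D (D (D (D ψ₁)))) * (D ψ₂ * χ₃ - D ψ₃ * χ₂ + 2 * (ψ₃ * D χ₂ - ψ₂ * D χ₃)) +
      D (D (D (D (D ψ₂)))) * (D ψ₃ * χ₁ - D ψ₁ * χ₃ + 2 * (ψ₁ * D χ₃ - ψ₃ * D χ₁)) +
      D (D (D (D (D ψ₃)))) * (D ψ₁ * χ₂ - D ψ₂ * χ₁ + 2 * (ψ₂ * D χ₁ - ψ₁ * D χ₂))) = 0 := by
  -- The terms containing one fixed `χ` are collected as `∫ W'''χ`; moving `∂³` onto `χ` and using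
  -- `χ''' = Aψ` leaves an expression in `w` and the `ψ`'s whose cyclic sum vanishes identically.
  have key : ∀ ψ₁ ψ₂ ψ₃ χ₃ : PerAlg, D (D (D χ₃)) = opA w ψ₃ →
      perInt (D (D (D (D (D ψ₁)))) * (D ψ₂ * χ₃ - 2 * (ψ₂ * D χ₃)) -
        D (D (D (D (D ψ₂)))) * (D ψ₁ * χ₃ - 2 * (ψ₁ * D χ₃))) =
      perInt (w * (2 * ψ₃ * (2 * (D (D (D (D ψ₁))) * ψ₂ - D (D (D (D ψ₂))) * ψ₁) -
        (D (D (D ψ₁)) * D ψ₂ - D (D (D ψ₂)) * D ψ₁)) -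
        D ψ₃ * (2 * (D (D (D ψ₁)) * ψ₂ - D (D (D ψ₂)) * ψ₁) -
          3 * (D (D ψ₁) * D ψ₂ - D (D ψ₂) * D ψ₁)))) := by
    intro ψ₁ ψ₂ ψ₃ χ₃ h
    set W := 2 * (D (D (D ψ₁)) * ψ₂ - D (D (D ψ₂)) * ψ₁) -
          3 * (D (D ψ₁) * D ψ₂ - D (D ψ₂) * D ψ₁) with hW
    have hW1 : D W = 2 * (D (D (D (D ψ₁))) * ψ₂ - D (D (D (D ψ₂))) * ψ₁) -
        (D (D (D ψ₁)) * D ψ₂ - D (D (D ψ₂)) * D ψ₁) := by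
      rw [hW]
      simp only [D_mul, map_sub, D_ofNat]
      ring
    have hW3 : D (D (D W)) = 3 * (D (D (D (D (D ψ₁)))) * D ψ₂ - D (D (D (D (D ψ₂)))) * D ψ₁) +
        2 * (D (D (D (D (D (D ψ₁))))) * ψ₂ - D (D (D (D (D (D ψ₂))))) * ψ₁) := by
      rw [hW1]
      simp only [D_mul, map_sub, map_add, D_ofNat, map_zero]
      ring
    have e1 : perInt (D (D (D (D (D ψ₁)))) * (D ψ₂ * χ₃ - 2 * (ψ₂ * D χ₃)) -
        D (D (D (D (D ψ₂)))) * (D ψ₁ * χ₃ - 2 * (ψ₁ * D χ₃))) = perInt (D (D (D W)) * χ₃) := by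
      refine perInt_congr_D (-2 * (D (D (D (D (D ψ₁)))) * ψ₂ - D (D (D (D (D ψ₂)))) * ψ₁) * χ₃) ?_
      rw [hW3]
      simp only [D_mul, map_sub, map_neg, D_ofNat]
      ring
    rw [e1, perInt_D3_mul, h, ← hW1, ← map_neg]
    refine perInt_congr_D (-2 * w * ψ₃ * W) ?_
    simp only [opA, D_mul, map_neg, D_ofNat]
    ring
  have k1 := key ψ₁ ψ₂ ψ₃ χ₃ h₃
  have k2 := key ψ₂ ψ₃ ψ₁ χ₁ h₁
  have k3 := key ψ₃ ψ₁ ψ₂ χ₂ h₂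
  have := congrArg₂ (· + ·) (congrArg₂ (· + ·) k1 k2) k3
  simp only [← map_add] at this
  refine Eq.trans ?_ (this.trans ?_)
  · congr 1
    ring
  · rw [← map_zero perInt]
    congr 1
    ring

/-! ### Smooth families and smooth sections -/

theorem SmoothMap.contDiff {Φ : M → M} (hΦ : SmoothMap Φ) {k : ℕ} {p : (Fin k → ℝ) → M}
    (hp : SmoothFamily p) : ContDiff ℝ ∞ fun z : (Fin k → ℝ) × ℝ => (Φ (p z.1)).1 z.2 :=
  hΦ k p hp

/-- A path in `M` that is smooth in both variables. -/
def SmoothMPath (p : ℝ → M) : Prop := ContDiff ℝ ∞ fun z : ℝ × ℝ => (p z.1).1 z.2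

theorem SmoothMPath.family {p : ℝ → M} (hp : SmoothMPath p) :
    SmoothFamily (fun s : Fin 1 → ℝ => p (s 0)) :=
  ContDiff.comp (g := fun z : ℝ × ℝ => (p z.1).1 z.2) hp
    (by fun_prop : ContDiff ℝ ∞ fun z : (Fin 1 → ℝ) × ℝ => (z.1 0, z.2))

theorem SmoothFamily.path {p : (Fin 1 → ℝ) → M} (hp : SmoothFamily p) :
    SmoothMPath (fun r => p fun _ => r) :=
  ContDiff.comp (g := fun z : (Fin 1 → ℝ) × ℝ => (p z.1).1 z.2) hp
    (by fun_prop : ContDiff ℝ ∞ fun z : ℝ × ℝ => ((fun _ : Fin 1 => z.1), z.2))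

theorem SmoothMap.path {Φ : M → M} (hΦ : SmoothMap Φ) {p : ℝ → M} (hp : SmoothMPath p) :
    SmoothMPath (fun r => Φ (p r)) :=
  SmoothFamily.path (hΦ 1 _ hp.family)

theorem smoothMPath_line (u h : M) : SmoothMPath (fun r : ℝ => u + r • h) := by
  have h1 := u.2.1.1
  have h2 := h.2.1.1
  change ContDiff ℝ ∞ fun z : ℝ × ℝ => u.1 z.2 + z.1 * h.1 z.2
  exact (h1.comp contDiff_snd).add (contDiff_fst.mul (h2.comp contDiff_snd))

theorem SmoothMPath.smoothPath {p : ℝ → M} (hp : SmoothMPath p) :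
    SmoothPath (fun r => toAlg (p r)) := hp

theorem SmoothMPath.perInt_pathDeriv {p : ℝ → M} (hp : SmoothMPath p) (s : ℝ) :
    perInt (hp.smoothPath.pathDeriv s) = 0 := by
  have h := hp.smoothPath.perInt_pathDeriv s
  simp only [perInt_toAlg] at h
  exact h.unique (hasDerivAt_const s 0)

/-- The velocity of a smooth path in `M`. -/
def SmoothMPath.velocity {p : ℝ → M} (hp : SmoothMPath p) (s : ℝ) : M :=
  ⟨_, (hp.smoothPath.pathDeriv s).2, hp.perInt_pathDeriv s⟩

theorem SmoothMPath.hasPathDeriv {p : ℝ → M} (hp : SmoothMPath p) (s : ℝ) :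
    HasPathDeriv (fun r => toAlg (p r)) (toAlg (hp.velocity s)) s :=
  hp.smoothPath.hasPathDeriv s

/-- A smooth map has derivatives along lines. -/
theorem SmoothMap.exists_dirDeriv {Φ : M → M} (hΦ : SmoothMap Φ) (u h : M) :
    ∃ Φ' : M, dirDeriv Φ u h = Φ'.1 ∧
      HasPathDeriv (fun r : ℝ => toAlg (Φ (u + r • h))) (toAlg Φ') 0 :=
  ⟨(hΦ.path (smoothMPath_line u h)).velocity 0, rfl, (hΦ.path (smoothMPath_line u h)).hasPathDeriv 0⟩

/-! ### Smoothness of the basic maps -/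

theorem contDiff_primitive_family {E : Type} [NormedAddCommGroup E] [NormedSpace ℝ E]
    [ProperSpace E] {p : E → M} (hp : ContDiff ℝ ∞ fun z : E × ℝ => (p z.1).1 z.2) :
    ContDiff ℝ ∞ fun z : E × ℝ => (Dinv (p z.1)).1 z.2 := by
  have h1 := contDiff_primitive_param hp
  exact h1.sub (contDiff_const.mul ((contDiff_integral_param h1 0 (2 * Real.pi)).comp contDiff_fst))

theorem smoothMap_Dinv : SmoothMap Dinv := fun _ _ hp => contDiff_primitive_family hp

theorem smoothMap_Dx : SmoothMap Dx := fun _ _ hp => contDiff_deriv_snd hp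

theorem SmoothMap.add {Φ Ψ : M → M} (h1 : SmoothMap Φ) (h2 : SmoothMap Ψ) :
    SmoothMap (fun u => Φ u + Ψ u) := fun k p hp => (h1 k p hp).add (h2 k p hp)

theorem SmoothMap.sub {Φ Ψ : M → M} (h1 : SmoothMap Φ) (h2 : SmoothMap Ψ) :
    SmoothMap (fun u => Φ u - Ψ u) := fun k p hp => (h1 k p hp).sub (h2 k p hp)

theorem SmoothMap.smul (c : ℝ) {Φ : M → M} (h1 : SmoothMap Φ) :
    SmoothMap (fun u => c • Φ u) := fun k p hp => contDiff_const.smul (h1 k p hp)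

theorem SmoothMap.comp {Φ Ψ : M → M} (h1 : SmoothMap Φ) (h2 : SmoothMap Ψ) :
    SmoothMap (fun u => Φ (Ψ u)) := fun k p hp => h1 k _ (h2 k p hp)

theorem smoothMap_id : SmoothMap fun u => u := fun _ _ hp => hp

theorem smoothMap_const (c : M) : SmoothMap fun _ => c := fun _ _ _ =>
  c.2.1.1.comp contDiff_snd

theorem smoothMap_K : SmoothMap K := fun k p hp => by
  have h := smoothMap_Dx k p hp
  have h' := smoothMap_Dinv k p hp
  exact ((ContDiff.mul hp h).neg).sub h'

/-- A smooth map from `M` to the smooth periodic functions. -/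
def SmoothAlgMap (Φ : M → PerAlg) : Prop :=
  ∀ (k : ℕ) (p : (Fin k → ℝ) → M), SmoothFamily p →
    ContDiff ℝ ∞ fun z : (Fin k → ℝ) × ℝ => (Φ (p z.1)).1 z.2

theorem SmoothMap.toAlg {Φ : M → M} (h : SmoothMap Φ) : SmoothAlgMap fun u => toAlg (Φ u) := h

namespace SmoothAlgMap

variable {Φ Ψ : M → PerAlg}

theorem add (h1 : SmoothAlgMap Φ) (h2 : SmoothAlgMap Ψ) : SmoothAlgMap fun u => Φ u + Ψ u :=
  fun k p hp => (h1 k p hp).add (h2 k p hp)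

theorem sub (h1 : SmoothAlgMap Φ) (h2 : SmoothAlgMap Ψ) : SmoothAlgMap fun u => Φ u - Ψ u :=
  fun k p hp => (h1 k p hp).sub (h2 k p hp)

theorem mul (h1 : SmoothAlgMap Φ) (h2 : SmoothAlgMap Ψ) : SmoothAlgMap fun u => Φ u * Ψ u :=
  fun k p hp => (h1 k p hp).mul (h2 k p hp)

theorem const (c : PerAlg) : SmoothAlgMap fun _ => c :=
  fun _ _ _ => c.contDiff.comp contDiff_snd

theorem smul (c : ℝ) (h1 : SmoothAlgMap Φ) : SmoothAlgMap fun u => c • Φ u :=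
  fun k p hp => contDiff_const.smul (h1 k p hp)

theorem D (h1 : SmoothAlgMap Φ) : SmoothAlgMap fun u => PerAlg.D (Φ u) :=
  fun k p hp => contDiff_deriv_snd (h1 k p hp)

theorem perInt (h1 : SmoothAlgMap Φ) : SmoothFunctional fun u => perInt (Φ u) :=
  fun k p hp => contDiff_integral_param (h1 k p hp) 0 (2 * Real.pi)

theorem path (h1 : SmoothAlgMap Φ) {p : ℝ → M} (hp : SmoothMPath p) :
    SmoothPath fun r => Φ (p r) :=
  ContDiff.comp (g := fun z : (Fin 1 → ℝ) × ℝ => (Φ (p (z.1 0))).1 z.2) (h1 1 _ hp.family)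
    (by fun_prop : ContDiff ℝ ∞ fun z : ℝ × ℝ => ((fun _ : Fin 1 => z.1), z.2))

end SmoothAlgMap

theorem smoothAlgMap_wbar : SmoothAlgMap wbar :=
  smoothMap_id.toAlg.D.D.add (SmoothAlgMap.const _)

theorem SmoothAlgMap.opA {Φ Ψ : M → PerAlg} (h1 : SmoothAlgMap Φ) (h2 : SmoothAlgMap Ψ) :
    SmoothAlgMap fun u => opA (Φ u) (Ψ u) :=
  ((((SmoothAlgMap.const 2).mul h1.D).mul h2)).add (((SmoothAlgMap.const 3).mul h1).mul h2.D)

theorem SmoothAlgMap.opB {Φ Ψ : M → PerAlg} (h1 : SmoothAlgMap Φ) (h2 : SmoothAlgMap Ψ) :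
    SmoothAlgMap fun u => opB (Φ u) (Ψ u) :=
  (h1.D.mul h2).add (((SmoothAlgMap.const 3).mul h1).mul h2.D)

theorem SmoothFunctional.differentiable {F : M → ℝ} (hF : SmoothFunctional F) {p : ℝ → M}
    (hp : SmoothMPath p) : Differentiable ℝ fun r => F (p r) :=
  ((hF 1 _ hp.family).comp (by fun_prop : ContDiff ℝ ∞ fun r : ℝ => fun _ : Fin 1 => r)).differentiable
    (by simp)

/-- The projection onto the functions of zero mean. -/
def subMean (f : PerAlg) : M := ⟨fun x => f.1 x - mean f.1, sub_mean_mem_M f.2⟩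

theorem toAlg_subMean {f : PerAlg} (h : perInt f = 0) : toAlg (subMean f) = f :=
  PerAlg.ext fun x => by
    have : mean f.1 = 0 := by
      change (2 * Real.pi)⁻¹ * perInt f = 0
      rw [h, mul_zero]
    change f.1 x - mean f.1 = f.1 x
    rw [this, sub_zero]

theorem SmoothAlgMap.subMean {Φ : M → PerAlg} (h1 : SmoothAlgMap Φ) :
    SmoothMap fun u => subMean (Φ u) := fun k p hp =>
  (h1 k p hp).sub (contDiff_const.mul ((h1.perInt k p hp).comp contDiff_fst))

end OV

namespace OV

open MeasureTheory Filter Topology PerAlg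

/-! ### Values of `η` and their derivatives along lines -/

/-- Two derivatives turn `D_x⁻¹u` into `u_x`, which is `3·(1/3)u_x`, the contribution to `B u` of
the constant in `ū`. -/
theorem DD_toAlg_K (u : M) : D (D (toAlg (K u))) = -opB (wbar u) (toAlg u) := by
  have h : (3 : PerAlg) * algebraMap ℝ PerAlg (1 / 3) = 1 := by
    rw [← map_ofNat (algebraMap ℝ PerAlg) 3, ← map_mul]
    norm_num
  rw [toAlg_K]
  simp only [map_sub, map_neg, D_mul, map_add, D_toAlg_Dinv, opB, wbar, D_algebraMap]
  linear_combination (D (toAlg u)) * h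

/-- The component of zero mean of `∂⁻³ A ∂⁻² φ`. -/
def chiPart (u φ : M) : M := Dinv (Dinv (Dinv (subMean (opA (wbar u) (toAlg (Dinv (Dinv φ)))))))

/-- The value of `η` obtained from the primitives of zero mean. -/
def etaPart (u φ : M) : M := Dinv (Dinv (subMean (opB (wbar u) (toAlg (chiPart u φ)))))

/-- All values of `η` at `φ` arise from the primitives of zero mean by adding constants to `ψ` and
`χ`. -/
theorem eta_param {u φ v : M} (h : eta u φ v) : ∃ c d : ℝ,
    v = etaPart u φ - (2 * c) • K u + d • Dx u ∧
    D (D (toAlg (Dinv (Dinv φ)) + algebraMap ℝ PerAlg c)) = toAlg φ ∧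
    D (D (D (toAlg (chiPart u φ) + (2 * c) • toAlg u + algebraMap ℝ PerAlg d))) =
      opA (wbar u) (toAlg (Dinv (Dinv φ)) + algebraMap ℝ PerAlg c) ∧
    D (D (toAlg v)) =
      opB (wbar u) (toAlg (chiPart u φ) + (2 * c) • toAlg u + algebraMap ℝ PerAlg d) := by
  obtain ⟨ψ, χ, h1, h2, h3⟩ := (eta_iff u φ v).mp h
  set w := wbar u with hw
  set U := toAlg u with hU
  have hDw : D w = D (D (D U)) := D_wbar u
  set Ψ := toAlg (Dinv (Dinv φ)) with hΨ
  have hΨφ : D (D Ψ) = toAlg φ := by simp [hΨ]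
  obtain ⟨c, hc⟩ : ∃ c, ψ = Ψ + algebraMap ℝ PerAlg c := by
    have : D (ψ - Ψ) = 0 := D_eq_zero_of_D_iterate_eq_zero 1 (by
      change D (D (ψ - Ψ)) = 0
      rw [map_sub, map_sub, h1, hΨφ, sub_self])
    exact ⟨_, by rw [← eq_algebraMap_of_D_eq_zero this]; ring⟩
  have hc2 : algebraMap ℝ PerAlg (2 * c) = 2 * algebraMap ℝ PerAlg c := by
    rw [map_mul, map_ofNat]
  -- `A` maps the constant `c` to `2c w' = (2c u)'''`; hence the shift of `χ` by `2c u`.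
  have hA : opA w ψ = opA w Ψ + (2 * c) • D (D (D U)) := by
    rw [hc, Algebra.smul_def, hc2, ← hDw]
    simp only [opA, map_add, D_algebraMap]
    ring
  have hAΨ : perInt (opA w Ψ) = 0 := by
    have := congrArg perInt (h2.trans hA)
    simpa using this.symm
  have hX : D (D (D (toAlg (chiPart u φ)))) = opA w Ψ := by
    simp [chiPart, toAlg_subMean hAΨ, ← hw, ← hΨ]
  obtain ⟨d, hd⟩ : ∃ d, χ = toAlg (chiPart u φ) + (2 * c) • U + algebraMap ℝ PerAlg d := by
    have : D (χ - toAlg (chiPart u φ) - (2 * c) • U) = 0 := D_eq_zero_of_D_iterate_eq_zero 2 (by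
      change D (D (D (χ - toAlg (chiPart u φ) - (2 * c) • U))) = 0
      simp only [map_sub, D_smul, h2, hX, hA]
      ring)
    exact ⟨_, by rw [← eq_algebraMap_of_D_eq_zero this]; ring⟩
  refine ⟨c, d, ?_, hc ▸ h1, by rw [← hc, ← hd, h2], by rw [← hd, h3]⟩
  have hB : opB w χ = opB w (toAlg (chiPart u φ)) + (2 * c) • opB w U + d • D (D (D U)) := by
    rw [hd, ← hDw]
    simp only [opB, map_add, D_algebraMap, Algebra.smul_def, D_mul]
    ring
  have hBK : opB w U = -D (D (toAlg (K u))) := by rw [DD_toAlg_K, neg_neg]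
  have hBX : perInt (opB w (toAlg (chiPart u φ))) = 0 := by
    have := congrArg perInt (h3.trans hB)
    rw [hBK] at this
    simpa using this.symm
  have hQ : D (D (toAlg (etaPart u φ))) = opB w (toAlg (chiPart u φ)) := by
    simp [etaPart, toAlg_subMean hBX, ← hw]
  refine DD_toAlg_injective ?_
  simp only [map_add, map_sub, map_smul, D_smul, toAlg_Dx, h3, hB, hQ, hBK]
  module

/-- The Gram determinant of `K u` and `u_x`; `ψ` and `χ` are determined by `φ` and the value of `η`
where it does not vanish. -/
def gram (u : M) : ℝ := perInt (toAlg (K u) * toAlg (K u)) * perInt (D (toAlg u) * D (toAlg u)) -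
  perInt (toAlg (K u) * D (toAlg u)) ^ 2

theorem smoothMap_chiPart {φ : M → M} (hφ : SmoothMap φ) : SmoothMap fun u => chiPart u (φ u) :=
  smoothMap_Dinv.comp (smoothMap_Dinv.comp (smoothMap_Dinv.comp
    (smoothAlgMap_wbar.opA (smoothMap_Dinv.comp (smoothMap_Dinv.comp hφ)).toAlg).subMean))

theorem smoothMap_etaPart {φ : M → M} (hφ : SmoothMap φ) : SmoothMap fun u => etaPart u (φ u) :=
  smoothMap_Dinv.comp (smoothMap_Dinv.comp
    (smoothAlgMap_wbar.opB (smoothMap_chiPart hφ).toAlg).subMean)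

/-- A smooth section carries no smooth choice of primitives a priori. The difference between `v` and
the normalized value is `-2cK + d u_x`; where `K` and `u_x` are independent this determines `c` and
`d` as quotients of smooth functionals. -/
theorem exists_differentiable_constants {φ v : M → M} (hφ : SmoothMap φ) (hv : SmoothMap v)
    (h : ∀ u, eta u (φ u) (v u)) : ∃ c d : M → ℝ,
    (∀ (p : ℝ → M), SmoothMPath p → ∀ s, gram (p s) ≠ 0 →
      DifferentiableAt ℝ (fun r => c (p r)) s ∧ DifferentiableAt ℝ (fun r => d (p r)) s) ∧
    ∀ u, gram u ≠ 0 →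
      D (D (toAlg (Dinv (Dinv (φ u))) + algebraMap ℝ PerAlg (c u))) = toAlg (φ u) ∧
      D (D (D (toAlg (chiPart u (φ u)) + (2 * c u) • toAlg u + algebraMap ℝ PerAlg (d u)))) =
        opA (wbar u) (toAlg (Dinv (Dinv (φ u))) + algebraMap ℝ PerAlg (c u)) ∧
      D (D (toAlg (v u))) =
        opB (wbar u) (toAlg (chiPart u (φ u)) + (2 * c u) • toAlg u +
          algebraMap ℝ PerAlg (d u)) := by
  set R : M → PerAlg := fun u => toAlg (v u) - toAlg (etaPart u (φ u)) with hR
  have hRs : SmoothAlgMap R := hv.toAlg.sub (smoothMap_etaPart hφ).toAlg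
  have hk : SmoothAlgMap fun u => toAlg (K u) := smoothMap_K.toAlg
  have he : SmoothAlgMap fun u => D (toAlg u) := smoothMap_id.toAlg.D
  -- Cramer's rule for the two pairings of `-2cK + d u_x` with `K` and `u_x`.
  refine ⟨fun u => -(perInt (R u * toAlg (K u)) * perInt (D (toAlg u) * D (toAlg u)) -
      perInt (R u * D (toAlg u)) * perInt (toAlg (K u) * D (toAlg u))) / (2 * gram u),
    fun u => (perInt (R u * D (toAlg u)) * perInt (toAlg (K u) * toAlg (K u)) -
      perInt (R u * toAlg (K u)) * perInt (toAlg (K u) * D (toAlg u))) / gram u, ?_, ?_⟩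
  · intro p hp s hs
    have d1 := (hk.mul hk).perInt.differentiable hp s
    have d2 := (he.mul he).perInt.differentiable hp s
    have d3 := (hk.mul he).perInt.differentiable hp s
    have d4 := (hRs.mul hk).perInt.differentiable hp s
    have d5 := (hRs.mul he).perInt.differentiable hp s
    have d6 : DifferentiableAt ℝ (fun r => gram (p r)) s := (d1.mul d2).sub (d3.pow 2)
    exact ⟨((d4.mul d2).sub (d5.mul d3)).neg.div (d6.const_mul 2) (mul_ne_zero two_ne_zero hs),
      ((d5.mul d1).sub (d4.mul d3)).div d6 hs⟩
  · intro u hu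
    obtain ⟨c, d, hcd, h1, h2, h3⟩ := eta_param (h u)
    have hRu : R u = (-(2 * c)) • toAlg (K u) + d • D (toAlg u) := by
      simp only [hR]
      conv_lhs => rw [hcd]
      simp only [map_add, map_sub, map_smul, toAlg_Dx]
      module
    have e1 : perInt (R u * toAlg (K u)) = -(2 * c) * perInt (toAlg (K u) * toAlg (K u)) +
        d * perInt (toAlg (K u) * D (toAlg u)) := by
      rw [hRu, add_mul, map_add, smul_mul_assoc, smul_mul_assoc, map_smul, map_smul,
        mul_comm (D _)]
      rfl
    have e2 : perInt (R u * D (toAlg u)) = -(2 * c) * perInt (toAlg (K u) * D (toAlg u)) +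
        d * perInt (D (toAlg u) * D (toAlg u)) := by
      rw [hRu, add_mul, map_add, smul_mul_assoc, smul_mul_assoc, map_smul, map_smul]
      rfl
    have ec : -(perInt (R u * toAlg (K u)) * perInt (D (toAlg u) * D (toAlg u)) -
        perInt (R u * D (toAlg u)) * perInt (toAlg (K u) * D (toAlg u))) / (2 * gram u) = c := by
      rw [div_eq_iff (mul_ne_zero two_ne_zero hu), e1, e2, gram]
      ring
    have ed : (perInt (R u * D (toAlg u)) * perInt (toAlg (K u) * toAlg (K u)) -
        perInt (R u * toAlg (K u)) * perInt (toAlg (K u) * D (toAlg u))) / gram u = d := by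
      rw [div_eq_iff hu, e1, e2, gram]
      ring
    simp only [ec, ed]
    exact ⟨h1, h2, h3⟩

theorem hasPathDeriv_opA {f g : ℝ → PerAlg} {f' g' : PerAlg} {s : ℝ} (hf : HasPathDeriv f f' s)
    (hg : HasPathDeriv g g' s) :
    HasPathDeriv (fun r => opA (f r) (g r)) (opA (f s) g' + opA f' (g s)) s := by
  have := (((hf.D.constMul 2).mul hg)).add ((hf.constMul 3).mul hg.D)
  have e : opA (f s) g' + opA f' (g s) =
      2 * D (f s) * g' + 2 * D f' * g s + (3 * f s * D g' + 3 * f' * D (g s)) := by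
    simp only [opA]
    ring
  rw [e]
  exact this

theorem hasPathDeriv_opB {f g : ℝ → PerAlg} {f' g' : PerAlg} {s : ℝ} (hf : HasPathDeriv f f' s)
    (hg : HasPathDeriv g g' s) :
    HasPathDeriv (fun r => opB (f r) (g r)) (opB (f s) g' + opB f' (g s)) s := by
  have := (hf.D.mul hg).add ((hf.constMul 3).mul hg.D)
  have e : opB (f s) g' + opB f' (g s) =
      D (f s) * g' + D f' * g s + (3 * f s * D g' + 3 * f' * D (g s)) := by
    simp only [opB]
    ring
  rw [e]
  exact this

/-- A smooth section of the pencil at a point where the Gram determinant does not vanish, together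
with its derivatives. -/
theorem exists_tangent {κ : ℝ} {φ v : M → M} (hφ : SmoothMap φ) (hv : SmoothMap v)
    (h : ∀ u, pencil κ u (φ u) (v u)) {u : M} (hu : gram u ≠ 0) : ∃ ψ χ : PerAlg,
    D (D ψ) = toAlg (φ u) ∧ D (D (D χ)) = opA (wbar u) ψ ∧
    D (D (toAlg (v u))) = opB (wbar u) χ + κ • D (D (D (D (D ψ)))) ∧
    ∀ k : M, ∃ (φ' v' : M) (ψ' χ' : PerAlg), dirDeriv φ u k = φ'.1 ∧ dirDeriv v u k = v'.1 ∧
      D (D ψ') = toAlg φ' ∧ D (D (D χ')) = opA (wbar u) ψ' + opA (D (D (toAlg k))) ψ ∧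
      D (D (toAlg v')) = opB (wbar u) χ' + opB (D (D (toAlg k))) χ +
        κ • D (D (D (D (D ψ')))) := by
  have hW : SmoothMap fun u => v u - κ • Dx (φ u) := hv.sub ((smoothMap_Dx.comp hφ).smul κ)
  obtain ⟨c, d, hcd, hgen⟩ := exists_differentiable_constants hφ hW fun u =>
    (pencil_iff κ u _ _).mp (h u)
  set ψ : M → PerAlg := fun u => toAlg (Dinv (Dinv (φ u))) + algebraMap ℝ PerAlg (c u) with hψ
  set χ : M → PerAlg := fun u => toAlg (chiPart u (φ u)) + (2 * c u) • toAlg u +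
    algebraMap ℝ PerAlg (d u) with hχ
  have hgen' : ∀ u, gram u ≠ 0 → D (D (ψ u)) = toAlg (φ u) ∧
      D (D (D (χ u))) = opA (wbar u) (ψ u) ∧
      D (D (toAlg (v u))) = opB (wbar u) (χ u) + κ • D (D (D (D (D (ψ u))))) := by
    intro u hu
    obtain ⟨h1, h2, h3⟩ := hgen u hu
    refine ⟨h1, h2, ?_⟩
    simp only [map_sub, map_smul, D_smul, toAlg_Dx] at h3
    rw [sub_eq_iff_eq_add] at h3
    rw [h3]
    simp only [hψ, h1, hχ]
  obtain ⟨h1, h2, h3⟩ := hgen' u hu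
  refine ⟨ψ u, χ u, h1, h2, h3, fun k => ?_⟩
  have hp := smoothMPath_line u k
  have hp0 : u + (0 : ℝ) • k = u := by simp
  obtain ⟨φ', hφ', hφd⟩ := hφ.exists_dirDeriv u k
  obtain ⟨v', hv', hvd⟩ := hv.exists_dirDeriv u k
  obtain ⟨hc, hd⟩ := hcd _ hp 0 (by rwa [hp0])
  have hwd : HasPathDeriv (fun r : ℝ => wbar (u + r • k)) (D (D (toAlg k))) 0 := by
    have := (hasPathDeriv_line u k 0).D.D.add (HasPathDeriv.const (algebraMap ℝ PerAlg (1 / 3)))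
    simpa [wbar] using this
  have hψd := ((smoothMap_Dinv.comp (smoothMap_Dinv.comp hφ)).path hp).hasPathDeriv 0 |>.add
    (HasPathDeriv.const_fun hc.hasDerivAt)
  have hχd := (((smoothMap_chiPart hφ).path hp).hasPathDeriv 0 |>.add
    (HasPathDeriv.smul (hc.hasDerivAt.const_mul 2) (hasPathDeriv_line u k 0))).add
      (HasPathDeriv.const_fun hd.hasDerivAt)
  -- The defining equations of `ψ` and `χ` can be differentiated because they hold on a
  -- neighbourhood in the line.
  have hg : ∀ᶠ r in 𝓝 (0 : ℝ), gram (u + r • k) ≠ 0 := by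
    have hk : SmoothAlgMap fun u => toAlg (K u) := smoothMap_K.toAlg
    have he : SmoothAlgMap fun u => D (toAlg u) := smoothMap_id.toAlg.D
    have hcont : ContinuousAt (fun r : ℝ => gram (u + r • k)) 0 :=
      ((((hk.mul hk).perInt.differentiable hp 0).mul
        ((he.mul he).perInt.differentiable hp 0)).sub
        (((hk.mul he).perInt.differentiable hp 0).pow 2)).continuousAt
    exact hcont.eventually_ne (by simpa using hu)
  obtain ⟨ψ', hψd⟩ : ∃ ψ', HasPathDeriv (fun r : ℝ => ψ (u + r • k)) ψ' 0 := ⟨_, hψd⟩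
  obtain ⟨χ', hχd⟩ : ∃ χ', HasPathDeriv (fun r : ℝ => χ (u + r • k)) χ' 0 := ⟨_, hχd⟩
  refine ⟨φ', v', ψ', χ', hφ', hv', hψd.D.D.unique (hφd.congr (hg.mono fun r hr => (hgen' _ hr).1)),
    ?_, ?_⟩
  · have := hχd.D.D.D.unique ((hasPathDeriv_opA hwd hψd).congr
      (hg.mono fun r hr => (hgen' _ hr).2.1))
    simpa only [hp0] using this
  · have := hvd.D.D.unique (((hasPathDeriv_opB hwd hχd).add
      (HasPathDeriv.smul (hasDerivAt_const _ κ) hψd.D.D.D.D.D)).congr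
      (hg.mono fun r hr => (hgen' _ hr).2.2))
    simpa only [hp0, zero_smul, add_zero] using this

end OV

namespace OV

open MeasureTheory Filter Topology PerAlg

/-! ### The Jacobi identity for the pencil -/

/-- The Lie term of two sections of the pencil in terms of their primitives. The derivatives of the
second section along `v₁` and of the first one along `v₃` are primed. -/
theorem perInt_lieTerm {κ : ℝ} {w ψ₂ χ₂ χ₁ ψ₃ χ₃ φ₂ v₁ v₃ φ₂' v₁' ψ₂' χ₂' ψ₁' χ₁' : PerAlg}
    (e₂ : D (D ψ₂) = φ₂) (a₂ : D (D (D χ₂)) = opA w ψ₂)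
    (b₃ : D (D v₃) = opB w χ₃ + κ • D (D (D (D (D ψ₃)))))
    (e₂' : D (D ψ₂') = φ₂') (a₂' : D (D (D χ₂')) = opA w ψ₂' + opA (D (D v₁)) ψ₂)
    (b₁' : D (D v₁') = opB w χ₁' + opB (D (D v₃)) χ₁ + κ • D (D (D (D (D ψ₁'))))) :
    perInt (φ₂' * v₃) + perInt (φ₂ * v₁') =
      perInt (χ₂ * D (D (D χ₁'))) - perInt (D (D (D χ₂')) * χ₃) +
      κ * (perInt (ψ₂ * D (D (D (D (D ψ₁'))))) - perInt (D (D (D (D (D ψ₂')))) * ψ₃)) +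
      perInt (opA (D (D v₁)) ψ₂ * χ₃) + perInt (opB (D (D v₃)) χ₁ * ψ₂) := by
  have h5 : perInt (ψ₂' * D (D (D (D (D ψ₃))))) = -perInt (D (D (D (D (D ψ₂')))) * ψ₃) := by
    rw [← perInt_D2_mul, ← neg_neg (perInt (D (D ψ₂') * _)), ← perInt_D3_mul]
  have t1 : perInt (φ₂' * v₃) = -perInt (D (D (D χ₂')) * χ₃) +
      perInt (opA (D (D v₁)) ψ₂ * χ₃) - κ * perInt (D (D (D (D (D ψ₂')))) * ψ₃) := by
    have h : perInt (ψ₂' * opB w χ₃) = -perInt (opA w ψ₂' * χ₃) := by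
      rw [perInt_opA_mul, neg_neg]
    rw [← e₂', perInt_D2_mul, b₃, mul_add, map_add, mul_smul_comm, map_smul, h, h5, a₂', add_mul,
      map_add, smul_eq_mul]
    ring
  have t2 : perInt (φ₂ * v₁') = perInt (χ₂ * D (D (D χ₁'))) +
      perInt (opB (D (D v₃)) χ₁ * ψ₂) + κ * perInt (ψ₂ * D (D (D (D (D ψ₁'))))) := by
    have h : perInt (ψ₂ * opB w χ₁') = perInt (χ₂ * D (D (D χ₁'))) := by
      rw [← neg_neg (perInt _), ← perInt_opA_mul, ← a₂, perInt_D3_mul, neg_neg]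
    rw [← e₂, perInt_D2_mul, b₁', mul_add, mul_add, map_add, map_add, mul_smul_comm, map_smul, h,
      mul_comm ψ₂ (opB _ _), smul_eq_mul]
  rw [t1, t2]
  ring

/-- The terms of the Lie terms that contain no derivatives of sections. -/
theorem perInt_opA_add_opB (v ψ₂ χ₂ ψ₃ χ₃ : PerAlg) :
    perInt (opA v ψ₂ * χ₃) + perInt (opB v χ₂ * ψ₃) =
      perInt (v * (D ψ₂ * χ₃ - D ψ₃ * χ₂ + 2 * (ψ₃ * D χ₂ - ψ₂ * D χ₃))) := by
  rw [← map_add]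
  refine perInt_congr_D (v * (2 * ψ₂ * χ₃ + χ₂ * ψ₃)) ?_
  simp only [opA, opB, D_mul, map_add, D_ofNat]
  ring

/-- Expressed through `ψ` and `χ`, the terms with derivatives of sections cancel in the cyclic sum.
What is left pairs each `v_i''` with a bilinear expression in the other two sections, and splits
into the `η` identity plus `κ` times the `ϑ` identity. -/
theorem pencil_jacobi_of_gram {κ : ℝ} {φ₁ φ₂ φ₃ v₁ v₂ v₃ : M → M} (hφ₁ : SmoothMap φ₁)
    (hφ₂ : SmoothMap φ₂) (hφ₃ : SmoothMap φ₃) (hv₁ : SmoothMap v₁) (hv₂ : SmoothMap v₂)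
    (hv₃ : SmoothMap v₃) (h₁ : ∀ u, pencil κ u (φ₁ u) (v₁ u)) (h₂ : ∀ u, pencil κ u (φ₂ u) (v₂ u))
    (h₃ : ∀ u, pencil κ u (φ₃ u) (v₃ u)) {u : M} (hu : gram u ≠ 0) :
    lieTerm v₁ φ₂ v₃ u + lieTerm v₂ φ₃ v₁ u + lieTerm v₃ φ₁ v₂ u = 0 := by
  obtain ⟨ψ₁, χ₁, e₁, a₁, b₁, t₁⟩ := exists_tangent hφ₁ hv₁ h₁ hu
  obtain ⟨ψ₂, χ₂, e₂, a₂, b₂, t₂⟩ := exists_tangent hφ₂ hv₂ h₂ hu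
  obtain ⟨ψ₃, χ₃, e₃, a₃, b₃, t₃⟩ := exists_tangent hφ₃ hv₃ h₃ hu
  -- In the cyclic sum each section is differentiated in only one direction: the first along `v₃`,
  -- the second along `v₁`, the third along `v₂`.
  obtain ⟨φ₁', v₁', ψ₁', χ₁', dφ₁, dv₁, e₁', a₁', b₁'⟩ := t₁ (v₃ u)
  obtain ⟨φ₂', v₂', ψ₂', χ₂', dφ₂, dv₂, e₂', a₂', b₂'⟩ := t₂ (v₁ u)
  obtain ⟨φ₃', v₃', ψ₃', χ₃', dφ₃, dv₃, e₃', a₃', b₃'⟩ := t₃ (v₂ u)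
  simp only [lieTerm, dφ₁, dφ₂, dφ₃, dv₁, dv₂, dv₃, pair_toAlg]
  rw [perInt_lieTerm e₂ a₂ b₃ e₂' a₂' b₁', perInt_lieTerm e₃ a₃ b₁ e₃' a₃' b₂',
    perInt_lieTerm e₁ a₁ b₂ e₁' a₁' b₃']
  have k₁ := perInt_opA_add_opB (D (D (toAlg (v₁ u)))) ψ₂ χ₂ ψ₃ χ₃
  have k₂ := perInt_opA_add_opB (D (D (toAlg (v₂ u)))) ψ₃ χ₃ ψ₁ χ₁
  have k₃ := perInt_opA_add_opB (D (D (toAlg (v₃ u)))) ψ₁ χ₁ ψ₂ χ₂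
  have j : perInt (D (D (toAlg (v₁ u))) * (D ψ₂ * χ₃ - D ψ₃ * χ₂ + 2 * (ψ₃ * D χ₂ - ψ₂ * D χ₃))) +
      perInt (D (D (toAlg (v₂ u))) * (D ψ₃ * χ₁ - D ψ₁ * χ₃ + 2 * (ψ₁ * D χ₃ - ψ₃ * D χ₁))) +
      perInt (D (D (toAlg (v₃ u))) * (D ψ₁ * χ₂ - D ψ₂ * χ₁ + 2 * (ψ₂ * D χ₁ - ψ₁ * D χ₂))) =
      0 := by
    have j1 := perInt_jacobi_eta a₁ a₂ a₃
    have j2 := perInt_jacobi_theta a₁ a₂ a₃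
    rw [b₁, b₂, b₃]
    simp only [add_mul, smul_mul_assoc, map_add, map_smul, smul_eq_mul] at j1 j2 ⊢
    linear_combination j1 + κ * j2
  simp only [mul_comm (D (D (D χ₁'))) χ₂, mul_comm (D (D (D χ₂'))) χ₃, mul_comm (D (D (D χ₃'))) χ₁,
    mul_comm _ ψ₁, mul_comm _ ψ₂, mul_comm _ ψ₃] at k₁ k₂ k₃ j ⊢
  linear_combination k₁ + k₂ + k₃ + j

/-! ### Continuity and density -/

/-- The directional derivative is a partial derivative at zero of the smooth image of the
two-parameter family `p(s₀) + s₁ k(p(s₀))`, hence smooth in the base point. -/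
theorem continuous_lieTerm {v φ w : M → M} (hv : SmoothMap v) (hφ : SmoothMap φ)
    (hw : SmoothMap w) {p : ℝ → M} (hp : SmoothMPath p) : Continuous fun s => lieTerm v φ w (p s) := by
  have key : ∀ {Φ k : M → M}, SmoothMap Φ → SmoothMap k →
      ContDiff ℝ ∞ fun z : ℝ × ℝ => dirDeriv Φ (p z.1) (k (p z.1)) z.2 := by
    intro Φ k hΦ hk
    have hq : SmoothFamily fun s : Fin 2 → ℝ => p (s 0) + s 1 • k (p (s 0)) := by
      have h1 := hp.comp (by fun_prop : ContDiff ℝ ∞ fun z : (Fin 2 → ℝ) × ℝ => (z.1 0, z.2))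
      have h2 := (hk.path hp).comp
        (by fun_prop : ContDiff ℝ ∞ fun z : (Fin 2 → ℝ) × ℝ => (z.1 0, z.2))
      exact h1.add ((by fun_prop : ContDiff ℝ ∞ fun z : (Fin 2 → ℝ) × ℝ => z.1 1).mul h2)
    have hv : ContDiff ℝ ∞ fun z : ℝ × (ℝ × ℝ) => (![z.2.1, z.1] : Fin 2 → ℝ) :=
      contDiff_pi.mpr fun i => by
        fin_cases i
        · exact contDiff_fst.comp contDiff_snd
        · exact contDiff_fst
    have h3 := (hΦ.contDiff hq).comp (hv.prodMk (contDiff_snd.comp contDiff_snd))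
    have h4 := contDiff_deriv_fst h3
    exact h4.comp (by fun_prop : ContDiff ℝ ∞ fun z : ℝ × ℝ => ((0 : ℝ), z))
  have h1 := contDiff_integral_param ((key hφ hv).mul (hw.path hp)) 0 (2 * Real.pi)
  have h2 := contDiff_integral_param ((hφ.path hp).mul (key hv hw)) 0 (2 * Real.pi)
  exact h1.continuous.add h2.continuous

theorem eventually_polynomial_ne_zero {P : Polynomial ℝ} (hP : P ≠ 0) (a : ℝ) :
    ∀ᶠ s in 𝓝[≠] a, P.eval s ≠ 0 := by
  have hfin : {s | P.IsRoot s}.Finite := Polynomial.finite_setOfPred_isRoot hP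
  have h := (hfin.subset (Set.sdiff_subset (t := {a}))).isClosed.isOpen_compl.mem_nhds
    (show a ∈ ({s | P.IsRoot s} \ {a})ᶜ by simp)
  rw [eventually_nhdsWithin_iff]
  filter_upwards [h] with s hs hsa hr
  exact hs ⟨hr, hsa⟩

/-- As a polynomial in `s` the expression has `s⁶`-coefficient `a₄b₂ - c₃²`, and a nonzero
polynomial has isolated zeros. -/
theorem eventually_gram_ne_zero_of_top {a₀ a₁ a₂ a₃ a₄ b₀ b₁ b₂ c₀ c₁ c₂ c₃ : ℝ}
    (h : a₄ * b₂ - c₃ ^ 2 ≠ 0) : ∀ᶠ s : ℝ in 𝓝[≠] 0,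
    (a₀ + a₁ * s + a₂ * s ^ 2 + a₃ * s ^ 3 + a₄ * s ^ 4) * (b₀ + b₁ * s + b₂ * s ^ 2) -
      (c₀ + c₁ * s + c₂ * s ^ 2 + c₃ * s ^ 3) ^ 2 ≠ 0 := by
  open Polynomial in
  set P : ℝ[X] := (C a₀ + C a₁ * X + C a₂ * X ^ 2 + C a₃ * X ^ 3 + C a₄ * X ^ 4) *
    (C b₀ + C b₁ * X + C b₂ * X ^ 2) - (C c₀ + C c₁ * X + C c₂ * X ^ 2 + C c₃ * X ^ 3) ^ 2 with hP
  have he : ∀ s, P.eval s =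
      (a₀ + a₁ * s + a₂ * s ^ 2 + a₃ * s ^ 3 + a₄ * s ^ 4) * (b₀ + b₁ * s + b₂ * s ^ 2) -
      (c₀ + c₁ * s + c₂ * s ^ 2 + c₃ * s ^ 3) ^ 2 := fun s => by simp [hP]
  simp only [← he]
  refine eventually_polynomial_ne_zero (fun h0 => h ?_) 0
  have e : ∀ s, _ = (0 : ℝ) := fun s => (he s).symm.trans (by rw [h0, Polynomial.eval_zero])
  -- The sixth central difference kills lower powers and gives `6! = 720` on `s⁶`.
  linear_combination (1 / 720) * (e 3 - 6 * e 2 + 15 * e 1 - 20 * e 0 + 15 * e (-1) - 6 * e (-2) +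
    e (-3))

theorem cos_mem_M : (fun x => Real.cos x) ∈ M :=
  ⟨⟨Real.contDiff_cos, Real.cos_periodic⟩, by simp⟩

/-- `K` is quadratic in `u`, so along the line its leading part is `-s²PP'` with `P = cos`, and that
of `u_x` is `sP'`. These two are orthogonal and nonzero, which makes the leading coefficient of
`gram` nonzero whatever `u` is. -/
theorem eventually_gram_ne_zero (u : M) :
    ∀ᶠ s : ℝ in 𝓝[≠] 0, gram (u + s • ⟨_, cos_mem_M⟩) ≠ 0 := by
  set p : M := ⟨_, cos_mem_M⟩ with hp
  set P := toAlg p with hPd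
  set U := toAlg u with hU
  have hP0 : ∀ x, P.1 x = Real.cos x := fun _ => rfl
  have hP1 : ∀ x, (D P).1 x = -Real.sin x := fun x => by
    rw [D_apply]
    exact (Real.hasDerivAt_cos x).deriv
  have hNP : perInt (P * D P * D P) = 0 := by
    have : P * D P * D P = D ((-(1 / 3 : ℝ)) • (D P * D P * D P)) := by
      refine PerAlg.ext fun x => ?_
      have h2 : (D (D P)).1 x = -Real.cos x := by
        rw [D_apply, show (D P).1 = fun x => -Real.sin x from funext hP1]
        exact (Real.hasDerivAt_sin x).neg.deriv
      simp only [D_smul, D_mul, PerAlg.smul_apply, PerAlg.add_apply, PerAlg.mul_apply, hP0, hP1, h2]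
      ring
    rw [this, perInt_D]
  have hN : perInt (P * D P * (P * D P)) ≠ 0 := fun h => by
    have h1 := congrArg (fun f : PerAlg => f.1 (Real.pi / 4)) (eq_zero_of_perInt_mul_self h)
    simp only [PerAlg.mul_apply, hP0, hP1, PerAlg.zero_apply, Real.cos_pi_div_four,
      Real.sin_pi_div_four] at h1
    have : (0 : ℝ) < √2 := by positivity
    nlinarith
  have hD : perInt (D P * D P) ≠ 0 := fun h => by
    have h1 := congrArg (fun f : PerAlg => f.1 (Real.pi / 2)) (eq_zero_of_perInt_mul_self h)
    simp [hP1] at h1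
  set K₁ := -(U * D P + P * D U) - toAlg (Dinv p) with hK₁
  have hDinv : ∀ s : ℝ, toAlg (Dinv (u + s • p)) = toAlg (Dinv u) + s • toAlg (Dinv p) := by
    intro s
    have : Dinv (u + s • p) = Dinv u + s • Dinv p := D_toAlg_injective (by
      simp only [D_toAlg_Dinv, map_add, map_smul, D_smul])
    rw [this, map_add, map_smul]
  have hK : ∀ s : ℝ, toAlg (K (u + s • p)) = toAlg (K u) + s • K₁ - s ^ 2 • (P * D P) := by
    intro s
    simp only [toAlg_K, hDinv, hK₁, map_add, map_smul, D_smul, ← hU, ← hPd]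
    simp only [Algebra.smul_def, map_pow]
    ring
  have key := eventually_gram_ne_zero_of_top (a₀ := perInt (toAlg (K u) * toAlg (K u)))
    (a₁ := 2 * perInt (toAlg (K u) * K₁))
    (a₂ := perInt (K₁ * K₁) - 2 * perInt (toAlg (K u) * (P * D P)))
    (a₃ := -2 * perInt (K₁ * (P * D P))) (a₄ := perInt (P * D P * (P * D P)))
    (b₀ := perInt (D U * D U)) (b₁ := 2 * perInt (D U * D P)) (b₂ := perInt (D P * D P))
    (c₀ := perInt (toAlg (K u) * D U)) (c₁ := perInt (toAlg (K u) * D P) + perInt (K₁ * D U))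
    (c₂ := perInt (K₁ * D P) - perInt (P * D P * D U)) (c₃ := -perInt (P * D P * D P))
    (by rw [hNP]; simpa using ⟨hN, hD⟩)
  refine key.mono fun s hs => ?_
  convert hs using 1
  have ea : toAlg (K (u + s • p)) * toAlg (K (u + s • p)) = toAlg (K u) * toAlg (K u) +
      (2 * s) • (toAlg (K u) * K₁) + s ^ 2 • (K₁ * K₁) - (2 * s ^ 2) • (toAlg (K u) * (P * D P)) -
      (2 * s ^ 3) • (K₁ * (P * D P)) + s ^ 4 • (P * D P * (P * D P)) := by
    rw [hK]
    simp only [Algebra.smul_def, map_mul, map_pow, map_ofNat]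
    ring
  have eb : D (toAlg (u + s • p)) * D (toAlg (u + s • p)) = D U * D U + (2 * s) • (D U * D P) +
      s ^ 2 • (D P * D P) := by
    simp only [map_add, map_smul, D_smul, ← hU, ← hPd]
    simp only [Algebra.smul_def, map_mul, map_pow, map_ofNat]
    ring
  have ec : toAlg (K (u + s • p)) * D (toAlg (u + s • p)) = toAlg (K u) * D U +
      s • (toAlg (K u) * D P) + s • (K₁ * D U) + s ^ 2 • (K₁ * D P) - s ^ 2 • (P * D P * D U) -
      s ^ 3 • (P * D P * D P) := by
    rw [hK]
    simp only [map_add, map_smul, D_smul, ← hU, ← hPd]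
    simp only [Algebra.smul_def, map_pow]
    ring
  rw [gram, ea, eb, ec]
  simp only [map_add, map_sub, map_smul, smul_eq_mul]
  ring

theorem isPoisson_pencil (κ : ℝ) : IsPoisson (pencil κ) where
  skewAdjoint := pencil_skewAdjoint κ
  jacobi φ₁ φ₂ φ₃ v₁ v₂ v₃ hφ₁ hφ₂ hφ₃ hv₁ hv₂ hv₃ h₁ h₂ h₃ u := by
    have hp := smoothMPath_line u ⟨_, cos_mem_M⟩
    have hc := (((continuous_lieTerm hv₁ hφ₂ hv₃ hp).add (continuous_lieTerm hv₂ hφ₃ hv₁ hp)).add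
      (continuous_lieTerm hv₃ hφ₁ hv₂ hp)).continuousAt (x := 0)
    have h0 := tendsto_nhds_unique_of_eventuallyEq (hc.tendsto.mono_left nhdsWithin_le_nhds)
      (tendsto_const_nhds (x := (0 : ℝ)) (f := 𝓝[≠] (0 : ℝ)))
      ((eventually_gram_ne_zero u).mono fun s hs =>
        pencil_jacobi_of_gram hφ₁ hφ₂ hφ₃ hv₁ hv₂ hv₃ h₁ h₂ h₃ hs)
    have e : u + (0 : ℝ) • (⟨_, cos_mem_M⟩ : M) = u := by rw [zero_smul, add_zero]
    simp only [Pi.add_apply, e] at h0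
    exact h0

theorem isPoisson_eta : IsPoisson eta := by
  have : eta = pencil 0 := funext fun u => funext fun φ => funext fun v =>
    propext (pencil_zero u φ v).symm
  rw [this]
  exact isPoisson_pencil 0

/-- `D_x` does not depend on `u`: the derivative of each section occurs twice in the cyclic sum,
with opposite signs by skewness. -/
theorem isPoisson_theta : IsPoisson theta where
  skewAdjoint := theta_skewAdjoint
  jacobi φ₁ φ₂ φ₃ v₁ v₂ v₃ hφ₁ hφ₂ hφ₃ _ _ _ h₁ h₂ h₃ u := by
    obtain rfl : v₁ = fun u => Dx (φ₁ u) := funext h₁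
    obtain rfl : v₂ = fun u => Dx (φ₂ u) := funext h₂
    obtain rfl : v₃ = fun u => Dx (φ₃ u) := funext h₃
    have hD : ∀ {φ : M → M}, SmoothMap φ → ∀ k : M, ∃ φ' : M, dirDeriv φ u k = φ'.1 ∧
        dirDeriv (fun u => Dx (φ u)) u k = (Dx φ').1 := by
      intro φ hφ k
      obtain ⟨φ', h, hd⟩ := hφ.exists_dirDeriv u k
      obtain ⟨v', h', hd'⟩ := (smoothMap_Dx.comp hφ).exists_dirDeriv u k
      have : v' = Dx φ' := toAlg_injective (hd'.unique hd.D)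
      exact ⟨φ', h, this ▸ h'⟩
    obtain ⟨φ₁', d₁, c₁⟩ := hD hφ₁ (Dx (φ₃ u))
    obtain ⟨φ₂', d₂, c₂⟩ := hD hφ₂ (Dx (φ₁ u))
    obtain ⟨φ₃', d₃, c₃⟩ := hD hφ₃ (Dx (φ₂ u))
    simp only [lieTerm, d₁, d₂, d₃, c₁, c₂, c₃]
    rw [pair_Dx (φ₂ u), pair_Dx (φ₃ u), pair_Dx (φ₁ u)]
    ring

end OV

namespace OV

open MeasureTheory Filter Topology PerAlg

/-! ### Linear systems over an interval -/

/-- Composing with `ρ` extends data over `J` to all times without changing it near `t`, so that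
global calculus applies locally. -/
theorem exists_cutoff {J : Set ℝ} (hJ : IsOpen J) {t : ℝ} (ht : t ∈ J) :
    ∃ ρ : ℝ → ℝ, ContDiff ℝ ∞ ρ ∧ (∀ r, ρ r ∈ J) ∧ ∀ᶠ r in 𝓝 t, ρ r = r := by
  obtain ⟨ε, hε, hb⟩ := Metric.isOpen_iff.mp hJ t ht
  let b : ContDiffBump t := ⟨ε / 2, ε, by positivity, by linarith⟩
  refine ⟨fun r => t + b r * (r - t), contDiff_const.add (b.contDiff.mul
    (contDiff_id.sub contDiff_const)), fun r => hb ?_, ?_⟩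
  · rw [Metric.mem_ball, Real.dist_eq, add_sub_cancel_left, abs_mul, abs_of_nonneg b.nonneg]
    by_cases h : dist r t < ε
    · rw [Real.dist_eq] at h
      exact (mul_le_of_le_one_left (abs_nonneg _) b.le_one).trans_lt h
    · rw [b.zero_of_le_dist (not_lt.mp h), zero_mul]
      exact hε
  · filter_upwards [b.eventuallyEq_one] with r hr
    rw [hr]
    simp

theorem exists_contDiff_eventually_eq {F : Type*} [NormedAddCommGroup F] [NormedSpace ℝ F]
    {J : Set ℝ} (hJ : IsOpen J) {f : ℝ × ℝ → F} (hf : ContDiffOn ℝ ∞ f (J ×ˢ Set.univ)) {t : ℝ}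
    (ht : t ∈ J) : ∃ g : ℝ × ℝ → F, ContDiff ℝ ∞ g ∧ ∀ᶠ r in 𝓝 t, ∀ x, f (r, x) = g (r, x) := by
  obtain ⟨ρ, h1, h2, h3⟩ := exists_cutoff hJ ht
  refine ⟨fun z => f (ρ z.1, z.2), hf.comp_contDiff ((h1.comp contDiff_fst).prodMk contDiff_snd)
    fun z => ⟨h2 _, trivial⟩, h3.mono fun r hr x => ?_⟩
  change f (r, x) = f (ρ r, x)
  rw [hr]

theorem contDiffOn_of_eventually_eq {F : Type*} [NormedAddCommGroup F] [NormedSpace ℝ F]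
    {J : Set ℝ} {f : ℝ × ℝ → F}
    (h : ∀ t ∈ J, ∃ g : ℝ × ℝ → F, ContDiff ℝ ∞ g ∧ ∀ᶠ r in 𝓝 t, ∀ x, f (r, x) = g (r, x)) :
    ContDiffOn ℝ ∞ f (J ×ˢ Set.univ) := by
  rintro ⟨t, x⟩ ⟨ht, -⟩
  obtain ⟨g, hg, he⟩ := h t ht
  refine (hg.contDiffAt.congr_of_eventuallyEq ?_).contDiffWithinAt
  filter_upwards [continuous_fst.continuousAt.eventually he] with z hz
  exact hz z.2

variable {𝔸 : Type} [NormedRing 𝔸] [NormedAlgebra ℝ 𝔸]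

/-- The equation expresses the derivative by `y` itself, so regularity increases by one at each
step. -/
theorem contDiffOn_linearODE {J : Set ℝ} (hJ : IsOpen J) {m y : ℝ → 𝔸} (hm : ContDiffOn ℝ ∞ m J)
    (hy : ∀ t ∈ J, HasDerivAt y (m t * y t) t) : ContDiffOn ℝ ∞ y J := by
  refine contDiffOn_infty.mpr fun n => ?_
  induction n with
  | zero => exact contDiffOn_zero.mpr fun t ht => (hy t ht).continuousAt.continuousWithinAt
  | succ n ih =>
    push_cast
    refine (contDiffOn_succ_iff_deriv_of_isOpen hJ).mpr
      ⟨fun t ht => (hy t ht).differentiableAt.differentiableWithinAt, by simp, ?_⟩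
    exact ((contDiffOn_infty.mp hm n).mul ih).congr fun t ht => (hy t ht).deriv

variable [CompleteSpace 𝔸]

/-- On an open interval solutions of `y' = m y` with `y(t₀) = 1` are unique. -/
theorem linearODE_unique_on {J : Set ℝ} (hJ : IsOpen J) (hJ' : IsPreconnected J) {t₀ : ℝ}
    (ht₀ : t₀ ∈ J) {m : ℝ → 𝔸} (hm : Continuous m) {y z : ℝ → 𝔸}
    (hy : ∀ t, HasDerivAt y (m t * y t) t) (hz : ∀ t ∈ J, HasDerivAt z (m t * z t) t)
    (h0 : y t₀ = 1) (h0' : z t₀ = 1) {t : ℝ} (ht : t ∈ J) : y t = z t := by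
  obtain ⟨Φ, Ψ, h⟩ := exists_isFundamental (A := fun q : ℝ × ℝ => m (t₀ + q.2)) (by fun_prop)
  have hd : ∀ t ∈ J, HasDerivAt (fun t => Ψ (0, t - t₀) * z t) 0 t := fun t ht => by
    have h1 := (h.hasDerivAt_right 0 (t - t₀)).comp_sub_const t t₀
    rw [add_sub_cancel] at h1
    exact (h1.mul (hz t ht)).congr_deriv (by noncomm_ring)
  have h1 := hJ.is_const_of_deriv_eq_zero hJ'
    (fun t ht => (hd t ht).differentiableAt.differentiableWithinAt) (fun t ht => (hd t ht).deriv)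
    ht ht₀
  simp only [sub_self, h.right_zero, h0', mul_one] at h1
  have h2 : z t = Φ (0, t - t₀) := by
    rw [← mul_one (Φ _), ← h1, ← mul_assoc, h.left_mul_right, one_mul]
  have hy' : ∀ x, HasDerivAt (fun x => y (t₀ + x)) (m (t₀ + x) * y (t₀ + x)) x := fun x =>
    (hy (t₀ + x)).comp_const_add t₀ x
  have h3 := h.eq_mul (t := 0) hy' (t - t₀)
  simp only [add_sub_cancel, add_zero, h0, mul_one] at h3
  rw [h2, h3]

theorem exists_linearODE {m : ℝ → 𝔸} (hm : Continuous m) (t₀ : ℝ) :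
    ∃ y : ℝ → 𝔸, y t₀ = 1 ∧ ∀ t, HasDerivAt y (m t * y t) t := by
  obtain ⟨Φ, Ψ, h⟩ := exists_isFundamental (A := fun q : ℝ × ℝ => m (t₀ + q.2)) (by fun_prop)
  refine ⟨fun t => Φ (0, t - t₀), by simp [h.left_zero], fun t => ?_⟩
  have h1 := (h.hasDerivAt_left 0 (t - t₀)).comp_sub_const t t₀
  rwa [add_sub_cancel] at h1

/-- For each `t` a compact interval in `J` has `t` and `t₀` in its interior; freezing the
coefficient outside it gives a global equation. The solutions agree on overlaps by uniqueness, so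
the diagonal `y t t` solves the equation on `J`. -/
theorem exists_linearODE_on {J : Set ℝ} (hJ : IsOpen J) (hJ' : IsPreconnected J) {t₀ : ℝ}
    (ht₀ : t₀ ∈ J) {m : ℝ → 𝔸} (hm : ContinuousOn m J) :
    ∃ y : ℝ → 𝔸, y t₀ = 1 ∧ ∀ t ∈ J, HasDerivAt y (m t * y t) t := by
  have hloc : ∀ t ∈ J, ∃ a b : ℝ, a < b ∧ Set.Icc a b ⊆ J ∧ t ∈ Set.Ioo a b ∧ t₀ ∈ Set.Ioo a b := by
    intro t ht
    have hmin : min t t₀ ∈ J := by rcases min_choice t t₀ with h | h <;> rwa [h]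
    have hmax : max t t₀ ∈ J := by rcases max_choice t t₀ with h | h <;> rwa [h]
    obtain ⟨a, ha, haJ⟩ := (hJ.eventually_mem hmin |>.filter_mono nhdsWithin_le_nhds |>.and
      (self_mem_nhdsWithin (s := Set.Iio (min t t₀)))).exists.imp fun a h => And.symm h
    obtain ⟨b, hb, hbJ⟩ := (hJ.eventually_mem hmax |>.filter_mono nhdsWithin_le_nhds |>.and
      (self_mem_nhdsWithin (s := Set.Ioi (max t t₀)))).exists.imp fun a h => And.symm h
    simp only [lt_min_iff, max_lt_iff] at ha hb
    exact ⟨a, b, ha.1.trans hb.1, hJ'.ordConnected.out haJ hbJ, ⟨ha.1, hb.1⟩, ⟨ha.2, hb.2⟩⟩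
  choose! a b hab hsub hmem hmem₀ using hloc
  have hsol : ∀ t ∈ J, ∃ y : ℝ → 𝔸, y t₀ = 1 ∧ ∀ r,
      HasDerivAt y (m (max (a t) (min (b t) r)) * y r) r := fun t ht => by
    have hc : Continuous fun r => m (max (a t) (min (b t) r)) :=
      hm.comp_continuous (by fun_prop) fun r => hsub t ht
        ⟨le_max_left _ _, max_le (hab t ht).le (min_le_left _ _)⟩
    exact exists_linearODE hc t₀
  choose! y hy0 hy using hsol
  have hclamp : ∀ t ∈ J, ∀ r ∈ Set.Ioo (a t) (b t), max (a t) (min (b t) r) = r := fun t _ r hr => by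
    rw [min_eq_right hr.2.le, max_eq_right hr.1.le]
  have hy' : ∀ t ∈ J, ∀ r ∈ Set.Ioo (a t) (b t), HasDerivAt (y t) (m r * y t r) r :=
    fun t ht r hr => by
      have := hy t ht r
      rwa [hclamp t ht r hr] at this
  have hagree : ∀ t ∈ J, ∀ r ∈ Set.Ioo (a t) (b t), y r r = y t r := fun t ht r hr => by
    have hrJ : r ∈ J := hsub t ht (Set.Ioo_subset_Icc_self hr)
    have hc : Continuous fun s => m (max (a r) (min (b r) s)) :=
      hm.comp_continuous (by fun_prop) fun s => hsub r hrJ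
        ⟨le_max_left _ _, max_le (hab r hrJ).le (min_le_left _ _)⟩
    refine linearODE_unique_on (J := Set.Ioo (a r) (b r) ∩ Set.Ioo (a t) (b t))
      (isOpen_Ioo.inter isOpen_Ioo)
      (Set.ordConnected_Ioo.inter Set.ordConnected_Ioo).isPreconnected
      ⟨hmem₀ r hrJ, hmem₀ t ht⟩ hc (hy r hrJ) (fun s hs => ?_) (hy0 r hrJ) (hy0 t ht)
      ⟨hmem r hrJ, hr⟩
    rw [hclamp r hrJ s hs.1]
    exact hy' t ht s hs.2
  refine ⟨fun t => y t t, hy0 t₀ ht₀, fun t ht => ?_⟩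
  exact (hy' t ht t (hmem t ht)).congr_of_eventuallyEq
    ((isOpen_Ioo.eventually_mem (hmem t ht)).mono fun r hr => hagree t ht r hr)

/-- Each time is solved separately. Smoothness in `t` is local: near a given time the coefficients
agree with globally smooth ones, and uniqueness identifies the two fundamental solutions. -/
theorem exists_fundamental_on {J : Set ℝ} (hJ : IsOpen J) {l : ℝ × ℝ → 𝔸}
    (hl : ContDiffOn ℝ ∞ l (J ×ˢ Set.univ)) (x₀ : ℝ) : ∃ Φ : ℝ × ℝ → 𝔸,
    ContDiffOn ℝ ∞ Φ (J ×ˢ Set.univ) ∧ (∀ t ∈ J, Φ (t, x₀) = 1) ∧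
    ∀ t ∈ J, ∀ x, HasDerivAt (fun x => Φ (t, x)) (l (t, x) * Φ (t, x)) x := by
  have hc : ∀ t ∈ J, Continuous fun x => l (t, x) := fun t ht =>
    hl.continuousOn.comp_continuous (by fun_prop) fun x => ⟨ht, trivial⟩
  have hsol : ∀ t ∈ J, ∃ y : ℝ → 𝔸, y x₀ = 1 ∧ ∀ x, HasDerivAt y (l (t, x) * y x) x :=
    fun t ht => exists_linearODE (hc t ht) x₀
  choose! y hy0 hy using hsol
  refine ⟨fun z => y z.1 z.2, contDiffOn_of_eventually_eq fun t ht => ?_, hy0, hy⟩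
  obtain ⟨g, hg, he⟩ := exists_contDiff_eventually_eq hJ hl ht
  have hg' : ContDiff ℝ ∞ fun z : ℝ × ℝ => g (z.1, x₀ + z.2) :=
    hg.comp (by fun_prop : ContDiff ℝ ∞ fun z : ℝ × ℝ => (z.1, x₀ + z.2))
  obtain ⟨Φ, Ψ, h⟩ := exists_isFundamental hg'.continuous
  refine ⟨fun z => Φ (z.1, z.2 - x₀), (h.contDiff_left hg').comp
    (by fun_prop : ContDiff ℝ ∞ fun z : ℝ × ℝ => (z.1, z.2 - x₀)), ?_⟩
  filter_upwards [he, hJ.mem_nhds ht] with r hr hrJ x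
  have hy' : ∀ x, HasDerivAt (fun x => y r (x₀ + x)) (g (r, x₀ + x) * y r (x₀ + x)) x := fun x => by
    rw [← hr]
    exact (hy r hrJ (x₀ + x)).comp_const_add x₀ x
  have := h.eq_mul (t := r) hy' (x - x₀)
  simpa [hy0 r hrJ] using this

/-- A linear system with vanishing curvature has a smooth fundamental solution. -/
theorem exists_solution_of_zero_curvature {J : Set ℝ} (hJ : IsOpen J) (hJ' : IsPreconnected J)
    {l m : ℝ × ℝ → 𝔸} (hl : ContDiffOn ℝ ∞ l (J ×ˢ Set.univ))
    (hm : ContDiffOn ℝ ∞ m (J ×ˢ Set.univ))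
    (hlm : ∀ t ∈ J, ∀ x, deriv (fun r => l (r, x)) t - deriv (fun y => m (t, y)) x +
      (l (t, x) * m (t, x) - m (t, x) * l (t, x)) = 0) {t₀ : ℝ} (ht₀ : t₀ ∈ J) (x₀ : ℝ) :
    ∃ h : ℝ × ℝ → 𝔸, ContDiffOn ℝ ∞ h (J ×ˢ Set.univ) ∧ h (t₀, x₀) = 1 ∧
      ∀ t ∈ J, ∀ x, HasDerivAt (fun x => h (t, x)) (l (t, x) * h (t, x)) x ∧
        HasDerivAt (fun r => h (r, x)) (m (t, x) * h (t, x)) t := by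
  obtain ⟨Φ, hΦs, hΦ0, hΦ⟩ := exists_fundamental_on hJ hl x₀
  have hm0 : ContDiffOn ℝ ∞ (fun t => m (t, x₀)) J := hm.comp
    (by fun_prop : ContDiff ℝ ∞ fun t : ℝ => (t, x₀)).contDiffOn fun t ht => ⟨ht, trivial⟩
  obtain ⟨Θ, hΘ0, hΘ⟩ := exists_linearODE_on hJ hJ' ht₀ hm0.continuousOn
  have hΘs := contDiffOn_linearODE hJ hm0 hΘ
  -- Right multiplication by `Θ(t)` preserves the `x`-equation and makes the `t`-equation hold on `x
  -- = x₀`.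
  set h : ℝ × ℝ → 𝔸 := fun z => Φ z * Θ z.1 with hh
  have hs : ContDiffOn ℝ ∞ h (J ×ˢ Set.univ) :=
    hΦs.mul (hΘs.comp contDiff_fst.contDiffOn fun z hz => hz.1)
  have hx : ∀ t ∈ J, ∀ x, HasDerivAt (fun x => h (t, x)) (l (t, x) * h (t, x)) x :=
    fun t ht x => ((hΦ t ht x).mul_const (Θ t)).congr_deriv (mul_assoc _ _ _)
  refine ⟨h, hs, by simp [hh, hΦ0 t₀ ht₀, hΘ0], fun t ht x => ⟨hx t ht x, ?_⟩⟩
  obtain ⟨g, hg, hge⟩ := exists_contDiff_eventually_eq hJ hs ht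
  obtain ⟨l', hl', hle⟩ := exists_contDiff_eventually_eq hJ hl ht
  obtain ⟨m', hm', hme⟩ := exists_contDiff_eventually_eq hJ hm ht
  have hgt : ∀ x, HasDerivAt (fun r => g (r, x)) (deriv (fun r => g (r, x)) t) t := fun x =>
    (((hg.comp (by fun_prop : ContDiff ℝ ∞ fun r : ℝ => (r, x))).differentiable (by simp)) t).hasDerivAt
  have hht : ∀ x, HasDerivAt (fun r => h (r, x)) (deriv (fun r => g (r, x)) t) t := fun x =>
    (hgt x).congr_of_eventuallyEq (hge.mono fun r hr => hr x)
  set z : ℝ → 𝔸 := fun x => deriv (fun r => g (r, x)) t - m (t, x) * h (t, x) with hz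
  have hlt : ∀ x, HasDerivAt (fun r => l (r, x)) (deriv (fun r => l (r, x)) t) t := fun x => by
    have h1 : DifferentiableAt ℝ (fun r => l' (r, x)) t :=
      ((hl'.comp (by fun_prop : ContDiff ℝ ∞ fun r : ℝ => (r, x))).differentiable (by simp)) t
    exact (h1.congr_of_eventuallyEq (hle.mono fun r hr => hr x)).hasDerivAt
  have hmx : ∀ x, HasDerivAt (fun y => m (t, y)) (deriv (fun y => m (t, y)) x) x := fun x => by
    have h1 : DifferentiableAt ℝ (fun y => m' (t, y)) x :=
      ((hm'.comp (by fun_prop : ContDiff ℝ ∞ fun y : ℝ => (t, y))).differentiable (by simp)) x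
    rw [show (fun y => m (t, y)) = fun y => m' (t, y) from funext hme.self_of_nhds]
    exact h1.hasDerivAt
  -- Zero curvature says exactly that the defect `z = h_t - mh` satisfies `z_x = lz`.
  have hzd : ∀ x, HasDerivAt z (ContinuousLinearMap.mul ℝ 𝔸 (l (t, x)) (z x)) x := fun x => by
    have h1 : HasDerivAt (fun x => deriv (fun r => g (r, x)) t)
        (deriv (fun y => deriv (fun r => g (r, y)) t) x) x :=
      ((((contDiff_deriv_fst hg).comp (by fun_prop : ContDiff ℝ ∞ fun y : ℝ => (t, y))).differentiable
        (by simp)) x).hasDerivAt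
    have h2 := deriv_deriv_comm (hg.contDiffAt (x := (t, x)))
    have h3 : HasDerivAt (fun r => deriv (fun y => g (r, y)) x)
        (deriv (fun r => l (r, x)) t * h (t, x) + l (t, x) * deriv (fun r => g (r, x)) t) t := by
      refine ((hlt x).mul (hht x)).congr_of_eventuallyEq ?_
      filter_upwards [hge, hJ.mem_nhds ht] with r hr hrJ
      rw [show (fun y => g (r, y)) = fun y => h (r, y) from (funext hr).symm]
      exact (hx r hrJ x).deriv
    rw [h2.unique h3] at h1
    refine (h1.sub ((hmx x).mul (hx t ht x))).congr_deriv ?_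
    have e : deriv (fun r => l (r, x)) t = deriv (fun y => m (t, y)) x -
        (l (t, x) * m (t, x) - m (t, x) * l (t, x)) := by
      rw [eq_sub_iff_add_eq, ← sub_eq_zero, ← hlm t ht x]
      abel
    rw [e, ContinuousLinearMap.mul_apply', hz]
    noncomm_ring
  have hz0 : z x₀ = 0 := by
    have h1 : HasDerivAt (fun r => h (r, x₀)) (m (t, x₀) * Θ t) t :=
      (hΘ t ht).congr_of_eventuallyEq ((hJ.eventually_mem ht).mono fun r hr => by
        simp [hh, hΦ0 r hr])
    simp only [hz, (hht x₀).unique h1, hh, hΦ0 t ht, one_mul, sub_self]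
  have hlc : Continuous fun x => ContinuousLinearMap.mul ℝ 𝔸 (l (t, x)) :=
    (ContinuousLinearMap.mul ℝ 𝔸).continuous.comp
      (hl.continuousOn.comp_continuous (by fun_prop) fun x => ⟨ht, trivial⟩)
  have hzero : z = fun _ => 0 := linearODE_unique hlc hzd
    (fun x => (hasDerivAt_const x (0 : 𝔸)).congr_deriv (by simp)) hz0
  exact (hht x).congr_deriv (sub_eq_zero.mp (congrFun hzero x))

end OV

namespace OV

open MeasureTheory Filter Topology PerAlg

/-! ### Curves in `M` -/

section Curves

variable {J : Set ℝ} {u : ℝ → M} {t : ℝ}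

theorem SmoothCurve.exists_path (hu : SmoothCurve J u) (hJ : IsOpen J) (ht : t ∈ J) :
    ∃ p : ℝ → M, SmoothMPath p ∧ ∀ᶠ r in 𝓝 t, u r = p r := by
  obtain ⟨ρ, h1, h2, h3⟩ := exists_cutoff hJ ht
  exact ⟨fun r => u (ρ r), ContDiffOn.comp_contDiff hu ((h1.comp contDiff_fst).prodMk contDiff_snd)
    fun z => ⟨h2 _, trivial⟩, h3.mono fun r hr => congrArg u hr.symm⟩

theorem SmoothCurve.exists_velocity (hu : SmoothCurve J u) (hJ : IsOpen J) (ht : t ∈ J) :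
    ∃ v : M, HasPathDeriv (fun r => toAlg (u r)) (toAlg v) t := by
  obtain ⟨p, hp, he⟩ := hu.exists_path hJ ht
  exact ⟨_, (hp.hasPathDeriv t).congr (he.mono fun r hr => by rw [hr])⟩

theorem SmoothCurve.contDiffOn (hu : SmoothCurve J u) (hJ : IsOpen J) {Φ : M → PerAlg}
    (hΦ : SmoothAlgMap Φ) : ContDiffOn ℝ ∞ (fun z : ℝ × ℝ => (Φ (u z.1)).1 z.2) (J ×ˢ Set.univ) :=
  contDiffOn_of_eventually_eq fun t ht => by
    obtain ⟨p, hp, he⟩ := hu.exists_path hJ ht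
    exact ⟨_, hΦ.path hp, he.mono fun r hr x => by simp only [hr]⟩

theorem hasPathDeriv_wbar {v : M} (h : HasPathDeriv (fun r => toAlg (u r)) (toAlg v) t) :
    HasPathDeriv (fun r => wbar (u r)) (D (D (toAlg v))) t := by
  have := h.D.D.add (HasPathDeriv.const (algebraMap ℝ PerAlg (1 / 3)))
  simpa [wbar] using this

theorem ubar_eq_wbar (u : M) : ubar u.1 = (wbar u).1 := funext fun x => (wbar_apply u x).symm

theorem hasDerivAt_ubar (u : M) (x : ℝ) : HasDerivAt (ubar u.1) (deriv (ubar u.1) x) x := by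
  rw [ubar_eq_wbar]
  exact (wbar u).hasDerivAt x

theorem hasDerivAt_coe (u : M) (x : ℝ) : HasDerivAt u.1 (deriv u.1 x) x := (toAlg u).hasDerivAt x

theorem hasDerivAt_deriv_coe (u : M) (x : ℝ) : HasDerivAt (deriv u.1) (ubar u.1 x - 1 / 3) x := by
  refine ((D (toAlg u)).hasDerivAt x).congr_deriv ?_
  rw [ubar_eq_wbar, wbar, PerAlg.add_apply, algebraMap_apply, add_sub_cancel_right]

theorem SmoothCurve.hasDerivAt_ubar (hu : SmoothCurve J u) (hJ : IsOpen J) (ht : t ∈ J) (x : ℝ) :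
    HasDerivAt (fun r => ubar (u r).1 x) (deriv (fun r => ubar (u r).1 x) t) t := by
  obtain ⟨v, hv⟩ := hu.exists_velocity hJ ht
  have := (hasPathDeriv_wbar hv).hasDerivAt x
  simp only [← ubar_eq_wbar] at this
  exact this.differentiableAt.hasDerivAt

/-- The equation `du/dt = K[u]` in terms of `ū`. -/
theorem isSolution_iff (hu : SmoothCurve J u) (hJ : IsOpen J) : IsSolution J u ↔
    ∀ t ∈ J, ∀ x, deriv (fun r => ubar (u r).1 x) t + (u t).1 x * deriv (ubar (u t).1) x +
      3 * deriv (u t).1 x * ubar (u t).1 x = 0 := by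
  have hB : ∀ (u : M) (x : ℝ), (opB (wbar u) (toAlg u)).1 x =
      u.1 x * deriv (ubar u.1) x + 3 * deriv u.1 x * ubar u.1 x := fun u x => by
    rw [ubar_eq_wbar]
    simp only [opB, PerAlg.add_apply, PerAlg.mul_apply, PerAlg.ofNat_apply, D_apply, toAlg_apply]
    rw [show (toAlg u).1 = u.1 from rfl]
    ring
  refine forall₂_congr fun t ht => ?_
  obtain ⟨v, hv⟩ := hu.exists_velocity hJ ht
  have h1 : ∀ x, deriv (fun s => (u s).1 x) t = v.1 x := fun x => (hv.hasDerivAt x).deriv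
  have h2 : ∀ x, deriv (fun r => ubar (u r).1 x) t = (D (D (toAlg v))).1 x := fun x => by
    have := (hasPathDeriv_wbar hv).hasDerivAt x
    simp only [← ubar_eq_wbar] at this
    exact this.deriv
  -- Velocity and `K` both have zero mean, so comparing second derivatives suffices.
  have h3 : (∀ x, v.1 x = (K (u t)).1 x) ↔ D (D (toAlg v)) = -opB (wbar (u t)) (toAlg (u t)) := by
    rw [← DD_toAlg_K, DD_toAlg_injective.eq_iff]
    exact ⟨fun h => Subtype.ext (funext h), fun h x => by rw [h]⟩
  simp only [h1, h2, h3]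
  constructor
  · intro h x
    rw [h, PerAlg.neg_apply, hB]
    ring
  · intro h
    refine PerAlg.ext fun x => ?_
    rw [PerAlg.neg_apply, hB]
    linear_combination h x

end Curves

/-! ### The Lax representation -/

section Lax

variable {J : Set ℝ} {u : ℝ → M} {μ : ℂ}

theorem hasDerivAt_lMat_snd (u : M) (μ : ℂ) (x : ℝ) (i j : Fin 3) :
    HasDerivAt (fun y => lMat u.1 μ y i j)
      (!![0, 0, 0; 0, 0, 0; -μ * ((deriv (ubar u.1) x : ℝ) : ℂ), 0, 0] i j) x := by
  fin_cases i <;> fin_cases j <;> try exact hasDerivAt_const x _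
  exact (hasDerivAt_ubar u x).ofReal_comp.const_mul (-μ)

theorem hasDerivAt_lMat_fst (hu : SmoothCurve J u) (hJ : IsOpen J) (μ : ℂ) {t : ℝ} (ht : t ∈ J)
    (x : ℝ) (i j : Fin 3) : HasDerivAt (fun r => lMat (u r).1 μ x i j)
      (!![0, 0, 0; 0, 0, 0; -μ * ((deriv (fun r => ubar (u r).1 x) t : ℝ) : ℂ), 0, 0] i j) t := by
  fin_cases i <;> fin_cases j <;> try exact hasDerivAt_const t _
  exact (hu.hasDerivAt_ubar hJ ht x).ofReal_comp.const_mul (-μ)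

theorem hasDerivAt_qMat (u : M) (μ : ℂ) (x : ℝ) (i j : Fin 3) :
    HasDerivAt (fun y => qMat u.1 μ y i j)
      (!![((ubar u.1 x - 1 / 3 : ℝ) : ℂ), 0, 0; 0, 0, 0; 0, 0, -((ubar u.1 x - 1 / 3 : ℝ) : ℂ)] i j)
      x := by
  fin_cases i <;> fin_cases j <;> try exact hasDerivAt_const x _
  · exact (hasDerivAt_deriv_coe u x).ofReal_comp
  · exact (hasDerivAt_deriv_coe u x).ofReal_comp.neg

/-- Only the lower left entry has content: it is `-μ` times the equation for `ū`. The diagonal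
entries use `u_xx = ū - 1/3`, matched by the constants `-1/3` in `q`. -/
theorem zeroCurvature_iff (hu : SmoothCurve J u) (hJ : IsOpen J) (hμ : μ ≠ 0) :
    ZeroCurvature J u μ ↔ IsSolution J u := by
  rw [isSolution_iff hu hJ]
  refine forall₂_congr fun t ht => forall_congr' fun x => ?_
  simp only [Dt, (hasDerivAt_lMat_fst hu hJ μ ht x _ _).deriv,
    (hasDerivAt_lMat_snd (u t) μ x _ _).deriv, (hasDerivAt_qMat (u t) μ x _ _).deriv]
  constructor
  · intro h
    have h31 := h 2 0
    simp [qMat, lMat] at h31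
    have h' : -μ * ((deriv (fun r => ubar (u r).1 x) t + (u t).1 x * deriv (ubar (u t).1) x +
        3 * deriv (u t).1 x * ubar (u t).1 x : ℝ) : ℂ) = 0 := by
      push_cast
      linear_combination h31
    exact_mod_cast (mul_eq_zero.mp h').resolve_left (neg_ne_zero.mpr hμ)
  · intro h i j
    have h' : ((deriv (fun r => ubar (u r).1 x) t + (u t).1 x * deriv (ubar (u t).1) x +
        3 * deriv (u t).1 x * ubar (u t).1 x : ℝ) : ℂ) = 0 := by rw [h, Complex.ofReal_zero]
    push_cast at h'
    fin_cases i <;> fin_cases j <;> simp [qMat, lMat]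
    · field_simp
      ring
    · linear_combination -μ * h'
    · field_simp
      ring

variable {f : ℝ → ℝ → ℂ}

theorem SmoothOver.exists_iteratedDeriv_eq (hf : SmoothOver J f) (hJ : IsOpen J) {t : ℝ}
    (ht : t ∈ J) (n : ℕ) : ∃ g : ℝ × ℝ → ℂ, ContDiff ℝ ∞ g ∧
      ∀ᶠ r in 𝓝 t, ∀ x, iteratedDeriv n (f r) x = g (r, x) := by
  obtain ⟨g, hg, he⟩ := exists_contDiff_eventually_eq hJ hf ht
  exact ⟨_, contDiff_iteratedDeriv_snd n hg, he.mono fun r hr x => by rw [show f r = _ from funext hr]⟩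

theorem SmoothOver.hasDerivAt_snd (hf : SmoothOver J f) (hJ : IsOpen J) {t : ℝ} (ht : t ∈ J) (n : ℕ)
    (x : ℝ) : HasDerivAt (iteratedDeriv n (f t)) (iteratedDeriv (n + 1) (f t) x) x := by
  obtain ⟨g, hg, he⟩ := hf.exists_iteratedDeriv_eq hJ ht n
  rw [iteratedDeriv_succ, show iteratedDeriv n (f t) = _ from funext he.self_of_nhds]
  exact ((hg.comp (by fun_prop : ContDiff ℝ ∞ fun y : ℝ => (t, y))).differentiable
    (by simp) x).hasDerivAt

theorem SmoothOver.hasDerivAt_fst (hf : SmoothOver J f) (hJ : IsOpen J) {t : ℝ} (ht : t ∈ J) (n : ℕ)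
    (x : ℝ) : HasDerivAt (fun r => iteratedDeriv n (f r) x)
      (deriv (fun r => iteratedDeriv n (f r) x) t) t := by
  obtain ⟨g, hg, he⟩ := hf.exists_iteratedDeriv_eq hJ ht n
  refine DifferentiableAt.hasDerivAt (DifferentiableAt.congr_of_eventuallyEq ?_
    (he.mono fun r hr => hr x))
  exact (hg.comp (by fun_prop : ContDiff ℝ ∞ fun y : ℝ => (y, x))).differentiable (by simp) t

theorem SmoothOver.hasDerivAt_succ (hf : SmoothOver J f) (hJ : IsOpen J) {t : ℝ} (ht : t ∈ J)
    {n : ℕ} {x : ℝ} {e : ℝ → ℂ} {e' : ℂ}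
    (he : ∀ y, deriv (fun r => iteratedDeriv n (f r) y) t = e y) (he' : HasDerivAt e e' x) :
    HasDerivAt (fun r => iteratedDeriv (n + 1) (f r) x) e' t := by
  obtain ⟨g, hg, hge⟩ := hf.exists_iteratedDeriv_eq hJ ht n
  have h := deriv_deriv_comm (hg.contDiffAt (x := (t, x)))
  have h1 : (fun y => deriv (fun r => g (r, y)) t) = e := funext fun y => by
    rw [← he]
    exact (EventuallyEq.deriv_eq (hge.mono fun r hr => hr y)).symm
  rw [h1, he'.deriv] at h
  refine h.congr_of_eventuallyEq (hge.mono fun r hr => ?_)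
  simp only [iteratedDeriv_succ]
  rw [show iteratedDeriv n (f r) = _ from funext hr]

theorem matrixLax_eq_jet {h : Fin 3 → ℝ → ℝ → ℂ} (hh : MatrixLax J u μ h) {t : ℝ} (ht : t ∈ J)
    (x : ℝ) (i : Fin 3) : h i t x = jet (h 0) i t x := by
  have h1 : deriv (h 0 t) = h 1 t := funext fun x => by
    have := (hh t ht x 0).2
    simpa [lMat, Fin.sum_univ_three] using this
  have h2 : deriv (h 1 t) = h 2 t := funext fun x => by
    have := (hh t ht x 1).2
    simpa [lMat, Fin.sum_univ_three] using this
  fin_cases i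
  · rfl
  · simp [jet, h1]
  · simp [jet, iteratedDeriv_succ, h1, h2]

theorem MatrixLax.scalarLax {h : Fin 3 → ℝ → ℝ → ℂ} (hh : MatrixLax J u μ h) :
    ScalarLax J u μ (h 0) := fun t ht x => by
  have h2 : iteratedDeriv 2 (h 0 t) = h 2 t := funext fun x => (matrixLax_eq_jet hh ht x 2).symm
  constructor
  · have := (hh t ht x 2).2
    rw [iteratedDeriv_succ, h2, this]
    simp [lMat, Fin.sum_univ_three]
  · have := (hh t ht x 0).1
    rw [this, h2]
    simp [qMat, Fin.sum_univ_three]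
    ring

/-- The lower rows are `x`-derivatives of the first. In the second row `μ⁻¹f''' = -ūf` meets `u_xx f
= (ū - 1/3)f`, and only `-f/3` survives. -/
theorem ScalarLax.matrixLax (hμ : μ ≠ 0) (hJ : IsOpen J) (hf : SmoothOver J f)
    (h : ScalarLax J u μ f) : MatrixLax J u μ (jet f) := by
  intro t ht
  have hd := fun n x => hf.hasDerivAt_snd hJ ht n x
  have hux := fun x => (hasDerivAt_coe (u t) x).ofReal_comp
  have huxx := fun x => (hasDerivAt_deriv_coe (u t) x).ofReal_comp
  have e0 : ∀ y, deriv (fun r => iteratedDeriv 0 (f r) y) t = μ⁻¹ * iteratedDeriv 2 (f t) y +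
      ((deriv (u t).1 y : ℝ) : ℂ) * iteratedDeriv 0 (f t) y -
        ((u t).1 y : ℂ) * iteratedDeriv 1 (f t) y := fun y => by
    have := (h t ht y).2
    simp only [Dt] at this
    simp only [iteratedDeriv_zero, iteratedDeriv_one]
    linear_combination this
  have e1 : ∀ y, HasDerivAt (fun r => iteratedDeriv 1 (f r) y)
      (-1 / 3 * iteratedDeriv 0 (f t) y - ((u t).1 y : ℂ) * iteratedDeriv 2 (f t) y) t := fun y => by
    have := hf.hasDerivAt_succ hJ ht e0
      ((((hd 2 y).const_mul μ⁻¹).add ((huxx y).mul (hd 0 y))).sub ((hux y).mul (hd 1 y)))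
    refine this.congr_deriv ?_
    simp only [zero_add, Nat.reduceAdd, (h t ht y).1, iteratedDeriv_zero]
    push_cast
    field_simp
    ring
  have e2 : ∀ y, HasDerivAt (fun r => iteratedDeriv 2 (f r) y)
      (-1 / 3 * iteratedDeriv 1 (f t) y - (((deriv (u t).1 y : ℝ) : ℂ) * iteratedDeriv 2 (f t) y +
        ((u t).1 y : ℂ) * iteratedDeriv 3 (f t) y)) t := fun y =>
    hf.hasDerivAt_succ hJ ht (fun y => (e1 y).deriv)
      (((hd 0 y).const_mul _).sub ((hux y).mul (hd 2 y)))
  intro x i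
  have h3 := (h t ht x).1
  fin_cases i
  · have a := e0 x
    have b := (hd 0 x).deriv
    constructor
    · change deriv (fun r => iteratedDeriv 0 (f r) x) t + ((u t).1 x : ℂ) *
        deriv (iteratedDeriv 0 (f t)) x = _
      rw [a, b]
      simp [qMat, Fin.sum_univ_three, jet]
      ring
    · change deriv (iteratedDeriv 0 (f t)) x = _
      rw [b]
      simp [lMat, Fin.sum_univ_three, jet]
  · have a := (e1 x).deriv
    have b := (hd 1 x).deriv
    constructor
    · change deriv (fun r => iteratedDeriv 1 (f r) x) t + ((u t).1 x : ℂ) *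
        deriv (iteratedDeriv 1 (f t)) x = _
      rw [a, b]
      simp [qMat, Fin.sum_univ_three, jet]
    · change deriv (iteratedDeriv 1 (f t)) x = _
      rw [b]
      simp [lMat, Fin.sum_univ_three, jet]
  · have a := (e2 x).deriv
    have b := (hd 2 x).deriv
    constructor
    · change deriv (fun r => iteratedDeriv 2 (f r) x) t + ((u t).1 x : ℂ) *
        deriv (iteratedDeriv 2 (f t)) x = _
      rw [a, b]
      simp [qMat, Fin.sum_univ_three, jet]
      ring
    · change deriv (iteratedDeriv 2 (f t)) x = _
      rw [b, h3]
      simp [lMat, Fin.sum_univ_three, jet]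

theorem scalarLax_iff_matrixLax (hμ : μ ≠ 0) (hJ : IsOpen J) (hf : SmoothOver J f) :
    ScalarLax J u μ f ↔ MatrixLax J u μ (jet f) :=
  ⟨ScalarLax.matrixLax hμ hJ hf, fun h => by
    have := h.scalarLax
    rwa [show jet f 0 = f from funext fun t => funext fun x => by simp [jet]] at this⟩

/-- The time derivative of `f'''` is computed by differentiating the `t`-equation for `f''` in `x`,
and by differentiating the spectral equation in `t`. With data `(1,0,0)` the comparison leaves `μ`
times the equation for `ū`. -/
theorem isSolution_of_compatible (hu : SmoothCurve J u) (hJ : IsOpen J) (hμ : μ ≠ 0)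
    (hc : Compatible J (ScalarLax J u μ)) : IsSolution J u := by
  rw [isSolution_iff hu hJ]
  intro t ht x
  obtain ⟨f, hf, hs, hj⟩ := hc t ht x ![1, 0, 0]
  have j0 : iteratedDeriv 0 (f t) x = 1 := hj 0
  have j1 : iteratedDeriv 1 (f t) x = 0 := hj 1
  have j2 : iteratedDeriv 2 (f t) x = 0 := hj 2
  have hm := hs.matrixLax hμ hJ hf
  have hd := fun n x => hf.hasDerivAt_snd hJ ht n x
  have hux := fun x => (hasDerivAt_coe (u t) x).ofReal_comp
  have huxx := fun x => (hasDerivAt_deriv_coe (u t) x).ofReal_comp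
  have hw := fun x => (hasDerivAt_ubar (u t) x).ofReal_comp
  have hwt := (hu.hasDerivAt_ubar hJ ht x).ofReal_comp
  have ht0 : deriv (fun r => iteratedDeriv 0 (f r) x) t = ((deriv (u t).1 x : ℝ) : ℂ) := by
    have h1 : deriv (fun r => iteratedDeriv 0 (f r) x) t + ((u t).1 x : ℂ) *
      deriv (iteratedDeriv 0 (f t)) x = _ := (hm t ht x 0).1
    rw [(hd 0 x).deriv] at h1
    simpa [qMat, Fin.sum_univ_three, jet, j0, j1, j2, -iteratedDeriv_zero, -iteratedDeriv_one] using h1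
  have ht2 : ∀ y, deriv (fun r => iteratedDeriv 2 (f r) y) t = -1 / 3 * iteratedDeriv 1 (f t) y -
      ((deriv (u t).1 y : ℝ) : ℂ) * iteratedDeriv 2 (f t) y +
      μ * (((u t).1 y : ℂ) * (ubar (u t).1 y : ℂ) * iteratedDeriv 0 (f t) y) := fun y => by
    have h1 : deriv (fun r => iteratedDeriv 2 (f r) y) t + ((u t).1 y : ℂ) *
      deriv (iteratedDeriv 2 (f t)) y = _ := (hm t ht y 2).1
    rw [(hd 2 y).deriv, (hs t ht y).1] at h1
    simp [qMat, Fin.sum_univ_three, jet, -iteratedDeriv_zero, -iteratedDeriv_one] at h1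
    rw [iteratedDeriv_zero]
    linear_combination h1
  have c1 := hf.hasDerivAt_succ hJ ht ht2
    ((((hd 1 x).const_mul _).sub ((huxx x).mul (hd 2 x))).add
      ((((hux x).mul (hw x)).mul (hd 0 x)).const_mul μ))
  have c2 : HasDerivAt (fun r => iteratedDeriv 3 (f r) x) _ t :=
    ((hwt.mul (hf.hasDerivAt_fst hJ ht 0 x)).const_mul (-μ)).congr_of_eventuallyEq
      ((hJ.eventually_mem ht).mono fun r hr => by
        simp only [(hs r hr x).1, Pi.mul_apply, iteratedDeriv_zero]
        ring)
  have hu := c1.unique c2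
  rw [ht0] at hu
  have j0' : f t x = 1 := by simpa using j0
  simp only [zero_add, Nat.reduceAdd, j0, j1, j2, (hs t ht x).1, j0', Pi.mul_apply] at hu
  have h' : μ * ((deriv (fun r => ubar (u r).1 x) t + (u t).1 x * deriv (ubar (u t).1) x +
        3 * deriv (u t).1 x * ubar (u t).1 x : ℝ) : ℂ) = 0 := by
    push_cast
    linear_combination hu
  exact_mod_cast (mul_eq_zero.mp h').resolve_left hμ

-- Solutions of the Lax system from zero curvature

attribute [local instance] Matrix.linftyOpNormedRing Matrix.linftyOpNormedAlgebra

/-- Complex matrices with the topology of the operator norm, as a product. -/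
def matrixEquivPi : Matrix (Fin 3) (Fin 3) ℂ ≃L[ℝ] (Fin 3 → Fin 3 → ℂ) :=
  (Matrix.ofLinearEquiv ℝ).symm.toContinuousLinearEquiv

theorem hasDerivAt_matrix {A : ℝ → Matrix (Fin 3) (Fin 3) ℂ} {A' : Matrix (Fin 3) (Fin 3) ℂ} {t : ℝ} :
    HasDerivAt A A' t ↔ ∀ i j, HasDerivAt (fun r => A r i j) (A' i j) t := by
  have h : HasDerivAt A A' t ↔ HasDerivAt (fun r => matrixEquivPi (A r)) (matrixEquivPi A') t := by
    refine ⟨fun h => matrixEquivPi.hasFDerivAt.comp_hasDerivAt t h, fun h => ?_⟩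
    exact matrixEquivPi.symm.hasFDerivAt.comp_hasDerivAt t h
  rw [h]
  refine hasDerivAt_pi.trans (forall_congr' fun i => ?_)
  exact hasDerivAt_pi

theorem contDiffOn_matrix {A : ℝ × ℝ → Matrix (Fin 3) (Fin 3) ℂ} {s : Set (ℝ × ℝ)} :
    ContDiffOn ℝ ∞ A s ↔ ∀ i j, ContDiffOn ℝ ∞ (fun r => A r i j) s := by
  have h : ContDiffOn ℝ ∞ A s ↔ ContDiffOn ℝ ∞ (fun r => matrixEquivPi (A r)) s :=
    (matrixEquivPi.comp_contDiffOn_iff (f := A)).symm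
  rw [h]
  refine contDiffOn_pi.trans (forall_congr' fun i => ?_)
  exact contDiffOn_pi

theorem contDiffOn_lMat (hu : SmoothCurve J u) (hJ : IsOpen J) (μ : ℂ) :
    ContDiffOn ℝ ∞ (fun z : ℝ × ℝ => lMat (u z.1).1 μ z.2) (J ×ˢ Set.univ) := by
  have hw := Complex.ofRealCLM.contDiff.comp_contDiffOn (hu.contDiffOn hJ smoothAlgMap_wbar)
  simp only [← ubar_eq_wbar] at hw
  refine contDiffOn_matrix.mpr fun i j => ?_
  fin_cases i <;> fin_cases j <;> try exact contDiffOn_const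
  exact contDiffOn_const.mul hw

theorem contDiffOn_qMat (hu : SmoothCurve J u) (hJ : IsOpen J) (μ : ℂ) :
    ContDiffOn ℝ ∞ (fun z : ℝ × ℝ => qMat (u z.1).1 μ z.2) (J ×ˢ Set.univ) := by
  have hd := Complex.ofRealCLM.contDiff.comp_contDiffOn (hu.contDiffOn hJ smoothMap_id.toAlg.D)
  refine contDiffOn_matrix.mpr fun i j => ?_
  fin_cases i <;> fin_cases j <;> try exact contDiffOn_const
  · exact hd
  · exact hd.neg

theorem compatible_of_isSolution (hu : SmoothCurve J u) (hJ : IsOpen J) (hJ' : IsPreconnected J)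
    (hμ : μ ≠ 0) (hs : IsSolution J u) : Compatible J (ScalarLax J u μ) := by
  intro t₀ ht₀ x₀ c
  have hU := Complex.ofRealCLM.contDiff.comp_contDiffOn (hu.contDiffOn hJ smoothMap_id.toAlg)
  have hz := (zeroCurvature_iff hu hJ hμ).mpr hs
  -- Since `D_t = ∂_t + u∂_x`, the system in plain partial derivatives has `t`-matrix `q - ul`.
  set m : ℝ × ℝ → Matrix (Fin 3) (Fin 3) ℂ := fun z =>
    qMat (u z.1).1 μ z.2 - ((u z.1).1 z.2 : ℂ) • lMat (u z.1).1 μ z.2 with hm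
  have hms : ContDiffOn ℝ ∞ m (J ×ˢ Set.univ) :=
    contDiffOn_matrix.mpr fun i j => (contDiffOn_matrix.mp (contDiffOn_qMat hu hJ μ) i j).sub
      (hU.mul (contDiffOn_matrix.mp (contDiffOn_lMat hu hJ μ) i j))
  obtain ⟨h, hh, h0, hd⟩ := exists_solution_of_zero_curvature hJ hJ'
    (l := fun z => lMat (u z.1).1 μ z.2) (m := m) (contDiffOn_lMat hu hJ μ) hms (fun t ht x => by
      have h1 := hasDerivAt_matrix.mpr (hasDerivAt_lMat_fst hu hJ μ ht x)
      have h2 : HasDerivAt (fun y => m (t, y))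
          (!![((ubar (u t).1 x - 1 / 3 : ℝ) : ℂ), 0, 0; 0, 0, 0; 0, 0,
            -((ubar (u t).1 x - 1 / 3 : ℝ) : ℂ)] -
            (((deriv (u t).1 x : ℝ) : ℂ) • lMat (u t).1 μ x + ((u t).1 x : ℂ) •
            !![0, 0, 0; 0, 0, 0; -μ * ((deriv (ubar (u t).1) x : ℝ) : ℂ), 0, 0])) x :=
        hasDerivAt_matrix.mpr fun i j =>
        (hasDerivAt_qMat (u t) μ x i j).sub
          ((hasDerivAt_coe (u t) x).ofReal_comp.mul (hasDerivAt_lMat_snd (u t) μ x i j))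
      rw [h1.deriv, h2.deriv]
      ext i j
      have h3 := hz t ht x i j
      simp only [Dt, (hasDerivAt_lMat_fst hu hJ μ ht x i j).deriv,
        (hasDerivAt_lMat_snd (u t) μ x i j).deriv, (hasDerivAt_qMat (u t) μ x i j).deriv] at h3
      simp only [hm, mul_sub, sub_mul, smul_eq_mul, Matrix.smul_apply, Matrix.mul_smul, Matrix.smul_mul, Matrix.add_apply,
        Matrix.sub_apply, Matrix.zero_apply, sub_sub_sub_cancel_right] at h3 ⊢
      linear_combination h3) ht₀ x₀
  set f : Fin 3 → ℝ → ℝ → ℂ := fun i t x => ∑ j, h (t, x) i j * c j with hf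
  have hML : MatrixLax J u μ f := by
    intro t ht x i
    have hx : HasDerivAt (f i t) (∑ j, (lMat (u t).1 μ x * h (t, x)) i j * c j) x :=
      HasDerivAt.fun_sum fun j _ => (hasDerivAt_matrix.mp (hd t ht x).1 i j).mul_const (c j)
    have ht' : HasDerivAt (fun r => f i r x) (∑ j, (m (t, x) * h (t, x)) i j * c j) t :=
      HasDerivAt.fun_sum fun j _ => (hasDerivAt_matrix.mp (hd t ht x).2 i j).mul_const (c j)
    rw [Dt, hx.deriv, ht'.deriv]
    simp only [hm, hf, Matrix.mul_apply, Matrix.sub_apply, Matrix.smul_apply, smul_eq_mul,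
      Fin.sum_univ_three]
    constructor <;> ring
  have hfs : SmoothOver J (f 0) := by
    have : ∀ j, ContDiffOn ℝ ∞ (fun z => h z 0 j) (J ×ˢ Set.univ) := fun j =>
      contDiffOn_matrix.mp hh 0 j
    exact ContDiffOn.sum fun j _ => (this j).mul contDiffOn_const
  refine ⟨f 0, hfs, hML.scalarLax, fun i => ?_⟩
  rw [← matrixLax_eq_jet hML ht₀]
  simp [hf, h0, Matrix.one_apply]

theorem isSolution_iff_compatible (hu : SmoothCurve J u) (hJ : IsOpen J) (hJ' : IsPreconnected J)
    (hμ : μ ≠ 0) : IsSolution J u ↔ Compatible J (ScalarLax J u μ) :=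
  ⟨compatible_of_isSolution hu hJ hJ' hμ, isSolution_of_compatible hu hJ hμ⟩

/-- The adjoint system is the original one at `-μ`, so all results for `μ ≠ 0` transfer. -/
theorem adjointLax_iff : AdjointLax J u μ f ↔ ScalarLax J u (-μ) f := by
  simp only [AdjointLax, ScalarLax, neg_neg, inv_neg]

theorem isSolution_iff_compatible_adjoint (hu : SmoothCurve J u) (hJ : IsOpen J)
    (hJ' : IsPreconnected J) (hμ : μ ≠ 0) : IsSolution J u ↔ Compatible J (AdjointLax J u μ) := by
  rw [show AdjointLax J u μ = ScalarLax J u (-μ) from funext fun f => propext adjointLax_iff]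
  exact isSolution_iff_compatible hu hJ hJ' (neg_ne_zero.mpr hμ)

end Lax

end OV

namespace OV

open MeasureTheory Filter Topology PerAlg

/-! ### The Hamiltonians of `K` -/

theorem SmoothPath.hasDerivAt_perInt {f : ℝ → PerAlg} (hf : SmoothPath f) {f' : PerAlg} {s : ℝ}
    (h : HasPathDeriv f f' s) : HasDerivAt (fun r => perInt (f r)) (perInt f') s := by
  rw [h.unique (hf.hasPathDeriv s)]
  exact hf.perInt_pathDeriv s

theorem SmoothAlgMap.hasDerivAt_perInt {Φ : M → PerAlg} (hΦ : SmoothAlgMap Φ) {p : ℝ → M}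
    (hp : SmoothMPath p) {f' : PerAlg} {s : ℝ} (h : HasPathDeriv (fun r => Φ (p r)) f' s) :
    HasDerivAt (fun r => PerAlg.perInt (Φ (p r))) (PerAlg.perInt f') s :=
  (hΦ.path hp).hasDerivAt_perInt h

theorem toAlg_subMean_eq (f : PerAlg) : toAlg (subMean f) = f - algebraMap ℝ PerAlg (mean f.1) := rfl

theorem perInt_subMean_mul (f : PerAlg) (v : M) :
    perInt (toAlg (subMean f) * toAlg v) = perInt (f * toAlg v) := by
  rw [toAlg_subMean_eq, sub_mul, map_sub, ← Algebra.smul_def, map_smul, perInt_toAlg, smul_zero,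
    sub_zero]

theorem hasPathDeriv_Dinv_line (u v : M) (s : ℝ) :
    HasPathDeriv (fun r : ℝ => toAlg (Dinv (u + r • v))) (toAlg (Dinv v)) s := by
  have h : ∀ r : ℝ, Dinv (u + r • v) = Dinv u + r • Dinv v := fun r => D_toAlg_injective (by
    simp only [D_toAlg_Dinv, map_add, map_smul, D_smul])
  simp only [h]
  exact hasPathDeriv_line _ _ s

/-- The gradient of `H`. -/
def gradH (u : M) : M := (1 / 2 : ℝ) • subMean (toAlg u * toAlg u) + Dinv (Dinv u)

theorem smoothMap_gradH : SmoothMap gradH :=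
  (((smoothMap_id.toAlg.mul smoothMap_id.toAlg).subMean).smul _).add
    (smoothMap_Dinv.comp smoothMap_Dinv)

theorem hasGrad_H : HasGrad H gradH := by
  intro u v
  have hU : SmoothAlgMap fun u => toAlg u := smoothMap_id.toAlg
  have hI : SmoothAlgMap fun u => toAlg (Dinv u) := smoothMap_Dinv.toAlg
  have hp := smoothMPath_line u v
  have d1 := ((hU.mul hU).mul hU).hasDerivAt_perInt hp (s := 0)
    (((hasPathDeriv_line u v 0).mul (hasPathDeriv_line u v 0)).mul (hasPathDeriv_line u v 0))
  have d2 := (hI.mul hI).hasDerivAt_perInt hp (s := 0)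
    ((hasPathDeriv_Dinv_line u v 0).mul (hasPathDeriv_Dinv_line u v 0))
  have hH : ∀ u, H u = 1 / 2 * (1 / 3 * perInt (toAlg u * toAlg u * toAlg u) -
      perInt (toAlg (Dinv u) * toAlg (Dinv u))) := fun u => by
    rw [← smul_eq_mul (1 / 3), ← map_smul, ← map_sub]
    refine congrArg (1 / 2 * ·) (intervalIntegral.integral_congr fun x _ => ?_)
    simp only [PerAlg.sub_apply, PerAlg.smul_apply, PerAlg.mul_apply, toAlg_apply]
    ring
  simp only [hH]
  refine (((d1.const_mul (1 / 3)).sub d2).const_mul (1 / 2)).congr_deriv ?_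
  have e0 : u + (0 : ℝ) • v = u := by rw [zero_smul, add_zero]
  have e1 : perInt (toAlg (Dinv (Dinv u)) * toAlg v) = -perInt (toAlg (Dinv u) * toAlg (Dinv v)) := by
    conv_lhs => rw [← D_toAlg_Dinv v]
    rw [perInt_mul_D, D_toAlg_Dinv]
  have e2 : toAlg u * toAlg v * toAlg u = toAlg u * toAlg u * toAlg v := by ring
  simp only [pair_toAlg, gradH, map_add, map_smul, add_mul, smul_mul_assoc, perInt_subMean_mul, e1,
    e0, e2, smul_eq_mul, mul_comm (toAlg v) (toAlg u), mul_comm (toAlg (Dinv v))]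
  ring

theorem theta_gradH (u : M) : theta u (gradH u) (-K u) := by
  refine toAlg_injective ?_
  have h : (algebraMap ℝ PerAlg (1 / 2)) * 2 = 1 := by
    rw [← map_ofNat (algebraMap ℝ PerAlg) 2, ← map_mul]
    norm_num
  simp only [toAlg_Dx, gradH, map_add, map_smul, map_neg, toAlg_K, D_toAlg_Dinv,
    toAlg_subMean_eq, map_sub, D_algebraMap, D_mul, Algebra.smul_def]
  linear_combination -(toAlg u * D (toAlg u)) * h

theorem Hbar_eq (u : M) : Hbar u = Real.pi / 3 := by
  have h : Hbar u = 1 / 2 * perInt (wbar u) := by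
    rw [Hbar, ubar_eq_wbar]
    rfl
  rw [h, wbar, map_add, perInt_D, perInt_algebraMap]
  ring

theorem hasGrad_Hbar : HasGrad Hbar fun _ => 0 := fun u v => by
  simp only [Hbar_eq]
  refine (hasDerivAt_const (0 : ℝ) (Real.pi / 3)).congr_deriv ?_
  rw [pair_toAlg, map_zero, zero_mul, map_zero]

/-- The witness is `χ = u`: `A(1/2) = ū' = u'''` and `B u = -(K u)''`. -/
theorem etaVia_neg_K (u : M) : EtaVia u (constPer (1 / 2)) ⟨u.1, u.2.1⟩ (-K u) := by
  refine (etaVia_iff u (algebraMap ℝ PerAlg (1 / 2)) (toAlg u) (-K u)).mpr ⟨?_, ?_⟩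
  · have h : 2 * algebraMap ℝ PerAlg (1 / 2) = 1 := by
      rw [← map_ofNat (algebraMap ℝ PerAlg) 2, ← map_mul]
      norm_num
    rw [opA, D_wbar, D_algebraMap]
    linear_combination (-D (D (D (toAlg u)))) * h
  · rw [map_neg, map_neg, map_neg, DD_toAlg_K, neg_neg]

theorem eta_zero_neg_K (u : M) : eta u 0 (-K u) :=
  ⟨constPer (1 / 2), ⟨u.1, u.2.1⟩, fun x => by
    simp only [constPer, iteratedDeriv_const]
    simp, etaVia_neg_K u⟩

end OV

namespace OV

open MeasureTheory Filter Topology PerAlg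

/-! ### Calculus of formal power series -/

section Series

open PowerSeries

/-- The function `f` with values in formal power series has derivative `f'` at `x`. -/
def SeriesDeriv (f : ℝ → ℝ⟦X⟧) (f' : ℝ⟦X⟧) (x : ℝ) : Prop :=
  ∀ n, HasDerivAt (fun r => coeff n (f r)) (coeff n f') x

/-- The function `f` with values in formal power series is smooth. -/
def SeriesSmooth {E : Type} [NormedAddCommGroup E] [NormedSpace ℝ E] (f : E → ℝ⟦X⟧) : Prop :=
  ∀ n, ContDiff ℝ ∞ fun z => coeff n (f z)

/-- The matrix-valued function `A` has derivative `A'` at `x`. -/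
def MatrixDeriv (A : ℝ → Matrix (Fin 3) (Fin 3) ℝ⟦X⟧) (A' : Matrix (Fin 3) (Fin 3) ℝ⟦X⟧) (x : ℝ) :
    Prop := ∀ i j, SeriesDeriv (fun r => A r i j) (A' i j) x

/-- The matrix-valued function `A` is smooth. -/
def MatrixSmooth {E : Type} [NormedAddCommGroup E] [NormedSpace ℝ E]
    (A : E → Matrix (Fin 3) (Fin 3) ℝ⟦X⟧) : Prop := ∀ i j, SeriesSmooth fun z => A z i j

variable {E : Type} [NormedAddCommGroup E] [NormedSpace ℝ E]

theorem SeriesDeriv.mul {f g : ℝ → ℝ⟦X⟧} {f' g' : ℝ⟦X⟧} {x : ℝ} (hf : SeriesDeriv f f' x)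
    (hg : SeriesDeriv g g' x) : SeriesDeriv (fun r => f r * g r) (f x * g' + f' * g x) x := fun n => by
  simp only [map_add, coeff_mul, ← Finset.sum_add_distrib]
  refine HasDerivAt.fun_sum fun q _ => ((hf q.1).mul (hg q.2)).congr_deriv ?_
  ring

theorem SeriesDeriv.sum {ι : Type} {s : Finset ι} {f : ι → ℝ → ℝ⟦X⟧} {f' : ι → ℝ⟦X⟧} {x : ℝ}
    (h : ∀ i ∈ s, SeriesDeriv (f i) (f' i) x) :
    SeriesDeriv (fun r => ∑ i ∈ s, f i r) (∑ i ∈ s, f' i) x := fun n => by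
  simp only [map_sum]
  exact HasDerivAt.fun_sum fun i hi => h i hi n

theorem SeriesSmooth.mul {f g : E → ℝ⟦X⟧} (hf : SeriesSmooth f) (hg : SeriesSmooth g) :
    SeriesSmooth fun z => f z * g z := fun n => by
  simp only [coeff_mul]
  exact ContDiff.sum fun q _ => (hf q.1).mul (hg q.2)

theorem SeriesSmooth.sum {ι : Type} {s : Finset ι} {f : ι → E → ℝ⟦X⟧}
    (h : ∀ i ∈ s, SeriesSmooth (f i)) : SeriesSmooth fun z => ∑ i ∈ s, f i z := fun n => by
  simp only [map_sum]
  exact ContDiff.sum fun i hi => h i hi n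

theorem MatrixDeriv.const (A : Matrix (Fin 3) (Fin 3) ℝ⟦X⟧) (x : ℝ) : MatrixDeriv (fun _ => A) 0 x :=
  fun _ _ _ => hasDerivAt_const _ _

theorem MatrixDeriv.mul {A B : ℝ → Matrix (Fin 3) (Fin 3) ℝ⟦X⟧}
    {A' B' : Matrix (Fin 3) (Fin 3) ℝ⟦X⟧} {x : ℝ} (hA : MatrixDeriv A A' x)
    (hB : MatrixDeriv B B' x) : MatrixDeriv (fun r => A r * B r) (A x * B' + A' * B x) x :=
  fun i j => by
  simp only [Matrix.add_apply, Matrix.mul_apply, ← Finset.sum_add_distrib]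
  exact SeriesDeriv.sum fun k _ => (hA i k).mul (hB k j)

theorem MatrixSmooth.mul {A B : E → Matrix (Fin 3) (Fin 3) ℝ⟦X⟧} (hA : MatrixSmooth A)
    (hB : MatrixSmooth B) : MatrixSmooth fun z => A z * B z := fun i j => by
  simp only [Matrix.mul_apply]
  exact SeriesSmooth.sum fun k _ => (hA i k).mul (hB k j)

theorem MatrixSmooth.comp {E' : Type} [NormedAddCommGroup E'] [NormedSpace ℝ E']
    {A : E → Matrix (Fin 3) (Fin 3) ℝ⟦X⟧} (hA : MatrixSmooth A) {g : E' → E} (hg : ContDiff ℝ ∞ g) :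
    MatrixSmooth fun z => A (g z) := fun i j n => (hA i j n).comp hg

theorem MatrixSmooth.contDiff {A : E → Matrix (Fin 3) (Fin 3) ℝ⟦X⟧} (h : MatrixSmooth A)
    (i j : Fin 3) (n : ℕ) : ContDiff ℝ ∞ fun z => coeff n (A z i j) := h i j n

theorem MatrixDeriv.eq_of_zero {A : ℝ → Matrix (Fin 3) (Fin 3) ℝ⟦X⟧}
    (h : ∀ x, MatrixDeriv A 0 x) (x y : ℝ) : A x = A y := by
  ext i j n
  exact is_const_of_deriv_eq_zero (f := fun r => coeff n (A r i j))
    (fun x => (h x i j n).differentiableAt) (fun x => (h x i j n).deriv) x y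

end Series

/-! ### The monodromy matrix as a formal power series in the spectral parameter -/

section Monodromy

open PowerSeries

/-- The primitive that vanishes at `0`. -/
def prim (f : ℝ → ℝ) (x : ℝ) : ℝ := ∫ y in (0 : ℝ)..x, f y

theorem prim_zero (f : ℝ → ℝ) : prim f 0 = 0 := intervalIntegral.integral_same

theorem hasDerivAt_prim {f : ℝ → ℝ} (hf : Continuous f) (x : ℝ) : HasDerivAt (prim f) (f x) x :=
  (hf.integral_hasStrictDerivAt 0 x).hasDerivAt

/-- The coefficients of the fundamental matrix of `F_x = l F`. -/
def fundCoeff (w : ℝ → ℝ) : ℕ → Fin 3 → Fin 3 → ℝ → ℝ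
  | 0 => fun i j x => !![1, x, x ^ 2 / 2; 0, 1, x; 0, 0, 1] i j
  | n + 1 => fun i j => ![prim (prim (prim fun y => -(w y * fundCoeff w n 0 j y))),
      prim (prim fun y => -(w y * fundCoeff w n 0 j y)),
      prim fun y => -(w y * fundCoeff w n 0 j y)] i

/-- The coefficients of the inverse of the fundamental matrix. -/
def invCoeff (w : ℝ → ℝ) : ℕ → Fin 3 → Fin 3 → ℝ → ℝ
  | 0 => fun i j x => !![1, -x, x ^ 2 / 2; 0, 1, -x; 0, 0, 1] i j
  | n + 1 => fun i j => ![prim fun y => w y * invCoeff w n i 2 y,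
      fun x => -prim (prim fun y => w y * invCoeff w n i 2 y) x,
      prim (prim (prim fun y => w y * invCoeff w n i 2 y))] j

section Smooth

variable {E : Type} [NormedAddCommGroup E] [NormedSpace ℝ E] [ProperSpace E]

theorem contDiff_prim {g : E × ℝ → ℝ} (hg : ContDiff ℝ ∞ g) :
    ContDiff ℝ ∞ fun z : E × ℝ => prim (fun y => g (z.1, y)) z.2 := contDiff_primitive_param hg

theorem contDiff_fundCoeff {w : E × ℝ → ℝ} (hw : ContDiff ℝ ∞ w) (n : ℕ) (i j : Fin 3) :
    ContDiff ℝ ∞ fun z : E × ℝ => fundCoeff (fun y => w (z.1, y)) n i j z.2 := by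
  induction n generalizing i with
  | zero =>
    fin_cases i <;> fin_cases j <;> first | exact contDiff_const | exact contDiff_snd | skip
    exact (contDiff_snd.pow 2).div_const 2
  | succ n ih =>
    have h1 := contDiff_prim (hw.mul (ih 0)).neg
    fin_cases i
    · exact contDiff_prim (contDiff_prim h1)
    · exact contDiff_prim h1
    · exact h1

theorem contDiff_invCoeff {w : E × ℝ → ℝ} (hw : ContDiff ℝ ∞ w) (n : ℕ) (i j : Fin 3) :
    ContDiff ℝ ∞ fun z : E × ℝ => invCoeff (fun y => w (z.1, y)) n i j z.2 := by
  induction n generalizing j with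
  | zero =>
    fin_cases i <;> fin_cases j <;>
      first | exact contDiff_const | exact contDiff_snd.neg | skip
    exact (contDiff_snd.pow 2).div_const 2
  | succ n ih =>
    have h1 := contDiff_prim (hw.mul (ih 2))
    fin_cases j
    · exact h1
    · exact (contDiff_prim h1).neg
    · exact contDiff_prim (contDiff_prim h1)

end Smooth

/-- The fundamental matrix of `F_x = l F` with `F(0) = 1`. -/
def fund (w : ℝ → ℝ) (x : ℝ) : Matrix (Fin 3) (Fin 3) ℝ⟦X⟧ :=
  Matrix.of fun i j => PowerSeries.mk fun n => fundCoeff w n i j x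

/-- The inverse of the fundamental matrix. -/
def fundInv (w : ℝ → ℝ) (x : ℝ) : Matrix (Fin 3) (Fin 3) ℝ⟦X⟧ :=
  Matrix.of fun i j => PowerSeries.mk fun n => invCoeff w n i j x

/-- The matrix `l` of the `x`-part; the indeterminate is the spectral parameter. -/
def lSeries (c : ℝ) : Matrix (Fin 3) (Fin 3) ℝ⟦X⟧ := !![0, 1, 0; 0, 0, 1; C (-c) * X, 0, 0]

theorem coeff_succ_C_mul_X_mul (c : ℝ) (f : ℝ⟦X⟧) (n : ℕ) :
    coeff (n + 1) (C c * X * f) = c * coeff n f := by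
  rw [mul_assoc, coeff_C_mul, coeff_succ_X_mul]

theorem coeff_succ_neg_C_mul_X_mul (c : ℝ) (f : ℝ⟦X⟧) (n : ℕ) :
    coeff (n + 1) (-(C (-c) * X * f)) = c * coeff n f := by
  rw [map_neg, coeff_succ_C_mul_X_mul]
  ring

theorem coeff_fund (w : ℝ → ℝ) (x : ℝ) (n : ℕ) (i j : Fin 3) :
    coeff n (fund w x i j) = fundCoeff w n i j x := by
  rw [fund, Matrix.of_apply, coeff_mk]

theorem coeff_fundInv (w : ℝ → ℝ) (x : ℝ) (n : ℕ) (i j : Fin 3) :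
    coeff n (fundInv w x i j) = invCoeff w n i j x := by
  rw [fundInv, Matrix.of_apply, coeff_mk]

theorem matrixSmooth_fund {E : Type} [NormedAddCommGroup E] [NormedSpace ℝ E] [ProperSpace E]
    {w : E × ℝ → ℝ} (hw : ContDiff ℝ ∞ w) :
    MatrixSmooth fun z : E × ℝ => fund (fun y => w (z.1, y)) z.2 := fun i j n => by
  simp only [coeff_fund]
  exact contDiff_fundCoeff hw n i j

theorem matrixSmooth_fundInv {E : Type} [NormedAddCommGroup E] [NormedSpace ℝ E] [ProperSpace E]
    {w : E × ℝ → ℝ} (hw : ContDiff ℝ ∞ w) :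
    MatrixSmooth fun z : E × ℝ => fundInv (fun y => w (z.1, y)) z.2 := fun i j n => by
  simp only [coeff_fundInv]
  exact contDiff_invCoeff hw n i j

variable {w : ℝ → ℝ}

theorem continuous_fundCoeff (hw : ContDiff ℝ ∞ w) (n : ℕ) (i j : Fin 3) :
    Continuous (fundCoeff w n i j) :=
  ((contDiff_fundCoeff (E := ℝ) (hw.comp contDiff_snd) n i j).comp
    (by fun_prop : ContDiff ℝ ∞ fun x : ℝ => ((0 : ℝ), x))).continuous

theorem continuous_invCoeff (hw : ContDiff ℝ ∞ w) (n : ℕ) (i j : Fin 3) :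
    Continuous (invCoeff w n i j) :=
  ((contDiff_invCoeff (E := ℝ) (hw.comp contDiff_snd) n i j).comp
    (by fun_prop : ContDiff ℝ ∞ fun x : ℝ => ((0 : ℝ), x))).continuous

/-- Only the lower left entry of `l` carries the indeterminate: at each order the bottom row is
integrated from the previous order, and each upper row from the row below it. -/
theorem matrixDeriv_fund (hw : ContDiff ℝ ∞ w) (x : ℝ) :
    MatrixDeriv (fund w) (lSeries (w x) * fund w x) x := by
  intro i j n
  simp only [coeff_fund]
  cases n with
  | zero =>
    have hs : HasDerivAt (fun x : ℝ => x ^ 2 / 2) x x :=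
      ((hasDerivAt_pow 2 x).div_const 2).congr_deriv (by norm_num)
    fin_cases i <;> fin_cases j <;>
      simp [lSeries, Matrix.mul_apply, Fin.sum_univ_three, fundCoeff, fund, hasDerivAt_const,
        hasDerivAt_id', mul_assoc, hs]
  | succ n =>
    have h1 : Continuous fun y => -(w y * fundCoeff w n 0 j y) :=
      (hw.continuous.mul (continuous_fundCoeff hw n 0 j)).neg
    have h2 : Continuous (prim fun y => -(w y * fundCoeff w n 0 j y)) :=
      continuous_fundCoeff hw (n + 1) 2 j
    have h3 : Continuous (prim (prim fun y => -(w y * fundCoeff w n 0 j y))) :=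
      continuous_fundCoeff hw (n + 1) 1 j
    fin_cases i
    · refine (hasDerivAt_prim h3 x).congr_deriv ?_
      simp [lSeries, Matrix.mul_apply, Fin.sum_univ_three, coeff_fund, fundCoeff]
    · refine (hasDerivAt_prim h2 x).congr_deriv ?_
      simp [lSeries, Matrix.mul_apply, Fin.sum_univ_three, coeff_fund, fundCoeff]
    · refine (hasDerivAt_prim h1 x).congr_deriv ?_
      simp [lSeries, Matrix.mul_apply, Fin.sum_univ_three, coeff_fund,
        coeff_succ_C_mul_X_mul, -map_neg]

theorem matrixDeriv_fundInv (hw : ContDiff ℝ ∞ w) (x : ℝ) :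
    MatrixDeriv (fundInv w) (fundInv w x * -lSeries (w x)) x := by
  intro i j n
  simp only [coeff_fundInv]
  cases n with
  | zero =>
    have hs : HasDerivAt (fun x : ℝ => x ^ 2 / 2) x x :=
      ((hasDerivAt_pow 2 x).div_const 2).congr_deriv (by norm_num)
    fin_cases i <;> fin_cases j <;>
      simp [lSeries, Matrix.mul_apply, Fin.sum_univ_three, invCoeff, fundInv, hasDerivAt_const,
        hs, hasDerivAt_neg']
  | succ n =>
    have h1 : Continuous fun y => w y * invCoeff w n i 2 y :=
      hw.continuous.mul (continuous_invCoeff hw n i 2)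
    have h2 : Continuous (prim fun y => w y * invCoeff w n i 2 y) :=
      continuous_invCoeff hw (n + 1) i 0
    have h3 : Continuous (prim (prim fun y => w y * invCoeff w n i 2 y)) :=
      (continuous_invCoeff hw (n + 1) i 1).neg.congr fun x => neg_neg _
    fin_cases j
    · refine (hasDerivAt_prim h1 x).congr_deriv ?_
      simp [lSeries, Matrix.mul_apply, Fin.sum_univ_three, mul_comm _ (C _ * X), -map_neg]
      exact ((coeff_succ_neg_C_mul_X_mul _ _ _).trans (by rw [coeff_fundInv])).symm
    · refine (hasDerivAt_prim h2 x).neg.congr_deriv ?_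
      simp [lSeries, Matrix.mul_apply, Fin.sum_univ_three, coeff_fundInv, invCoeff]
    · refine (hasDerivAt_prim h3 x).congr_deriv ?_
      simp [lSeries, Matrix.mul_apply, Fin.sum_univ_three, coeff_fundInv, invCoeff]

theorem fund_zero (w : ℝ → ℝ) : fund w 0 = 1 := by
  ext i j n
  rw [coeff_fund]
  cases n with
  | zero => fin_cases i <;> fin_cases j <;> simp [fundCoeff]
  | succ n => fin_cases i <;> fin_cases j <;> simp [fundCoeff, prim_zero, coeff_one]

theorem fundInv_zero (w : ℝ → ℝ) : fundInv w 0 = 1 := by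
  ext i j n
  rw [coeff_fundInv]
  cases n with
  | zero => fin_cases i <;> fin_cases j <;> simp [invCoeff]
  | succ n => fin_cases i <;> fin_cases j <;> simp [invCoeff, prim_zero, coeff_one]

theorem fundInv_mul_fund (hw : ContDiff ℝ ∞ w) (x : ℝ) : fundInv w x * fund w x = 1 := by
  have h : ∀ x, MatrixDeriv (fun x => fundInv w x * fund w x) 0 x := fun x => by
    have := (matrixDeriv_fundInv hw x).mul (matrixDeriv_fund hw x)
    rwa [show fundInv w x * (lSeries (w x) * fund w x) + fundInv w x * -lSeries (w x) * fund w x = 0 by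
      noncomm_ring] at this
  have := MatrixDeriv.eq_of_zero h x 0
  simpa only [fund_zero, fundInv_zero, mul_one] using this

theorem fund_mul_fundInv (hw : ContDiff ℝ ∞ w) (x : ℝ) : fund w x * fundInv w x = 1 :=
  mul_eq_one_comm.mp (fundInv_mul_fund hw x)

theorem eq_fund_mul (hw : ContDiff ℝ ∞ w) {Y : ℝ → Matrix (Fin 3) (Fin 3) ℝ⟦X⟧}
    (hY : ∀ x, MatrixDeriv Y (lSeries (w x) * Y x) x) (x : ℝ) : Y x = fund w x * Y 0 := by
  have h : ∀ x, MatrixDeriv (fun x => fundInv w x * Y x) 0 x := fun x => by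
    have := (matrixDeriv_fundInv hw x).mul (hY x)
    rwa [show fundInv w x * (lSeries (w x) * Y x) + fundInv w x * -lSeries (w x) * Y x = 0 by
      noncomm_ring] at this
  have := MatrixDeriv.eq_of_zero h x 0
  simp only [fundInv_zero, one_mul] at this
  rw [← this, ← mul_assoc, fund_mul_fundInv hw, one_mul]

/-! ### Periodic potentials and the monodromy matrix -/

theorem fund_add (hw : ContDiff ℝ ∞ w) {a : ℝ} (ha : Function.Periodic w a) (x : ℝ) :
    fund w (x + a) = fund w x * fund w a := by
  have := eq_fund_mul hw (Y := fun x => fund w (x + a)) (fun x i j n => by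
    have := matrixDeriv_fund hw (x + a) i j n
    rw [ha] at this
    exact this.comp_add_const x a) x
  simpa only [zero_add] using this

theorem fundInv_add (hw : ContDiff ℝ ∞ w) {a : ℝ} (ha : Function.Periodic w a) (x : ℝ) :
    fundInv w (x + a) = fundInv w a * fundInv w x := by
  have h : fund w (x + a) * (fundInv w a * fundInv w x) = 1 := by
    rw [fund_add hw ha, mul_assoc, ← mul_assoc (fund w a), fund_mul_fundInv hw, one_mul,
      fund_mul_fundInv hw]
  calc fundInv w (x + a) = fundInv w (x + a) * (fund w (x + a) * (fundInv w a * fundInv w x)) := by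
        rw [h, mul_one]
    _ = _ := by rw [← mul_assoc, fundInv_mul_fund hw, one_mul]

/-- The monodromy matrix with base point `x`. -/
def monodromy (w : ℝ → ℝ) (x : ℝ) : Matrix (Fin 3) (Fin 3) ℝ⟦X⟧ :=
  fund w x * fund w (2 * Real.pi) * fundInv w x

theorem monodromy_periodic (hw : ContDiff ℝ ∞ w) (hp : Function.Periodic w (2 * Real.pi)) :
    Function.Periodic (monodromy w) (2 * Real.pi) := fun x => by
  simp only [monodromy]
  rw [fund_add hw hp, fundInv_add hw hp, mul_assoc (fund w x), mul_assoc (fund w x), mul_assoc,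
    ← mul_assoc (fund w (2 * Real.pi)) (fundInv w (2 * Real.pi)), fund_mul_fundInv hw, one_mul,
    mul_assoc]

theorem matrixDeriv_monodromy (hw : ContDiff ℝ ∞ w) (x : ℝ) : MatrixDeriv (monodromy w)
    (lSeries (w x) * monodromy w x - monodromy w x * lSeries (w x)) x := by
  have := ((matrixDeriv_fund hw x).mul (MatrixDeriv.const (fund w (2 * Real.pi)) x)).mul
    (matrixDeriv_fundInv hw x)
  rwa [show fund w x * fund w (2 * Real.pi) * (fundInv w x * -lSeries (w x)) +
    (fund w x * 0 + lSeries (w x) * fund w x * fund w (2 * Real.pi)) * fundInv w x =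
    lSeries (w x) * monodromy w x - monodromy w x * lSeries (w x) by
      simp only [monodromy]; noncomm_ring] at this

theorem matrixSmooth_monodromy {E : Type} [NormedAddCommGroup E] [NormedSpace ℝ E] [ProperSpace E]
    {w : E × ℝ → ℝ} (hw : ContDiff ℝ ∞ w) :
    MatrixSmooth fun z : E × ℝ => monodromy (fun y => w (z.1, y)) z.2 :=
  ((matrixSmooth_fund hw).mul ((matrixSmooth_fund hw).comp
    (by fun_prop : ContDiff ℝ ∞ fun z : E × ℝ => (z.1, 2 * Real.pi)))).mul (matrixSmooth_fundInv hw)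

theorem matrixSmooth_transport {E : Type} [NormedAddCommGroup E] [NormedSpace ℝ E] [ProperSpace E]
    {w v : E × ℝ → ℝ} (hw : ContDiff ℝ ∞ w) (hv : ContDiff ℝ ∞ v)
    (c : Matrix (Fin 3) (Fin 3) ℝ⟦X⟧) : MatrixSmooth fun z : E × ℝ =>
      fund (fun y => v (z.1, y)) z.2 * c * fundInv (fun y => w (z.1, y)) z.2 :=
  have h1 := matrixSmooth_fund hv
  have h2 : MatrixSmooth fun _ : E × ℝ => c := fun _ _ _ => contDiff_const
  (h1.mul h2).mul (matrixSmooth_fundInv hw)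

/-- For a constant potential the monodromy matrix does not depend on the base point. -/
theorem monodromy_const (c x : ℝ) : monodromy (fun _ => c) x = fund (fun _ => c) (2 * Real.pi) := by
  have hc : ContDiff ℝ ∞ fun _ : ℝ => c := contDiff_const
  have h := fund_add hc (a := 2 * Real.pi) (fun _ => rfl) x
  rw [add_comm, fund_add hc (fun _ => rfl)] at h
  rw [monodromy, ← h, mul_assoc, fund_mul_fundInv hc, mul_one]

/-- The difference of the traces of two monodromy matrices. -/
theorem coeff_trace_fund_sub {w v : ℝ → ℝ} (hw : ContDiff ℝ ∞ w) (hv : ContDiff ℝ ∞ v) (n : ℕ) :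
    coeff (n + 1) (fund v (2 * Real.pi)).trace - coeff (n + 1) (fund w (2 * Real.pi)).trace =
      -∫ x in (0 : ℝ)..(2 * Real.pi),
        (v x - w x) * coeff n ((fund v x * fund w (2 * Real.pi) * fundInv w x) 0 2) := by
  set c := fund w (2 * Real.pi) with hc
  -- `y` runs from the trace for `w` at `0` to the trace for `v` at `2π`, because `c` cancels
  -- `fundInv w (2π)`.
  set y : ℝ → ℝ := fun x => coeff (n + 1) (c * (fundInv w x * fund v x)).trace with hy
  have hd : ∀ x, HasDerivAt y
      (-((v x - w x) * coeff n ((fund v x * c * fundInv w x) 0 2))) x := fun x => by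
    have h1 := (MatrixDeriv.const c x).mul ((matrixDeriv_fundInv hw x).mul (matrixDeriv_fund hv x))
    have h2 : SeriesDeriv (fun x => (c * (fundInv w x * fund v x)).trace) _ x :=
      SeriesDeriv.sum fun i _ => h1 i i
    refine (h2 (n + 1)).congr_deriv ?_
    -- The two matrices differ in one entry, proportional to the indeterminate; so the trace picks
    -- out the corner entry one order lower.
    have e : lSeries (v x) - lSeries (w x) = Matrix.single 2 0 (C (-(v x - w x)) * X) := by
      refine Matrix.ext fun i j => ?_
      fin_cases i <;> fin_cases j <;> try simp [lSeries]
      ring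
    have e2 : c * (fundInv w x * (lSeries (v x) * fund v x) + fundInv w x * -lSeries (w x) * fund v x) +
        0 * (fundInv w x * fund v x) =
        c * (fundInv w x * (Matrix.single 2 0 (C (-(v x - w x)) * X) * fund v x)) := by
      rw [← e]
      noncomm_ring
    change coeff (n + 1) (Matrix.trace (c * (fundInv w x * (lSeries (v x) * fund v x) +
      fundInv w x * -lSeries (w x) * fund v x) + 0 * (fundInv w x * fund v x))) = _
    have e3 : (c * (fundInv w x * (Matrix.single 2 0 (C (-(v x - w x)) * X) * fund v x))).trace =
        C (-(v x - w x)) * X * (fund v x * c * fundInv w x) 0 2 := by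
      rw [← mul_assoc, Matrix.trace_mul_comm, mul_assoc, Matrix.trace_single_mul, smul_eq_mul,
        mul_assoc (fund v x)]
    rw [e2, e3, coeff_succ_C_mul_X_mul, neg_mul]
  have hcont : Continuous fun x =>
      -((v x - w x) * coeff n ((fund v x * c * fundInv w x) 0 2)) := by
    have := matrixSmooth_transport (E := ℝ) (w := fun z : ℝ × ℝ => w z.2) (v := fun z : ℝ × ℝ => v z.2)
      (hw.comp contDiff_snd) (hv.comp contDiff_snd) c 0 2 n
    exact ((hv.continuous.sub hw.continuous).mul (this.continuous.comp
      (by fun_prop : Continuous fun x : ℝ => ((0 : ℝ), x)))).neg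
  have h := intervalIntegral.integral_eq_sub_of_hasDerivAt (f := y) (fun x _ => hd x)
    (hcont.intervalIntegrable 0 (2 * Real.pi))
  rw [intervalIntegral.integral_neg] at h
  rw [h]
  simp only [hy]
  rw [fund_zero, fundInv_zero, mul_one, mul_one, ← mul_assoc, hc, fund_mul_fundInv hw, one_mul]

end Monodromy

end OV

namespace OV

open MeasureTheory Filter Topology PerAlg

/-! ### The hierarchy -/

section Hierarchy

open PowerSeries

theorem coeff_commutator (c : ℝ) (T : Matrix (Fin 3) (Fin 3) ℝ⟦X⟧) (n : ℕ) :
    let Q := lSeries c * T - T * lSeries c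
    coeff (n + 1) (Q 0 0) = coeff (n + 1) (T 1 0) + c * coeff n (T 0 2) ∧
    coeff (n + 1) (Q 0 1) = coeff (n + 1) (T 1 1) - coeff (n + 1) (T 0 0) ∧
    coeff (n + 1) (Q 0 2) = coeff (n + 1) (T 1 2) - coeff (n + 1) (T 0 1) ∧
    coeff (n + 1) (Q 1 0) = coeff (n + 1) (T 2 0) + c * coeff n (T 1 2) ∧
    coeff (n + 1) (Q 1 1) = coeff (n + 1) (T 2 1) - coeff (n + 1) (T 1 0) ∧
    coeff (n + 1) (Q 1 2) = coeff (n + 1) (T 2 2) - coeff (n + 1) (T 1 1) ∧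
    coeff (n + 1) (Q 2 1) = -(c * coeff n (T 0 1)) - coeff (n + 1) (T 2 0) ∧
    coeff (n + 1) (Q 2 2) = -(c * coeff n (T 0 2)) - coeff (n + 1) (T 2 1) := by
  have h1 : ∀ f : ℝ⟦X⟧, coeff (n + 1) (C c * X * f) = c * coeff n f :=
    fun f => coeff_succ_C_mul_X_mul c f n
  have h2 : ∀ f : ℝ⟦X⟧, coeff (n + 1) (f * (C c * X)) = c * coeff n f := fun f => by
    rw [mul_comm, h1]
  simp only [Matrix.sub_apply, Matrix.mul_apply, Fin.sum_univ_three]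
  simp [lSeries, h1, h2]

theorem contDiff_coeff_monodromy {w : ℝ → ℝ} (hw : ContDiff ℝ ∞ w) (n : ℕ) (i j : Fin 3) :
    ContDiff ℝ ∞ fun x => coeff n (monodromy w x i j) := by
  have h1 : ContDiff ℝ ∞ fun z : ℝ × ℝ => w z.2 := hw.comp contDiff_snd
  have h2 : ContDiff ℝ ∞ fun x : ℝ => ((0 : ℝ), x) := by fun_prop
  have h3 := (matrixSmooth_monodromy h1).comp h2
  exact h3.contDiff i j n

/-- The entries of the coefficients of the monodromy matrix. -/
def entry (u : M) (n : ℕ) (i j : Fin 3) : PerAlg :=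
  ⟨fun x => coeff n (monodromy (wbar u).1 x i j), contDiff_coeff_monodromy (wbar u).contDiff n i j,
    fun x => congrArg (fun T => coeff n (T i j))
      (monodromy_periodic (wbar u).contDiff (wbar u).periodic x)⟩

theorem smoothAlgMap_entry (n : ℕ) (i j : Fin 3) : SmoothAlgMap fun u => entry u n i j :=
  fun k p hp => matrixSmooth_monodromy (smoothAlgMap_wbar k p hp) i j n

theorem D_entry_apply (u : M) (n : ℕ) (i j : Fin 3) (x : ℝ) : (D (entry u n i j)).1 x =
    coeff n ((lSeries ((wbar u).1 x) * monodromy (wbar u).1 x -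
      monodromy (wbar u).1 x * lSeries ((wbar u).1 x)) i j) :=
  (matrixDeriv_monodromy (wbar u).contDiff x i j n).deriv

theorem D_entry_succ (u : M) (n : ℕ) :
    D (entry u (n + 1) 0 0) = entry u (n + 1) 1 0 + wbar u * entry u n 0 2 ∧
    D (entry u (n + 1) 0 1) = entry u (n + 1) 1 1 - entry u (n + 1) 0 0 ∧
    D (entry u (n + 1) 0 2) = entry u (n + 1) 1 2 - entry u (n + 1) 0 1 ∧
    D (entry u (n + 1) 1 0) = entry u (n + 1) 2 0 + wbar u * entry u n 1 2 ∧
    D (entry u (n + 1) 1 1) = entry u (n + 1) 2 1 - entry u (n + 1) 1 0 ∧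
    D (entry u (n + 1) 1 2) = entry u (n + 1) 2 2 - entry u (n + 1) 1 1 ∧
    D (entry u (n + 1) 2 1) = -(wbar u * entry u n 0 1) - entry u (n + 1) 2 0 ∧
    D (entry u (n + 1) 2 2) = -(wbar u * entry u n 0 2) - entry u (n + 1) 2 1 := by
  have h := fun x => coeff_commutator ((wbar u).1 x) (monodromy (wbar u).1 x) n
  simp only at h
  refine ⟨?_, ?_, ?_, ?_, ?_, ?_, ?_, ?_⟩ <;> refine PerAlg.ext fun x => ?_ <;> rw [D_entry_apply]
  · exact (h x).1
  · exact (h x).2.1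
  · exact (h x).2.2.1
  · exact (h x).2.2.2.1
  · exact (h x).2.2.2.2.1
  · exact (h x).2.2.2.2.2.1
  · exact (h x).2.2.2.2.2.2.1
  · exact (h x).2.2.2.2.2.2.2

/-- The coefficients of the upper right entry of the monodromy matrix. -/
def cornerEntry (u : M) (n : ℕ) : PerAlg := entry u n 0 2

/-- The coefficients of the sum of the entries of the monodromy matrix above the diagonal. -/
def diagEntry (u : M) (n : ℕ) : PerAlg := entry u n 0 1 + entry u n 1 2

/-- Elimination from `T_x = [l,T]`. At order zero the potential drops out of the commutator, so the
formula for the derivative of the corner entry needs a separate case. -/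
theorem D3_diagEntry (u : M) (n : ℕ) :
    D (D (D (diagEntry u (n + 1)))) = -opA (wbar u) (cornerEntry u n) := by
  cases n with
  | zero =>
    obtain ⟨h00, h01, h02, h10, h11, h12, h21, h22⟩ := D_entry_succ u 0
    have h : D (cornerEntry u 0) = entry u 0 1 2 - entry u 0 0 1 := by
      refine PerAlg.ext fun x => ?_
      rw [cornerEntry, D_entry_apply]
      simp only [Matrix.sub_apply, Matrix.mul_apply, Fin.sum_univ_three]
      simp [lSeries, entry]
    simp only [diagEntry, map_add, map_sub, map_neg, h00, h01, h10, h11, h12, h21, h22, opA,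
      D_mul, h]
    rw [cornerEntry] at h ⊢
    rw [h]
    ring
  | succ n =>
    obtain ⟨h00, h01, h02, h10, h11, h12, h21, h22⟩ := D_entry_succ u (n + 1)
    obtain ⟨-, -, h, -⟩ := D_entry_succ u n
    simp only [diagEntry, map_add, map_sub, map_neg, h00, h01, h10, h11, h12, h21, h22, opA,
      D_mul, h, cornerEntry]
    ring

theorem D_diagEntry_zero (u : M) : D (diagEntry u 0) = entry u 0 2 2 - entry u 0 0 0 := by
  refine PerAlg.ext fun x => ?_
  simp only [diagEntry, map_add, PerAlg.add_apply, D_entry_apply]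
  simp only [Matrix.sub_apply, Matrix.mul_apply, Fin.sum_univ_three]
  simp [lSeries, entry]

theorem D5_cornerEntry (u : M) (n : ℕ) :
    D (D (D (D (D (cornerEntry u (n + 1)))))) = 3 * opB (wbar u) (diagEntry u n) := by
  have hd : D (diagEntry u n) = entry u n 2 2 - entry u n 0 0 := by
    cases n with
    | zero => exact D_diagEntry_zero u
    | succ n =>
      obtain ⟨h00, h01, h02, h10, h11, h12, h21, h22⟩ := D_entry_succ u n
      simp only [diagEntry, map_add, h01, h12]
      ring
  -- Four derivatives reduce the corner entry to the lower left one, whose own equation is `∂T₂₀ =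
  -- w(T₂₂ - T₀₀) = wS'`, with `T₂₀` one order above `S`.
  have h4 : D (D (D (D (cornerEntry u (n + 1))))) =
      6 * entry u (n + 1) 2 0 + 3 * (wbar u * diagEntry u n) := by
    obtain ⟨h00, h01, h02, h10, h11, h12, h21, h22⟩ := D_entry_succ u n
    simp only [cornerEntry, diagEntry, map_add, map_sub, map_neg, h00, h01, h02, h10, h11, h12, h21,
      h22]
    ring
  have h20 : D (entry u (n + 1) 2 0) = wbar u * D (diagEntry u n) := by
    rw [hd]
    refine PerAlg.ext fun x => ?_
    have h1 : ∀ f : ℝ⟦X⟧, coeff (n + 1) (C ((wbar u).1 x) * X * f) = (wbar u).1 x * coeff n f :=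
      fun f => coeff_succ_C_mul_X_mul _ f n
    have h2 : ∀ f : ℝ⟦X⟧, coeff (n + 1) (f * (C ((wbar u).1 x) * X)) = (wbar u).1 x * coeff n f :=
      fun f => by rw [mul_comm, h1]
    rw [D_entry_apply]
    simp only [Matrix.sub_apply, Matrix.mul_apply, Fin.sum_univ_three]
    simp [lSeries, h1, h2, entry]
    ring
  rw [h4]
  simp only [map_add, D_mul, D_ofNat, h20, opB]
  ring

/-- At order zero `l` is a nilpotent constant matrix; the corner of its exponential over the period
is `(2π)²/2`. -/
theorem cornerEntry_zero (u : M) : cornerEntry u 0 = algebraMap ℝ PerAlg (2 * Real.pi ^ 2) := by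
  refine PerAlg.ext fun x => ?_
  have hF : ∀ x i j, constantCoeff (fund (wbar u).1 x i j) = fundCoeff (wbar u).1 0 i j x :=
    fun x i j => by rw [← coeff_zero_eq_constantCoeff_apply, coeff_fund]
  have hG : ∀ x i j, constantCoeff (fundInv (wbar u).1 x i j) = invCoeff (wbar u).1 0 i j x :=
    fun x i j => by rw [← coeff_zero_eq_constantCoeff_apply, coeff_fundInv]
  change coeff 0 (monodromy (wbar u).1 x 0 2) = 2 * Real.pi ^ 2
  simp only [monodromy, Matrix.mul_apply, Fin.sum_univ_three, coeff_zero_eq_constantCoeff, map_add,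
    map_mul, hF, hG]
  simp [fundCoeff, invCoeff]
  ring

/-- The normalization of the hierarchy. -/
def scale (j : ℕ) : ℝ := ((-3 : ℝ) ^ j)⁻¹ / (2 * Real.pi ^ 2)

theorem scale_ne_zero (j : ℕ) : scale j ≠ 0 := by
  have := Real.pi_ne_zero
  exact div_ne_zero (inv_ne_zero (pow_ne_zero _ (by norm_num))) (by positivity)

theorem scale_succ (j : ℕ) : scale j = -3 * scale (j + 1) := by
  simp only [scale, pow_succ]
  field_simp

/-- The gradients of the conservation laws. -/
def flow (j : ℕ) (u : M) : M := subMean (scale j • D (D (cornerEntry u (2 * j))))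

theorem toAlg_flow (j : ℕ) (u : M) : toAlg (flow j u) = scale j • D (D (cornerEntry u (2 * j))) :=
  toAlg_subMean (by rw [map_smul, perInt_D, smul_zero])

theorem smoothMap_flow (j : ℕ) : SmoothMap (flow j) :=
  ((smoothAlgMap_entry _ 0 2).D.D.smul _).subMean

theorem flow_zero (u : M) : flow 0 u = 0 := toAlg_injective (by
  rw [toAlg_flow, mul_zero, cornerEntry_zero, D_algebraMap, map_zero, smul_zero, map_zero])

/-- The Lenard recursion. -/
theorem etaVia_flow (j : ℕ) (u : M) :
    EtaVia u ⟨(scale j • cornerEntry u (2 * j)).1, (scale j • cornerEntry u (2 * j)).2⟩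
      ⟨(-(scale j) • diagEntry u (2 * j + 1)).1, (-(scale j) • diagEntry u (2 * j + 1)).2⟩
      (Dx (flow (j + 1) u)) := by
  refine (etaVia_iff _ _ _ _).mpr ⟨?_, ?_⟩
  · simp only [D_smul, D3_diagEntry]
    simp only [opA, D_smul]
    simp only [Algebra.smul_def, map_neg]
    ring
  · have h := D5_cornerEntry u (2 * j + 1)
    rw [show 2 * j + 1 + 1 = 2 * (j + 1) by ring] at h
    rw [toAlg_Dx, toAlg_flow]
    simp only [D_smul, h]
    simp only [opB, D_smul]
    simp only [Algebra.smul_def, scale_succ j, map_neg, map_mul, map_ofNat]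
    ring

theorem eta_flow (j : ℕ) (u : M) : eta u (flow j u) (Dx (flow (j + 1) u)) :=
  ⟨_, _, fun x => by
    change iteratedDeriv 2 (scale j • cornerEntry u (2 * j)).1 x = (toAlg (flow j u)).1 x
    rw [← D_iterate_apply, toAlg_flow]
    simp, etaVia_flow j u⟩

theorem exists_etaVia_flow_one (u : M) : ∃ χ : Per, EtaVia u (constPer 1) χ (Dx (flow 1 u)) := by
  have h := etaVia_flow 0 u
  have h1 : scale 0 • cornerEntry u (2 * 0) = algebraMap ℝ PerAlg 1 := by
    rw [mul_zero, cornerEntry_zero, Algebra.smul_def, ← map_mul, scale]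
    congr 1
    have := Real.pi_ne_zero
    field_simp
  have h2 : (⟨(scale 0 • cornerEntry u (2 * 0)).1, (scale 0 • cornerEntry u (2 * 0)).2⟩ : Per) =
      constPer 1 := Subtype.ext (congrArg Subtype.val h1)
  exact ⟨_, h2 ▸ h⟩

/-! ### The conserved functionals -/

/-- The coefficients of the trace of the monodromy matrix. -/
def traceCoeff (n : ℕ) (u : M) : ℝ := coeff n (fund (wbar u).1 (2 * Real.pi)).trace

theorem smoothFunctional_traceCoeff (n : ℕ) : SmoothFunctional (traceCoeff n) := fun k p hp => by
  have h := (matrixSmooth_fund (smoothAlgMap_wbar k p hp)).comp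
    (by fun_prop : ContDiff ℝ ∞ fun s : Fin k → ℝ => (s, 2 * Real.pi))
  exact SeriesSmooth.sum (fun i _ => h i i) n

/-- In the exact formula for the difference of traces the factor `v - w` vanishes at the base point,
so only its derivative contributes, paired with the monodromy at the base point. -/
theorem hasDerivAt_traceCoeff {p : ℝ → M} (hp : SmoothMPath p) {v : M} {s : ℝ}
    (hv : HasPathDeriv (fun r => toAlg (p r)) (toAlg v) s) (n : ℕ) :
    HasDerivAt (fun r => traceCoeff (n + 1) (p r))
      (-perInt (D (D (toAlg v)) * cornerEntry (p s) n)) s := by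
  have hw : ContDiff ℝ ∞ fun z : ℝ × ℝ => (wbar (p z.1)).1 z.2 := smoothAlgMap_wbar.path hp
  have hws : ContDiff ℝ ∞ fun z : ℝ × ℝ => (wbar (p s)).1 z.2 :=
    (wbar (p s)).contDiff.comp contDiff_snd
  have hh := matrixSmooth_transport hws hw (fund (wbar (p s)).1 (2 * Real.pi)) 0 2 n
  have hg := (hw.sub hws).mul hh
  have h1 := (hasDerivAt_integral_param hg 0 (2 * Real.pi) s).neg
  have hd : ∀ x, deriv (fun r => ((wbar (p r)).1 x - (wbar (p s)).1 x) *
      coeff n ((fund (wbar (p r)).1 x * fund (wbar (p s)).1 (2 * Real.pi) *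
        fundInv (wbar (p s)).1 x) 0 2)) s = (D (D (toAlg v)) * cornerEntry (p s) n).1 x := fun x => by
    have h2 := (hasPathDeriv_wbar hv).hasDerivAt x
    have h3 := ((hh.comp (by fun_prop : ContDiff ℝ ∞ fun r : ℝ => (r, x))).differentiable
      (by simp) s).hasDerivAt
    refine ((h2.sub_const ((wbar (p s)).1 x)).mul h3).deriv.trans ?_
    rw [sub_self, zero_mul, add_zero]
    rfl
  have h4 := (h1.add_const (traceCoeff (n + 1) (p s))).congr_of_eventuallyEq
    (Eventually.of_forall fun r => sub_eq_iff_eq_add.mp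
      (coeff_trace_fund_sub (wbar (p s)).contDiff (wbar (p r)).contDiff n))
  refine h4.congr_deriv (congrArg Neg.neg ?_)
  exact intervalIntegral.integral_congr fun x _ => hd x

/-- The conserved functional with gradient `flow j`. -/
def charge (j : ℕ) (u : M) : ℝ := -scale j * traceCoeff (2 * j + 1) u

theorem hasDerivAt_charge {p : ℝ → M} (hp : SmoothMPath p) {v : M} {s : ℝ}
    (hv : HasPathDeriv (fun r => toAlg (p r)) (toAlg v) s) (j : ℕ) :
    HasDerivAt (fun r => charge j (p r)) (pair (flow j (p s)).1 v.1) s := by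
  refine ((hasDerivAt_traceCoeff hp hv (2 * j)).const_mul (-scale j)).congr_deriv ?_
  rw [pair_toAlg, toAlg_flow, smul_mul_assoc, map_smul, perInt_D2_mul, mul_comm (toAlg v), smul_eq_mul]
  ring

/-- The gradient is integrated along the ray from `0` to `u`; this transfers all properties of the
trace functional to the homotopy formula. -/
theorem homotopy_flow (j : ℕ) (u : M) : homotopy (flow j) u = charge j u - charge j 0 := by
  have hp := smoothMPath_line 0 u
  have hd : ∀ s : ℝ, HasDerivAt (fun r : ℝ => charge j (0 + r • u)) (pair (flow j (s • u)).1 u.1) s :=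
    fun s => by
      have := hasDerivAt_charge hp (hasPathDeriv_line 0 u s) j
      rwa [zero_add] at this
  have hc : Continuous fun s : ℝ => pair (flow j (s • u)).1 u.1 := by
    have := (((smoothMap_flow j).toAlg.mul (SmoothAlgMap.const (toAlg u))).perInt.differentiable
      hp).continuous
    simp only [zero_add] at this
    exact this
  rw [homotopy, intervalIntegral.integral_eq_sub_of_hasDerivAt (fun s _ => hd s)
    (hc.intervalIntegrable 0 1)]
  simp only [one_smul, zero_smul, zero_add]

theorem hasDerivAt_homotopy_flow {p : ℝ → M} (hp : SmoothMPath p) {v : M} {s : ℝ}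
    (hv : HasPathDeriv (fun r => toAlg (p r)) (toAlg v) s) (j : ℕ) :
    HasDerivAt (fun r => homotopy (flow j) (p r)) (pair (flow j (p s)).1 v.1) s := by
  simp only [homotopy_flow]
  exact (hasDerivAt_charge hp hv j).sub_const _

theorem smoothFunctional_homotopy_flow (j : ℕ) : SmoothFunctional (homotopy (flow j)) :=
  fun k p hp => by
  simp only [homotopy_flow]
  exact (contDiff_const.mul (smoothFunctional_traceCoeff _ k p hp)).sub contDiff_const

theorem hasGrad_homotopy_flow (j : ℕ) : HasGrad (homotopy (flow j)) (flow j) := fun u v => by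
  have := hasDerivAt_homotopy_flow (smoothMPath_line u v) (hasPathDeriv_line u v 0) j
  rwa [zero_smul, add_zero] at this

/-- `-K` is a value of `η` at the zero covector, and a skew relation makes such values orthogonal to
its domain. -/
theorem pair_flow_K (j : ℕ) (u : M) : pair (flow j u).1 (K u).1 = 0 := by
  have h := eta_skew (eta_zero_neg_K u) (eta_flow j u)
  have h0 : pair (0 : M).1 (Dx (flow (j + 1) u)).1 = 0 := by
    rw [pair_toAlg, map_zero, zero_mul, map_zero]
  have h1 : pair (flow j u).1 (-K u).1 = -pair (flow j u).1 (K u).1 := by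
    rw [pair_toAlg, pair_toAlg, ← map_neg perInt, map_neg]
    congr 1
    ring
  linarith

theorem homotopy_flow_const {J : Set ℝ} {u : ℝ → M} (hJ : IsOpen J) (hJ' : IsPreconnected J)
    (hu : SmoothCurve J u) (hs : IsSolution J u) (j : ℕ) {t s : ℝ} (ht : t ∈ J) (hs' : s ∈ J) :
    homotopy (flow j) (u t) = homotopy (flow j) (u s) := by
  have hd : ∀ t ∈ J, HasDerivAt (fun r => homotopy (flow j) (u r)) 0 t := by
    intro t ht
    obtain ⟨p, hp, he⟩ := hu.exists_path hJ ht
    have hv := hp.hasPathDeriv t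
    have hK : hp.velocity t = K (u t) := Subtype.ext (funext fun x => by
      rw [← hs t ht x]
      exact ((hv.hasDerivAt x).congr_of_eventuallyEq (he.mono fun r hr => by rw [hr]; rfl)).deriv.symm)
    have := hasDerivAt_homotopy_flow hp hv j
    rw [hK, ← he.self_of_nhds, pair_flow_K] at this
    exact this.congr_of_eventuallyEq (he.mono fun r hr => by simp only [hr])
  exact hJ.is_const_of_deriv_eq_zero hJ'
    (fun t ht => (hd t ht).differentiableAt.differentiableWithinAt) (fun t ht => (hd t ht).deriv) ht hs'

/-- Lenard–Magri argument: skewness of `η` and `ϑ` moves one index across, `(φ_i, ϑφ_{j+1}) =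
(φ_{i+1}, ϑφ_j)`, down to `φ_0 = 0`. -/
theorem pair_flow_Dx_flow (i j : ℕ) (u : M) : pair (flow i u).1 (Dx (flow j u)).1 = 0 := by
  induction j generalizing i with
  | zero => rw [pair_Dx, flow_zero, pair_toAlg, map_zero, zero_mul, map_zero, neg_zero]
  | succ j ih =>
    have h := eta_skew (eta_flow i u) (eta_flow j u)
    rw [pair_Dx (flow j u)] at h
    have := ih (i + 1)
    linarith

/-- Skewness against the known value `ϑφ_{i+1}` at `φ_i` treats all values at `φ_j` at once. -/
theorem pair_flow_eta (i j : ℕ) {u v : M} (h : eta u (flow j u) v) : pair (flow i u).1 v.1 = 0 := by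
  have h1 := eta_skew (eta_flow i u) h
  rw [pair_flow_Dx_flow] at h1
  linarith

end Hierarchy

end OV

namespace OV

open MeasureTheory Filter Topology PerAlg

/-! ### Linear independence -/

section Linearization

theorem D_entry_zero_potential (n : ℕ) (i j : Fin 3) : D (entry 0 n i j) = 0 := by
  have hw : (wbar 0).1 = fun _ => 1 / 3 := funext fun x => by
    simp only [wbar, map_zero, zero_add, algebraMap_apply]
  refine PerAlg.ext fun x => ?_
  have h : (entry 0 n i j).1 = fun _ =>
      PowerSeries.coeff n (fund (fun _ => 1 / 3) (2 * Real.pi) i j) := funext fun x => by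
    change PowerSeries.coeff n (monodromy (wbar 0).1 x i j) = _
    rw [hw, monodromy_const]
  rw [D_apply, h, deriv_const]
  rfl

/-- The coefficients of the upper right entry at `u = 0`. -/
def cornerConst (n : ℕ) : ℝ := (cornerEntry 0 n).1 0

/-- The coefficients of the sum of the entries above the diagonal at `u = 0`. -/
def diagConst (n : ℕ) : ℝ := (diagEntry 0 n).1 0

theorem cornerEntry_zero_potential (n : ℕ) :
    cornerEntry 0 n = algebraMap ℝ PerAlg (cornerConst n) :=
  eq_algebraMap_of_D_eq_zero (D_entry_zero_potential n 0 2)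

theorem diagEntry_zero_potential (n : ℕ) : diagEntry 0 n = algebraMap ℝ PerAlg (diagConst n) :=
  eq_algebraMap_of_D_eq_zero (by
    rw [diagEntry, map_add, D_entry_zero_potential, D_entry_zero_potential, add_zero])

theorem cornerConst_zero : cornerConst 0 = 2 * Real.pi ^ 2 := by
  rw [cornerConst, cornerEntry_zero, algebraMap_apply]

theorem smoothAlgMap_diagEntry (n : ℕ) : SmoothAlgMap fun u => diagEntry u n :=
  (smoothAlgMap_entry n 0 1).add (smoothAlgMap_entry n 1 2)

/-- The linearizations at `u = 0` of the gradients of the conservation laws, as functions of the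
inverse square of the wave number. -/
def symbol : ℕ → Polynomial ℝ
  | 0 => 0
  | j + 1 => Polynomial.C 3 * (Polynomial.X ^ 3 * symbol j) -
      Polynomial.C (6 * cornerConst (2 * j)) * Polynomial.X ^ 2 -
      Polynomial.C (3 * diagConst (2 * j + 1)) * Polynomial.X

variable {e : M} {κ : ℝ}

theorem perInt_D_mul_D (he : D (D (toAlg e)) = -κ • toAlg e) (f : PerAlg) :
    perInt (D f * D (toAlg e)) = κ * perInt (f * toAlg e) := by
  rw [← neg_neg (perInt (D f * _)), ← perInt_mul_D, he, mul_smul_comm, map_smul, smul_eq_mul]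
  ring

theorem perInt_D3_mul_D (he : D (D (toAlg e)) = -κ • toAlg e) (f : PerAlg) :
    perInt (D (D (D f)) * D (toAlg e)) = -κ ^ 2 * perInt (f * toAlg e) := by
  rw [perInt_D_mul_D he, perInt_D2_mul, he, mul_smul_comm, map_smul, smul_eq_mul]
  ring

/-- Both monodromy recursions are differentiated at `u = 0`, where `ū = 1/3` and the entries are
constants, and are paired with `e'`. As `e` is an eigenfunction of `∂²`, they become scalar
recursions for pairings with `e`. -/
theorem exists_linearization (he : D (D (toAlg e)) = -κ • toAlg e) (hκ : κ ≠ 0) :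
    ∃ p s : ℕ → PerAlg,
      (∀ n, HasPathDeriv (fun r : ℝ => cornerEntry (0 + r • e) n) (p n) 0) ∧
      perInt (p 0 * toAlg e) = 0 ∧
      (∀ n, κ * perInt (s (n + 1) * toAlg e) = perInt (p n * toAlg e) -
        2 * κ * cornerConst n * perInt (toAlg e * toAlg e)) ∧
      ∀ n, κ ^ 2 * perInt (p (n + 1) * toAlg e) = 3 * perInt (s n * toAlg e) -
        3 * κ * diagConst n * perInt (toAlg e * toAlg e) := by
  have hp := smoothMPath_line 0 e
  have hP := fun n => ((smoothAlgMap_entry n 0 2).path hp).hasPathDeriv 0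
  have hS := fun n => ((smoothAlgMap_diagEntry n).path hp).hasPathDeriv 0
  set p := fun n => ((smoothAlgMap_entry n 0 2).path hp).pathDeriv 0
  set s := fun n => ((smoothAlgMap_diagEntry n).path hp).pathDeriv 0
  replace hP : ∀ n, HasPathDeriv (fun r : ℝ => cornerEntry (0 + r • e) n) (p n) 0 := hP
  replace hS : ∀ n, HasPathDeriv (fun r : ℝ => diagEntry (0 + r • e) n) (s n) 0 := hS
  have hw := hasPathDeriv_wbar (hasPathDeriv_line 0 e 0)
  have h0 : (0 : M) + (0 : ℝ) • e = 0 := by rw [zero_smul, add_zero]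
  have hw0 : wbar 0 = algebraMap ℝ PerAlg (1 / 3) := by simp only [wbar, map_zero, zero_add]
  have h3 : 3 * algebraMap ℝ PerAlg (1 / 3) = 1 := by
    rw [← map_ofNat (algebraMap ℝ PerAlg) 3, ← map_mul]
    norm_num
  have hconst : ∀ (c : ℝ) (f : PerAlg), perInt (algebraMap ℝ PerAlg c * f) = c * perInt f :=
    fun c f => by rw [← Algebra.smul_def, map_smul, smul_eq_mul]
  have he3 : perInt (D (D (D (toAlg e))) * D (toAlg e)) = -κ ^ 2 * perInt (toAlg e * toAlg e) :=
    perInt_D3_mul_D he _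
  refine ⟨p, s, hP, ?_, fun n => ?_, fun n => ?_⟩
  · have h1 := hP 0
    simp only [cornerEntry_zero] at h1
    rw [h1.unique (HasPathDeriv.const _), zero_mul, map_zero]
  · have h1 := hasPathDeriv_opA hw (hP n)
    have h2 := (hS (n + 1)).D.D.D
    simp only [D3_diagEntry] at h2
    have h4 := (h2.add h1).unique ((HasPathDeriv.const 0).congr (Eventually.of_forall fun r =>
      neg_add_cancel _))
    simp only [h0, opA, hw0, cornerEntry_zero_potential, D_algebraMap] at h4
    have h5 : D (D (D (s (n + 1)))) = -D (p n) -
        algebraMap ℝ PerAlg (2 * cornerConst n) * D (D (D (toAlg e))) := by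
      rw [map_mul, map_ofNat]
      linear_combination h4 - D (p n) * h3
    have h6 := congrArg (fun f => perInt (f * D (toAlg e))) h5
    simp only [sub_mul, map_sub, perInt_D3_mul_D he, mul_assoc, hconst] at h6
    have h7 : perInt (-D (p n) * D (toAlg e)) = -(κ * perInt (p n * toAlg e)) := by
      rw [← perInt_D_mul_D he, ← map_neg perInt]
      congr 1
      ring
    rw [h7] at h6
    refine mul_left_cancel₀ hκ ?_
    linear_combination -h6
  · have h1 := HasPathDeriv.constMul 3 (hasPathDeriv_opB hw (hS n))
    have h2 := (hP (n + 1)).D.D.D.D.D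
    simp only [D5_cornerEntry] at h2
    have h4 := h2.unique h1
    simp only [h0, opB, hw0, diagEntry_zero_potential, D_algebraMap] at h4
    have h5 : D (D (D (D (D (p (n + 1)))))) = 3 * D (s n) +
        algebraMap ℝ PerAlg (3 * diagConst n) * D (D (D (toAlg e))) := by
      rw [map_mul, map_ofNat]
      linear_combination h4 + 3 * D (s n) * h3
    have h6 := congrArg (fun f => perInt (f * D (toAlg e))) h5
    simp only [add_mul, map_add, perInt_D3_mul_D he, mul_assoc, hconst] at h6
    have h7 : perInt (3 * (D (s n) * D (toAlg e))) = 3 * (κ * perInt (s n * toAlg e)) := by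
      rw [← perInt_D_mul_D he, ← hconst, map_ofNat]
    rw [h7, perInt_D2_mul, he, mul_smul_comm, map_smul, smul_eq_mul] at h6
    refine mul_left_cancel₀ hκ ?_
    linear_combination h6

/-- Eliminating the diagonal sums from two successive scalar recursions and dividing by `κ³` gives
the recursion of `symbol` at `1/κ`. -/
theorem hasDerivAt_pair_flow (he : D (D (toAlg e)) = -κ • toAlg e) (hκ : κ ≠ 0) (j : ℕ) :
    HasDerivAt (fun r : ℝ => pair (flow j (0 + r • e)).1 e.1)
      (-κ * scale j * perInt (toAlg e * toAlg e) * (symbol j).eval κ⁻¹) 0 := by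
  obtain ⟨p, s, hp, hp0, hs, hps⟩ := exists_linearization he hκ
  have hsym : ∀ j, perInt (p (2 * j) * toAlg e) =
      perInt (toAlg e * toAlg e) * (symbol j).eval κ⁻¹ := by
    intro j
    induction j with
    | zero => simp [hp0, symbol]
    | succ j ih =>
      have h1 := hs (2 * j)
      have h2 := hps (2 * j + 1)
      rw [ih] at h1
      rw [show 2 * (j + 1) = 2 * j + 1 + 1 by ring]
      simp only [symbol, Polynomial.eval_sub, Polynomial.eval_mul, Polynomial.eval_pow,
        Polynomial.eval_C, Polynomial.eval_X]
      refine mul_left_cancel₀ (pow_ne_zero 3 hκ) ?_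
      have e1 : κ ^ 3 * perInt (p (2 * j + 1 + 1) * toAlg e) =
          3 * (κ * perInt (s (2 * j + 1) * toAlg e)) -
          3 * κ ^ 2 * diagConst (2 * j + 1) * perInt (toAlg e * toAlg e) := by
        linear_combination κ * h2
      rw [e1, h1]
      field_simp
      ring
  have hpair : ∀ r : ℝ, pair (flow j (0 + r • e)).1 e.1 =
      -κ * scale j * perInt (cornerEntry (0 + r • e) (2 * j) * toAlg e) := fun r => by
    rw [pair_toAlg, toAlg_flow, smul_mul_assoc, map_smul, perInt_D2_mul, he, mul_smul_comm, map_smul,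
      smul_eq_mul, smul_eq_mul]
    ring
  simp only [hpair]
  have hd := ((smoothAlgMap_entry (2 * j) 0 2).mul (SmoothAlgMap.const (toAlg e))).hasDerivAt_perInt
    (smoothMPath_line 0 e) ((hp (2 * j)).mul (HasPathDeriv.const (toAlg e)))
  refine (hd.const_mul (-κ * scale j)).congr_deriv ?_
  rw [mul_zero, zero_add, hsym]
  ring

theorem coeff_symbol (j n : ℕ) (hn : 3 * j + 2 < n) : (symbol (j + 1)).coeff n = 0 := by
  induction j generalizing n with
  | zero =>
    obtain ⟨n, rfl⟩ : ∃ m, n = m + 3 := ⟨n - 3, by omega⟩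
    simp [symbol]
  | succ j ih =>
    obtain ⟨n, rfl⟩ : ∃ m, n = m + 3 := ⟨n - 3, by omega⟩
    rw [symbol]
    simp only [Polynomial.coeff_sub, Polynomial.coeff_C_mul, Polynomial.coeff_X_pow_mul,
      Polynomial.coeff_X_pow, Polynomial.coeff_X]
    rw [ih n (by omega), if_neg (by omega), if_neg (by omega)]
    ring

/-- The leading term starts as `-6·2π²X²` and each step multiplies it by `3X³`; the remaining terms
have degree at most two and do not interfere. -/
theorem coeff_symbol_ne_zero (j : ℕ) : (symbol (j + 1)).coeff (3 * j + 2) ≠ 0 := by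
  induction j with
  | zero =>
    rw [symbol, symbol]
    simp only [Polynomial.coeff_sub, Polynomial.coeff_C_mul, Polynomial.coeff_X_pow,
      Polynomial.coeff_X, mul_zero, Polynomial.coeff_zero, cornerConst_zero]
    simp [Real.pi_ne_zero]
  | succ j ih =>
    rw [symbol, show 3 * (j + 1) + 2 = 3 * j + 2 + 3 by ring]
    simp only [Polynomial.coeff_sub, Polynomial.coeff_C_mul, Polynomial.coeff_X_pow_mul,
      Polynomial.coeff_X_pow, Polynomial.coeff_X]
    rw [if_neg (by omega), if_neg (by omega)]
    simpa using ih

theorem cos_mul_mem_M (k : ℕ) : (fun x => Real.cos (((k : ℝ) + 1) * x)) ∈ M := by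
  have hk : (k : ℝ) + 1 ≠ 0 := by positivity
  refine ⟨⟨by fun_prop, fun x => ?_⟩, ?_⟩
  · have := Real.cos_add_nat_mul_two_pi (((k : ℝ) + 1) * x) (k + 1)
    refine Eq.trans (congrArg Real.cos ?_) this
    push_cast
    ring
  · rw [intervalIntegral.integral_comp_mul_left _ hk, integral_cos, mul_zero, Real.sin_zero]
    have := Real.sin_nat_mul_pi (2 * (k + 1))
    push_cast at this
    rw [show ((k : ℝ) + 1) * (2 * Real.pi) = 2 * ((k : ℝ) + 1) * Real.pi by ring, this]
    simp

/-- The Fourier modes. -/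
def mode (k : ℕ) : M := ⟨_, cos_mul_mem_M k⟩

theorem D_D_mode (k : ℕ) : D (D (toAlg (mode k))) = -(((k : ℝ) + 1) ^ 2) • toAlg (mode k) := by
  have h1 : ∀ x, HasDerivAt (fun x => ((k : ℝ) + 1) * x) ((k : ℝ) + 1) x := fun x => by
    simpa using (hasDerivAt_id x).const_mul ((k : ℝ) + 1)
  have h2 : (D (toAlg (mode k))).1 = fun x => -Real.sin (((k : ℝ) + 1) * x) * ((k : ℝ) + 1) :=
    funext fun x => (h1 x).cos.deriv
  refine PerAlg.ext fun x => ?_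
  rw [D_apply, h2]
  refine ((h1 x).sin.neg.mul_const _).deriv.trans ?_
  change -(Real.cos (((k : ℝ) + 1) * x) * ((k : ℝ) + 1)) * ((k : ℝ) + 1) =
    -(((k : ℝ) + 1) ^ 2) * Real.cos (((k : ℝ) + 1) * x)
  ring

theorem perInt_mode_ne_zero (k : ℕ) : perInt (toAlg (mode k) * toAlg (mode k)) ≠ 0 := fun h => by
  have h1 := congrArg (fun f : PerAlg => f.1 0) (eq_zero_of_perInt_mul_self h)
  change Real.cos (((k : ℝ) + 1) * 0) = 0 at h1
  simp at h1

end Linearization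

theorem linearIndependent_homotopy_flow :
    LinearIndependent ℝ (fun j : ℕ => homotopy (flow (j + 1))) := by
  rw [linearIndependent_iff]
  intro l hl
  have h0 : ∀ u, ∑ j ∈ l.support, l j * homotopy (flow (j + 1)) u = 0 := fun u => by
    have := congrFun hl u
    simpa [Finsupp.linearCombination_apply, Finsupp.sum] using this
  -- The relation is differentiated once at an arbitrary point, and below once more at `u = 0` along
  -- each Fourier mode.
  have h1 : ∀ u v : M, ∑ j ∈ l.support, l j * pair (flow (j + 1) u).1 v.1 = 0 := fun u v => by
    have hd := HasDerivAt.fun_sum (u := l.support) fun j _ =>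
      ((hasGrad_homotopy_flow (j + 1)) u v).const_mul (l j)
    simp only [h0] at hd
    exact hd.unique (hasDerivAt_const _ _)
  set G : Polynomial ℝ := ∑ j ∈ l.support, Polynomial.C (l j * scale (j + 1)) * symbol (j + 1)
    with hG
  have h2 : ∀ k : ℕ, G.IsRoot ((((k : ℝ) + 1) ^ 2)⁻¹) := fun k => by
    have hκ : ((k : ℝ) + 1) ^ 2 ≠ 0 := by positivity
    have hd := HasDerivAt.fun_sum (u := l.support) fun j _ =>
      (hasDerivAt_pair_flow (D_D_mode k) hκ (j + 1)).const_mul (l j)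
    simp only [h1] at hd
    have h3 := hd.unique (hasDerivAt_const _ _)
    have h4 : -((k : ℝ) + 1) ^ 2 * perInt (toAlg (mode k) * toAlg (mode k)) *
        G.eval ((((k : ℝ) + 1) ^ 2)⁻¹) = 0 := by
      rw [← h3, hG, Polynomial.eval_finsetSum, Finset.mul_sum]
      refine Finset.sum_congr rfl fun j _ => ?_
      rw [Polynomial.eval_mul, Polynomial.eval_C]
      ring
    exact (mul_eq_zero.mp h4).resolve_left
      (mul_ne_zero (neg_ne_zero.mpr hκ) (perInt_mode_ne_zero k))
  have hG0 : G = 0 := by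
    refine Polynomial.eq_zero_of_infinite_isRoot G (Set.infinite_of_injective_forall_mem
      (f := fun k : ℕ => (((k : ℝ) + 1) ^ 2)⁻¹) (fun a b hab => ?_) h2)
    have h5 := inv_injective hab
    have h6 := (pow_left_inj₀ (by positivity) (by positivity) two_ne_zero).mp h5
    exact_mod_cast add_right_cancel h6
  by_contra hne
  have hs : l.support.Nonempty := Finsupp.support_nonempty_iff.mpr hne
  set m := l.support.max' hs with hm
  -- The degrees `3j + 2` increase with `j`, so only the largest index in the support reaches this
  -- coefficient.
  have hc : G.coeff (3 * m + 2) = l m * scale (m + 1) * (symbol (m + 1)).coeff (3 * m + 2) := by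
    rw [hG, Polynomial.finsetSum_coeff, Finset.sum_eq_single m]
    · rw [Polynomial.coeff_C_mul]
    · intro j hj hjm
      have : j < m := lt_of_le_of_ne (Finset.le_max' _ _ hj) hjm
      rw [Polynomial.coeff_C_mul, coeff_symbol j _ (by omega), mul_zero]
    · intro h
      exact absurd (Finset.max'_mem _ hs) h
  rw [hG0, Polynomial.coeff_zero] at hc
  exact mul_ne_zero (mul_ne_zero (Finsupp.mem_support_iff.mp (Finset.max'_mem _ hs))
    (scale_ne_zero _)) (coeff_symbol_ne_zero m) hc.symm

end OV

end

theorem proposition3p2 :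
    -- Lax representation, scalar and matrix
    (∀ (J : Set ℝ) (u : ℝ → OV.M), IsOpen J → IsPreconnected J → OV.SmoothCurve J u →
      ∀ μ : ℂ, μ ≠ 0 →
        (∀ f : ℝ → ℝ → ℂ, OV.SmoothOver J f →
          (OV.ScalarLax J u μ f ↔ OV.MatrixLax J u μ (OV.jet f))) ∧
        (∀ h : Fin 3 → ℝ → ℝ → ℂ, (∀ i, OV.SmoothOver J (h i)) → OV.MatrixLax J u μ h →
          ∀ t ∈ J, ∀ x, ∀ i, h i t x = OV.jet (h 0) i t x) ∧
        (OV.IsSolution J u ↔ OV.Compatible J (OV.ScalarLax J u μ)) ∧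
        (OV.IsSolution J u ↔ OV.Compatible J (OV.AdjointLax J u μ)) ∧
        (OV.IsSolution J u ↔ OV.ZeroCurvature J u μ)) ∧
    -- compatible Poisson structures
    OV.IsPoisson OV.theta ∧ OV.IsPoisson OV.eta ∧ (∀ κ : ℝ, OV.IsPoisson (OV.pencil κ)) ∧
    -- the flow is Hamiltonian for both
    OV.SmoothMap OV.K ∧
    (∃ g : OV.M → OV.M, OV.SmoothMap g ∧ OV.HasGrad OV.H g ∧
      ∀ u, OV.theta u (g u) (-OV.K u)) ∧
    (∃ g : OV.M → OV.M, OV.SmoothMap g ∧ OV.HasGrad OV.Hbar g ∧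
      ∀ u, OV.eta u (g u) (-OV.K u) ∧
        ∃ χ : OV.Per, OV.EtaVia u (OV.constPer (1 / 2)) χ (-OV.K u)) ∧
    -- the hierarchy of conservation laws
    (∃ φ : ℕ → OV.M → OV.M,
      (∀ j, OV.SmoothMap (φ j)) ∧
      (∀ u, OV.theta u (φ 0 u) 0) ∧
      (∀ j u, OV.Recursion u (φ j u) (φ (j + 1) u)) ∧
      (∀ u, ∃ χ : OV.Per, OV.EtaVia u (OV.constPer 1) χ (OV.Dx (φ 1 u))) ∧
      (∀ j, OV.SmoothFunctional (OV.homotopy (φ j)) ∧ OV.HasGrad (OV.homotopy (φ j)) (φ j)) ∧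
      (∀ (j : ℕ) (J : Set ℝ) (u : ℝ → OV.M), IsOpen J → IsPreconnected J →
        OV.SmoothCurve J u → OV.IsSolution J u →
        ∀ t ∈ J, ∀ s ∈ J, OV.homotopy (φ j) (u t) = OV.homotopy (φ j) (u s)) ∧
      (∀ i j u, OV.pair (φ i u).1 (OV.Dx (φ j u)).1 = 0) ∧
      (∀ i j u v, OV.eta u (φ j u) v → OV.pair (φ i u).1 v.1 = 0) ∧
      LinearIndependent ℝ (fun j : ℕ => OV.homotopy (φ (j + 1)))) := by
  refine ⟨fun J u hJ hJ' hu μ hμ => ⟨fun f hf => OV.scalarLax_iff_matrixLax hμ hJ hf,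
      fun h _ hh t ht x i => OV.matrixLax_eq_jet hh ht x i,
      OV.isSolution_iff_compatible hu hJ hJ' hμ, OV.isSolution_iff_compatible_adjoint hu hJ hJ' hμ,
      (OV.zeroCurvature_iff hu hJ hμ).symm⟩,
    OV.isPoisson_theta, OV.isPoisson_eta, OV.isPoisson_pencil, OV.smoothMap_K,
    ⟨OV.gradH, OV.smoothMap_gradH, OV.hasGrad_H, OV.theta_gradH⟩,
    ⟨fun _ => 0, OV.smoothMap_const 0, OV.hasGrad_Hbar, fun u =>
      ⟨OV.eta_zero_neg_K u, _, OV.etaVia_neg_K u⟩⟩,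
    OV.flow, OV.smoothMap_flow, fun u => ?_, fun j u => ⟨_, OV.eta_flow j u, rfl⟩,
    OV.exists_etaVia_flow_one,
    fun j => ⟨OV.smoothFunctional_homotopy_flow j, OV.hasGrad_homotopy_flow j⟩,
    fun j J u hJ hJ' hu hs t ht s hs' => OV.homotopy_flow_const hJ hJ' hu hs j ht hs',
    OV.pair_flow_Dx_flow, fun i j u v h => OV.pair_flow_eta i j h,
    OV.linearIndependent_homotopy_flow⟩
  rw [OV.flow_zero]
  exact (OV.eq_zero_of_D_toAlg (by simp)).symm
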